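/- Let $s>1/2$, and let $u_0\in H^{s+6}(\mathbb R)$, $v_0\in H^{s+7}(\mathbb R)$ be real-valued, where $\|f\|_{H^{s}}=\big(\int_{\mathbb R}(1+\xi^2)^s|\widehat f(\xi)|^2\,d\xi\big)^{1/2}$. Put $$w_0^+=\tfrac12(u_0-v_0),\qquad w_0^-=\tfrac12(u_0+v_0).$$ Then there is a constant $C>0$, depending only on $s,u_0,v_0$, such that for every $t^*>0$ there exists $\delta^*\in(0,1]$ with the following property. For all $0<\varepsilon\le\delta\le\delta^*$: (i) the improved Boussinesq equation $$u_{tt}-u_{xx}-\delta^2u_{xxtt}-\varepsilon(u^2)_{xx}=0,\qquad u(x,0)=u_0(x),\quad u_t(x,0)=(v_0)_x(x),$$ has a unique solution $u=u^{\varepsilon,\delta}\in C^2([0,t^*],H^s(\mathbb R))$; (ii) the two uncoupled Benjamin–Bona–Mahony equations $$w^+_t+w^+_x+\varepsilon w^+w^+_x-\tfrac34\delta^2w^+_{xxx}-\tfrac54\delta^2w^+_{xxt}=0,\qquad w^+(x,0)=w^+_0(x),$$ $$w^-_t-w^-_x-\varepsilon w^-w^-_x+\tfrac34\delta^2w^-_{xxx}-\tfrac54\delta^2w^-_{xxt}=0,\qquad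 w^-(x,0)=w^-_0(x),$$ have unique solutions $w^\pm=(w^\pm)^{\varepsilon,\delta}\in C([0,t^*],H^{s+5}(\mathbb R))\cap C^1([0,t^*],H^{s+4}(\mathbb R))$; (iii) for all $t\in[0,t^*]$, $$\|u^{\varepsilon,\delta}(t)-(w^+)^{\varepsilon,\delta}(t)-(w^-)^{\varepsilon,\delta}(t)\|_{H^s}\le C\big((\varepsilon+\delta^2)+(\varepsilon+\delta^4)t\big).$$ The equations hold in the sense of distributions in $x$ for every $t\in[0,t^*]$, the time derivatives being those of the Sobolev-space-valued functions (one-sided at the end points). Uniqueness also holds on shorter intervals: any solution, in the same class, on $[0,T]$ with $0<T\le t^*$ agrees with the solution above on $[0,T]$. -/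

import Mathlib

open MeasureTheory Set
open scoped FourierTransform SchwartzMap ENNReal

namespace Boussinesq

/-- Real-valued square integrable functions on the line. -/
abbrev L2 : Type := Lp ℝ 2 (volume : Measure ℝ)

/-- The inclusion of real-valued into complex-valued square integrable functions. -/
noncomputable def complexify : L2 →L[ℝ] Lp ℂ 2 (volume : Measure ℝ) :=
  Complex.ofRealCLM.compLpL 2 volume

/-- The Fourier side of `(1 - D²)^{s/2} f`. Mathlib's transform `𝓕 f η = ∫ e^{-2πixη} f(x) dx` is
taken at the frequency `η`, which corresponds to the wave number `ξ = 2πη`. -/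
noncomputable def weightedFourier (s : ℝ) (f : L2) : ℝ → ℂ :=
  fun η => ((1 + (2 * Real.pi * η) ^ 2) ^ (s / 2) : ℝ) • (𝓕 (complexify f) : Lp ℂ 2 volume) η

/-- The norm `‖f‖_{H^s} = (∫ (1 + ξ²)^s |f̂(ξ)|² dξ)^{1/2}`, with value `∞` when `f` does not lie
in `H^s`. The transform `f̂` in this formula is the unitary one, so that `‖f‖_{H^0} = ‖f‖_{L²}`. -/
noncomputable def sobolevENorm (s : ℝ) (f : L2) : ℝ≥0∞ :=
  eLpNorm (weightedFourier s f) 2 volume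

lemma weightedFourier_aestronglyMeasurable (s : ℝ) (f : L2) :
    AEStronglyMeasurable (weightedFourier s f) volume := by
  have h : AEStronglyMeasurable
      (fun η : ℝ => ((1 + (2 * Real.pi * η) ^ 2) ^ (s / 2) : ℝ)) volume :=
    Measurable.aestronglyMeasurable (by fun_prop)
  exact h.smul (Lp.aestronglyMeasurable (𝓕 (complexify f) : Lp ℂ 2 (volume : Measure ℝ)))

lemma weightedFourier_add (s : ℝ) (f g : L2) :
    weightedFourier s (f + g) =ᵐ[volume] weightedFourier s f + weightedFourier s g := by
  have h : (𝓕 (complexify (f + g)) : Lp ℂ 2 (volume : Measure ℝ))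
      = 𝓕 (complexify f) + 𝓕 (complexify g) := by
    rw [map_add, FourierTransform.fourier_add]
  filter_upwards [Lp.coeFn_add (𝓕 (complexify f) : Lp ℂ 2 (volume : Measure ℝ))
    (𝓕 (complexify g))] with η hη
  simp only [weightedFourier, h, hη, Pi.add_apply, smul_add]

lemma weightedFourier_smul (s c : ℝ) (f : L2) :
    weightedFourier s (c • f) =ᵐ[volume] c • weightedFourier s f := by
  have h : (𝓕 (complexify (c • f)) : Lp ℂ 2 (volume : Measure ℝ))
      = (c : ℂ) • 𝓕 (complexify f) := by
    rw [map_smul, ← FourierTransform.fourier_smul]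
    rfl
  filter_upwards [Lp.coeFn_smul (c : ℂ) (𝓕 (complexify f) : Lp ℂ 2 (volume : Measure ℝ))]
    with η hη
  simp only [weightedFourier, h, hη, Pi.smul_apply]
  rw [smul_comm, Complex.coe_smul]

/-- The real-valued functions of the Sobolev space `H^s(ℝ)`, `s ≥ 0`, as a subspace of `L²(ℝ)`. -/
noncomputable def sobolevSubmodule (s : ℝ) : Submodule ℝ L2 where
  carrier := {f | sobolevENorm s f < ∞}
  add_mem' {f g} hf hg := by
    have hf' : MemLp (weightedFourier s f) 2 volume :=
      ⟨weightedFourier_aestronglyMeasurable s f, hf⟩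
    have hg' : MemLp (weightedFourier s g) 2 volume :=
      ⟨weightedFourier_aestronglyMeasurable s g, hg⟩
    exact ((memLp_congr_ae (weightedFourier_add s f g)).2 (hf'.add hg')).2
  zero_mem' := by
    have h := weightedFourier_smul s 0 0
    rw [zero_smul, zero_smul] at h
    change eLpNorm _ 2 volume < ∞
    rw [eLpNorm_congr_ae h]
    simp
  smul_mem' c f hf := by
    have hf' : MemLp (weightedFourier s f) 2 volume :=
      ⟨weightedFourier_aestronglyMeasurable s f, hf⟩
    exact ((memLp_congr_ae (weightedFourier_smul s c f)).2 (hf'.const_smul c)).2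

/-- The space `H^s(ℝ)`, `s ≥ 0`, of real-valued functions, with the norm of `H^s` (and not with the
norm of `L²`). -/
def SobolevH (s : ℝ) : Type := sobolevSubmodule s

namespace SobolevH

noncomputable instance (s : ℝ) : AddCommGroup (SobolevH s) :=
  inferInstanceAs (AddCommGroup (sobolevSubmodule s))

noncomputable instance (s : ℝ) : Module ℝ (SobolevH s) :=
  inferInstanceAs (Module ℝ (sobolevSubmodule s))

/-- The inclusion `H^s ⊆ L²`. -/
noncomputable def toL2 (s : ℝ) : SobolevH s →ₗ[ℝ] L2 := (sobolevSubmodule s).subtype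

lemma memLp {s : ℝ} (f : SobolevH s) : MemLp (weightedFourier s (toL2 s f)) 2 volume :=
  ⟨weightedFourier_aestronglyMeasurable s _, f.2⟩

/-- The map `f ↦ (1 + ξ²)^{s/2} f̂` into `L²`, which is an isometry for the norm of `H^s`. -/
noncomputable def weighted (s : ℝ) : SobolevH s →ₗ[ℝ] Lp ℂ 2 (volume : Measure ℝ) where
  toFun f := (memLp f).toLp _
  map_add' f g := by
    rw [← MemLp.toLp_add, MemLp.toLp_eq_toLp_iff, map_add]
    exact weightedFourier_add s _ _
  map_smul' c f := by
    rw [RingHom.id_apply, ← MemLp.toLp_const_smul, MemLp.toLp_eq_toLp_iff, map_smul]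
    exact weightedFourier_smul s c _

lemma weighted_injective (s : ℝ) : Function.Injective (weighted s) := by
  refine (injective_iff_map_eq_zero _).2 fun f hf => ?_
  have h0 : weightedFourier s (toL2 s f) =ᵐ[volume] 0 := by
    have h1 := (memLp f).coeFn_toLp
    have h2 : ((memLp f).toLp _ : Lp ℂ 2 (volume : Measure ℝ)) = 0 := hf
    rw [h2] at h1
    exact h1.symm.trans (Lp.coeFn_zero _ _ _)
  have h3 : (𝓕 (complexify (toL2 s f)) : Lp ℂ 2 (volume : Measure ℝ)) = 0 := by
    refine Lp.ext ?_
    filter_upwards [h0, Lp.coeFn_zero ℂ 2 (volume : Measure ℝ)] with η hη h0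
    rw [h0]
    have hpos : (1 + (2 * Real.pi * η) ^ 2) ^ (s / 2) ≠ 0 :=
      (Real.rpow_pos_of_pos (by positivity) _).ne'
    exact (smul_eq_zero.1 hη).resolve_left hpos
  have h4 : complexify (toL2 s f) = 0 := by
    rw [← norm_eq_zero, ← Lp.norm_fourier_eq, h3, norm_zero]
  have h5 : toL2 s f = 0 := by
    refine Lp.ext ?_
    have h6 := Complex.ofRealCLM.coeFn_compLpL (p := 2) (μ := (volume : Measure ℝ)) (toL2 s f)
    change (complexify (toL2 s f) : ℝ → ℂ) =ᵐ[volume] _ at h6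
    rw [h4] at h6
    filter_upwards [h6, Lp.coeFn_zero ℂ 2 (volume : Measure ℝ),
      Lp.coeFn_zero ℝ 2 (volume : Measure ℝ)] with x h7 h8 h9
    rw [h8] at h7
    rw [h9]
    exact (Complex.ofReal_eq_zero.1 h7.symm)
  exact Subtype.ext h5

noncomputable instance (s : ℝ) : NormedAddCommGroup (SobolevH s) :=
  NormedAddCommGroup.induced _ _ (weighted s) (weighted_injective s)

noncomputable instance (s : ℝ) : NormedSpace ℝ (SobolevH s) :=
  NormedSpace.induced _ _ _ (weighted s)

lemma norm_eq {s : ℝ} (f : SobolevH s) : ‖f‖ = (sobolevENorm s (toL2 s f)).toReal :=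
  Lp.norm_toLp _ (memLp f)

end SobolevH

/-- `u ∈ C^k([0,T], H^s)`. The value `u t` is the function `u(·,t)`; values outside `[0,T]` do not
matter. -/
def IsCkSobolev (k : ℕ) (s T : ℝ) (u : ℝ → L2) : Prop :=
  ∃ U : ℝ → SobolevH s, (∀ t ∈ Icc 0 T, SobolevH.toL2 s (U t) = u t) ∧
    ContDiffOn ℝ k U (Icc 0 T)

/-- The time derivative on `[0,T]` (one-sided at the end points), taken in `L²`. -/
noncomputable def timeDeriv (T : ℝ) (u : ℝ → L2) : ℝ → L2 :=
  fun t => derivWithin u (Icc 0 T) t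

/-- `g = f_x` in the sense of distributions. -/
def IsWeakDeriv (f g : L2) : Prop :=
  ∀ φ : 𝓢(ℝ, ℝ), ∫ x, g x * φ x = -∫ x, f x * deriv φ x

/-- `u ∈ C²([0,T], H^s)` solves the improved Boussinesq equation
`u_tt - u_xx - δ² u_xxtt - ε (u²)_xx = 0` on `[0,T]` with `u(x,0) = u₀(x)` and
`u_t(x,0) = (v₀)_x(x)`. The derivatives in `x` are those of tempered distributions: they are moved
to the test function `φ`. -/
structure IsIBSolution (s ε δ : ℝ) (u₀ v₀ : L2) (T : ℝ) (u : ℝ → L2) : Prop where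
  regular : IsCkSobolev 2 s T u
  equation : ∀ t ∈ Icc 0 T, ∀ φ : 𝓢(ℝ, ℝ),
    ∫ x, (timeDeriv T (timeDeriv T u) t x * φ x
        - u t x * iteratedDeriv 2 φ x
        - δ ^ 2 * (timeDeriv T (timeDeriv T u) t x * iteratedDeriv 2 φ x)
        - ε * (u t x ^ 2 * iteratedDeriv 2 φ x)) = 0
  initial : u 0 = u₀
  initial_deriv : IsWeakDeriv v₀ (timeDeriv T u 0)

/-- `w ∈ C([0,T], H^r) ∩ C¹([0,T], H^{r-1})` solves the Benjamin-Bona-Mahony equation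
`w_t + σ w_x + σ ε w w_x - σ (3/4) δ² w_xxx - (5/4) δ² w_xxt = 0` on `[0,T]` with `w(x,0) = w₀(x)`;
`σ = 1` is the equation of right-going waves, `σ = -1` that of left-going waves. The derivatives in
`x` are those of tempered distributions, and `w w_x = (w²)_x / 2`. -/
structure IsBBMSolution (σ r ε δ : ℝ) (w₀ : L2) (T : ℝ) (w : ℝ → L2) : Prop where
  regular : IsCkSobolev 0 r T w
  regular_deriv : IsCkSobolev 1 (r - 1) T w
  equation : ∀ t ∈ Icc 0 T, ∀ φ : 𝓢(ℝ, ℝ),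
    ∫ x, (timeDeriv T w t x * φ x
        - σ * (w t x * deriv φ x)
        - σ * ε * (w t x ^ 2 / 2 * deriv φ x)
        + σ * (3 / 4) * δ ^ 2 * (w t x * iteratedDeriv 3 φ x)
        - (5 / 4) * δ ^ 2 * (timeDeriv T w t x * iteratedDeriv 2 φ x)) = 0
  initial : w 0 = w₀

/-- `u` is the solution on `[0,T]` of the initial value problem whose solutions on `[0,T']` are
those functions of time that satisfy `P T'`: it is a solution, and each solution on an interval
`[0,T']` with `0 < T' ≤ T` agrees with it there. -/
def IsTheSolution (P : ℝ → (ℝ → L2) → Prop) (T : ℝ) (u : ℝ → L2) : Prop :=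
  P T u ∧ ∀ T' ∈ Ioc 0 T, ∀ u', P T' u' → EqOn u' u (Icc 0 T')

end Boussinesq

/-! The number `δstar` may depend on `tstar`, the constant `C` may not, and the error bound contains
`ε t`. The nonlinear terms carry a factor `ε`, so in time `t` they move each of the three solutions
by only `O(ε t)` from the linear flow of its data. These contributions fit into the bound
separately, no cancellation between them is needed, and only linear flows have to be compared.

The linear Boussinesq flow is a sum of two waves with phases `∓ωt`, `ω = ξ / √(1 + δ²ξ²)`; the
linear BBM flows have phases `∓κt`, `κ = ξ (1 + ¾δ²ξ²) / (1 + (5/4)δ²ξ²)`. As functions of `δ²ξ²`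
the factors of `ξ` agree to first order at zero, and `|ω - κ| ≤ δ⁴|ξ|⁵` for all `ξ`
(`abs_om_sub_kap_le`). The price is five derivatives and an error `δ⁴ t` (`norm_emb_grp_sub_le`).
The data `u₀`, `(v₀)_x` split into the waves `½(u₀ ∓ √(1 + δ²ξ²) v₀)`; replacing the root by `1`
gives the error `δ²`, which does not grow in time.

Existence on all of `[0, tstar]` is a perturbation argument. The solution is written as the linear
flow applied to `a + Z(t)`, and the equation for `Z` involves `ε e^{iθt} D`, where the symbol of `D`
is bounded both by `1/δ` and by `|ξ|`. With `ε ≤ δ` the first bound makes the operator a contraction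
on `H^r`, so Lipschitz constants do not depend on `ε` and `δ` (`norm_duhamel_le`). The second bound
gains the factor `ε` for one derivative (`norm_duhamel_emb_le`): for data in `H^{r+1}` the forcing
at `Z = 0` is `O(ε)` in `H^r`, and for `ε` small in terms of the time interval a fixed point
argument keeps `Z` in the unit ball (`exists_small_solution`, `exists_small_quadratic`). Once this
is known, `Z'` is `O(ε)` in `H^{r-1}` with a constant independent of the interval, whence `Z = O(ε
t)`.

Uniqueness is that of ordinary differential equations with locally Lipschitz fields; for BBM this
form appears only after conjugation with the linear group. Everything is done on the Fourier side:
`weak_iff` translates the distributional equations, `op` provides the multipliers, and `exists_mul`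
the algebra property of `H^r`. -/

namespace Boussinesq

/-! ### Fourier transforms of real-valued square integrable functions. -/

/-- The Fourier transform of real-valued square integrable functions. -/
noncomputable def hat : L2 →L[ℝ] Lp ℂ 2 (volume : Measure ℝ) :=
  ((Lp.fourierTransformₗᵢ ℝ ℂ).toContinuousLinearEquiv.toContinuousLinearMap.restrictScalars ℝ).comp
    complexify

lemma hat_apply (f : L2) : hat f = (𝓕 (complexify f) : Lp ℂ 2 (volume : Measure ℝ)) := rfl

lemma coeFn_complexify (f : L2) : complexify f =ᵐ[volume] fun x => (f x : ℂ) :=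
  Complex.ofRealCLM.coeFn_compLpL (p := 2) (μ := (volume : Measure ℝ)) f

lemma norm_complexify (f : L2) : ‖complexify f‖ = ‖f‖ := by
  rw [Lp.norm_def, Lp.norm_def, eLpNorm_congr_ae (coeFn_complexify f)]
  congr 1
  exact eLpNorm_congr_norm_ae (Filter.Eventually.of_forall fun x => by simp)

lemma norm_hat (f : L2) : ‖hat f‖ = ‖f‖ := by
  rw [hat_apply, Lp.norm_fourier_eq, norm_complexify]

lemma hat_injective : Function.Injective hat := by
  refine (injective_iff_map_eq_zero _).2 fun f hf => ?_
  rw [← norm_eq_zero, ← norm_hat, hf, norm_zero]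

/-- The transform on `L²` is not given by an integral; this multiplication formula, which is the
definition of the transform of a tempered distribution, is the handle on its pointwise values. -/
lemma integral_mul_fourier (g : Lp ℂ 2 (volume : Measure ℝ)) (ψ : 𝓢(ℝ, ℂ)) :
    ∫ x, ψ x * (𝓕 g : Lp ℂ 2 (volume : Measure ℝ)) x = ∫ x, (𝓕 ψ) x * g x := by
  have h := congrArg (fun T => T ψ) (Lp.fourier_toTemperedDistribution_eq g)
  simp only [TemperedDistribution.fourier_apply, Lp.toTemperedDistribution_apply,
    smul_eq_mul] at h
  exact h.symm

lemma integral_mul_hat (f : L2) (ψ : 𝓢(ℝ, ℂ)) :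
    ∫ η, ψ η * hat f η = ∫ x, (𝓕 ψ) x * (f x : ℂ) := by
  rw [hat_apply, integral_mul_fourier]
  refine integral_congr_ae ?_
  filter_upwards [coeFn_complexify f] with x hx
  rw [hx]

lemma ae_eq_zero_of_integral_schwartz {f : ℝ → ℂ} (hf : LocallyIntegrable f)
    (h : ∀ ψ : 𝓢(ℝ, ℂ), ∫ x, ψ x * f x = 0) : f =ᵐ[volume] 0 := by
  refine ae_eq_zero_of_integral_contDiff_smul_eq_zero hf fun g hg hc => ?_
  have h1 : HasCompactSupport (Complex.ofRealCLM ∘ g) := hc.comp_left rfl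
  have h2 : ContDiff ℝ (⊤ : ℕ∞) (Complex.ofRealCLM ∘ g) := by fun_prop
  have h3 := h (h1.toSchwartzMap h2)
  simpa using h3

lemma locallyIntegrable_of_memLp_two {f : ℝ → ℂ} (hf : MemLp f 2 volume) :
    LocallyIntegrable f := hf.locallyIntegrable (by norm_num)

/-- Composition with the reflection. -/
noncomputable def schwartzReflect : 𝓢(ℝ, ℂ) →L[ℂ] 𝓢(ℝ, ℂ) :=
  SchwartzMap.compCLMOfContinuousLinearEquiv ℂ (ContinuousLinearEquiv.neg ℝ)

lemma schwartzReflect_apply (ψ : 𝓢(ℝ, ℂ)) (x : ℝ) : schwartzReflect ψ x = ψ (-x) := rfl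

/-- Complex conjugation of Schwartz functions. -/
noncomputable def schwartzConj : 𝓢(ℝ, ℂ) →L[ℝ] 𝓢(ℝ, ℂ) :=
  SchwartzMap.postcompCLM (Complex.conjCLE : ℂ →L[ℝ] ℂ)

lemma schwartzConj_apply (ψ : 𝓢(ℝ, ℂ)) (x : ℝ) :
    schwartzConj ψ x = (starRingEnd ℂ) (ψ x) := rfl

lemma fourier_schwartzReflect (ψ : 𝓢(ℝ, ℂ)) (x : ℝ) :
    (𝓕 (schwartzReflect ψ)) x = (starRingEnd ℂ) ((𝓕 (schwartzConj ψ)) x) := by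
  rw [SchwartzMap.fourier_coe, SchwartzMap.fourier_coe, Real.fourier_real_eq_integral_exp_smul,
    Real.fourier_real_eq_integral_exp_smul, ← integral_conj,
    ← integral_neg_eq_self (fun v : ℝ => Complex.exp _ • (schwartzReflect ψ) v)]
  refine integral_congr_ae (Filter.Eventually.of_forall fun v => ?_)
  simp only [schwartzReflect_apply, schwartzConj_apply, smul_eq_mul, map_mul, neg_neg,
    Complex.conj_conj, ← Complex.exp_conj, Complex.conj_ofReal, Complex.conj_I]
  congr 2
  push_cast
  ring

lemma memLp_comp_neg {f : ℝ → ℂ} (hf : MemLp f 2 volume) :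
    MemLp (fun x => f (-x)) 2 volume :=
  hf.comp_measurePreserving (Measure.measurePreserving_neg volume)

lemma integrable_schwartz_mul (ψ : 𝓢(ℝ, ℂ)) {f : ℝ → ℂ} (hf : MemLp f 2 volume) :
    Integrable (fun x => ψ x * f x) :=
  MemLp.integrable_mul (p := 2) (q := 2) (ψ.memLp 2 volume) hf

/-- The Fourier transform of a real-valued function has the Hermitian symmetry. -/
lemma hat_neg (f : L2) : ∀ᵐ η, hat f (-η) = (starRingEnd ℂ) (hat f η) := by
  have hm : MemLp (hat f) 2 volume := Lp.memLp _
  have hm1 := memLp_comp_neg hm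
  have hm2 : MemLp (fun η => (starRingEnd ℂ) (hat f η)) 2 volume := hm.star
  have h0 : (fun η => hat f (-η) - (starRingEnd ℂ) (hat f η)) =ᵐ[volume] 0 := by
    refine ae_eq_zero_of_integral_schwartz (locallyIntegrable_of_memLp_two (hm1.sub hm2))
      fun ψ => ?_
    simp only [mul_sub]
    rw [integral_sub (integrable_schwartz_mul ψ hm1) (integrable_schwartz_mul ψ hm2), sub_eq_zero]
    have e1 : ∫ η, ψ η * hat f (-η) = ∫ η, schwartzReflect ψ η * hat f η := by
      rw [← integral_neg_eq_self]
      simp [schwartzReflect_apply]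
    have e2 : ∫ η, ψ η * (starRingEnd ℂ) (hat f η)
        = (starRingEnd ℂ) (∫ η, schwartzConj ψ η * hat f η) := by
      rw [← integral_conj]
      simp [schwartzConj_apply]
    rw [e1, e2, integral_mul_hat, integral_mul_hat, ← integral_conj]
    simp [fourier_schwartzReflect]
  filter_upwards [h0] with η hη
  exact sub_eq_zero.1 hη

lemma hat_add_ae (f g : L2) : hat (f + g) =ᵐ[volume] fun η => hat f η + hat g η := by
  rw [map_add]; exact Lp.coeFn_add _ _

lemma hat_sub_ae (f g : L2) : hat (f - g) =ᵐ[volume] fun η => hat f η - hat g η := by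
  rw [map_sub]; exact Lp.coeFn_sub _ _

lemma hat_smul_ae (c : ℝ) (f : L2) : hat (c • f) =ᵐ[volume] fun η => (c : ℂ) * hat f η := by
  rw [map_smul]
  filter_upwards [Lp.coeFn_smul c (hat f)] with η hη
  rw [hη, Pi.smul_apply, Complex.real_smul]

lemma hat_ext {f g : L2} (h : hat f =ᵐ[volume] hat g) : f = g :=
  hat_injective (Lp.ext h)

/-- A square integrable function with the Hermitian symmetry is the Fourier transform of a
real-valued function. -/
lemma exists_hat_eq {G : ℝ → ℂ} (hG : MemLp G 2 volume)
    (h : ∀ᵐ η, G (-η) = (starRingEnd ℂ) (G η)) : ∃ f : L2, hat f =ᵐ[volume] G := by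
  set G' : Lp ℂ 2 (volume : Measure ℝ) := hG.toLp G with hG'
  set g : Lp ℂ 2 (volume : Measure ℝ) := 𝓕⁻ G' with hg
  set f : L2 := Complex.reCLM.compLpL 2 volume g with hf
  set k : L2 := Complex.imCLM.compLpL 2 volume g with hk
  have hdec : g = complexify f + Complex.I • complexify k := by
    refine Lp.ext ?_
    filter_upwards [Lp.coeFn_add (complexify f) (Complex.I • complexify k),
      Lp.coeFn_smul Complex.I (complexify k), coeFn_complexify f, coeFn_complexify k,
      Complex.reCLM.coeFn_compLpL (p := 2) (μ := (volume : Measure ℝ)) g,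
      Complex.imCLM.coeFn_compLpL (p := 2) (μ := (volume : Measure ℝ)) g] with x h1 h2 h3 h4 h5 h6
    rw [h1, Pi.add_apply, h2, Pi.smul_apply, h3, h4, hf, hk, h5, h6]
    simp only [Complex.reCLM_apply, Complex.imCLM_apply, smul_eq_mul]
    rw [mul_comm, Complex.re_add_im]
  have hF : G' = hat f + Complex.I • hat k := by
    rw [hat_apply, hat_apply, ← FourierTransform.fourier_smul, ← FourierTransform.fourier_add,
      ← hdec, hg, FourierTransform.fourier_fourierInv_eq]
  have hFae : G =ᵐ[volume] fun η => hat f η + Complex.I * hat k η := by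
    filter_upwards [hG.coeFn_toLp, Lp.coeFn_add (hat f) (Complex.I • hat k),
      Lp.coeFn_smul Complex.I (hat k)] with η h1 h2 h3
    rw [← h1, ← hG', hF, h2, Pi.add_apply, h3, Pi.smul_apply, smul_eq_mul]
  have hneg := (Measure.measurePreserving_neg (volume : Measure ℝ)).quasiMeasurePreserving.ae_eq_comp
    hFae
  -- Both `hat f` and `hat k` are Hermitian, so the factor `I` makes `I * hat k` anti-Hermitian; the
  -- symmetry of `G` forces this part to vanish.
  have hk0 : k = 0 := by
    refine hat_ext ?_
    rw [map_zero]
    filter_upwards [hFae, hneg, h, hat_neg f, hat_neg k, Lp.coeFn_zero ℂ 2 (volume : Measure ℝ)]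
      with η h1 h2 h3 h4 h5 h6
    simp only [Function.comp_apply] at h2
    rw [h6, Pi.zero_apply]
    rw [h3, h1, h4, h5] at h2
    simp only [map_add, map_mul, Complex.conj_I] at h2
    have h7 : Complex.I * (starRingEnd ℂ) (hat k η) = 0 := by linear_combination (-1/2 : ℂ) * h2
    have h8 := (mul_eq_zero.1 h7).resolve_left Complex.I_ne_zero
    exact (map_eq_zero _).1 h8
  refine ⟨f, ?_⟩
  rw [hk0, map_zero, smul_zero, add_zero] at hF
  rw [← hF]
  exact hG.coeFn_toLp

/-! ### Weights, and the Sobolev spaces on the Fourier side. -/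

/-- The weight `(1 + ξ²)^{r/2}` at the wave number `ξ = 2πη`. -/
noncomputable def wt (r η : ℝ) : ℝ := (1 + (2 * Real.pi * η) ^ 2) ^ (r / 2)

lemma one_le_wt_base (η : ℝ) : 1 ≤ 1 + (2 * Real.pi * η) ^ 2 := by
  linarith [sq_nonneg (2 * Real.pi * η)]

lemma wt_pos (r η : ℝ) : 0 < wt r η :=
  Real.rpow_pos_of_pos (lt_of_lt_of_le one_pos (one_le_wt_base η)) _

lemma wt_add (r r' η : ℝ) : wt (r + r') η = wt r η * wt r' η := by
  rw [wt, wt, wt, ← Real.rpow_add (lt_of_lt_of_le one_pos (one_le_wt_base η)), add_div]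

@[simp] lemma wt_zero (η : ℝ) : wt 0 η = 1 := by simp [wt]

lemma wt_mono {r r' : ℝ} (h : r' ≤ r) (η : ℝ) : wt r' η ≤ wt r η :=
  Real.rpow_le_rpow_of_exponent_le (one_le_wt_base η) (by linarith)

lemma one_le_wt {r : ℝ} (h : 0 ≤ r) (η : ℝ) : 1 ≤ wt r η := by
  rw [← wt_zero η]; exact wt_mono h η

@[simp] lemma wt_neg (r η : ℝ) : wt r (-η) = wt r η := by simp [wt]

lemma wt_two (η : ℝ) : wt 2 η = 1 + (2 * Real.pi * η) ^ 2 := by simp [wt]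

lemma wt_one_sq (η : ℝ) : wt 1 η ^ 2 = 1 + (2 * Real.pi * η) ^ 2 := by
  rw [← wt_two, sq, ← wt_add]; norm_num

lemma abs_le_wt_one (η : ℝ) : |2 * Real.pi * η| ≤ wt 1 η := by
  refine abs_le_of_sq_le_sq ?_ (wt_pos 1 η).le
  rw [wt_one_sq]; linarith

lemma wt_natCast (n : ℕ) (η : ℝ) : wt n η = wt 1 η ^ n := by
  induction n with
  | zero => simp
  | succ n ih => rw [Nat.cast_succ, wt_add, ih, pow_succ]

@[fun_prop] lemma measurable_wt (r : ℝ) : Measurable (wt r) := by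
  unfold wt; fun_prop

namespace SobolevH

/-- The Fourier transform of an element of `H^r`. -/
noncomputable def fhat {r : ℝ} (f : SobolevH r) : ℝ → ℂ := hat (toL2 r f)

lemma toL2_injective (r : ℝ) : Function.Injective (toL2 r) := Subtype.val_injective

lemma ext_toL2 {r : ℝ} {f g : SobolevH r} (h : toL2 r f = toL2 r g) : f = g := Subtype.ext h

lemma ext_fhat {r : ℝ} {f g : SobolevH r} (h : fhat f =ᵐ[volume] fhat g) : f = g :=
  toL2_injective r (hat_ext h)

lemma fhat_add {r : ℝ} (f g : SobolevH r) : fhat (f + g) =ᵐ[volume] fun η => fhat f η + fhat g η := by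
  unfold fhat; rw [map_add]; exact hat_add_ae _ _

lemma fhat_sub {r : ℝ} (f g : SobolevH r) : fhat (f - g) =ᵐ[volume] fun η => fhat f η - fhat g η := by
  unfold fhat; rw [map_sub]; exact hat_sub_ae _ _

lemma fhat_smul {r : ℝ} (c : ℝ) (f : SobolevH r) :
    fhat (c • f) =ᵐ[volume] fun η => (c : ℂ) * fhat f η := by
  unfold fhat; rw [map_smul]; exact hat_smul_ae _ _

lemma fhat_neg {r : ℝ} (f : SobolevH r) : fhat (-f) =ᵐ[volume] fun η => - fhat f η := by
  filter_upwards [fhat_smul (-1) f] with η hη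
  simpa using hη

lemma aestronglyMeasurable_fhat {r : ℝ} (f : SobolevH r) : AEStronglyMeasurable (fhat f) volume :=
  Lp.aestronglyMeasurable _

lemma memLp_fhat {r : ℝ} (f : SobolevH r) : MemLp (fhat f) 2 volume := Lp.memLp _

lemma memLp_wt_fhat {r : ℝ} (f : SobolevH r) :
    MemLp (fun η => wt r η * ‖fhat f η‖) 2 volume := by
  refine (memLp f).norm.congr_norm ((measurable_wt r).aestronglyMeasurable.mul
    (aestronglyMeasurable_fhat f).norm) (Filter.Eventually.of_forall fun η => ?_)
  simp only [weightedFourier, norm_smul, norm_norm, norm_mul]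
  rfl

lemma norm_sq_Lp_two (G : Lp ℂ 2 (volume : Measure ℝ)) : ‖G‖ ^ 2 = ∫ η, ‖G η‖ ^ 2 := by
  rw [← inner_self_eq_norm_sq (𝕜 := ℂ), L2.inner_def, ← integral_re (L2.integrable_inner _ _)]
  refine integral_congr_ae (Filter.Eventually.of_forall fun η => ?_)
  exact inner_self_eq_norm_sq (𝕜 := ℂ) (G η)

lemma norm_sq_eq {r : ℝ} (f : SobolevH r) : ‖f‖ ^ 2 = ∫ η, (wt r η * ‖fhat f η‖) ^ 2 := by
  have h1 : ‖f‖ = ‖(memLp f).toLp _‖ := rfl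
  rw [h1, norm_sq_Lp_two]
  refine integral_congr_ae ?_
  filter_upwards [(memLp f).coeFn_toLp] with η hη
  rw [hη, weightedFourier, norm_smul]
  congr 2
  exact Real.norm_of_nonneg (wt_pos r η).le

lemma integrable_norm_sq {r : ℝ} (f : SobolevH r) :
    Integrable (fun η => (wt r η * ‖fhat f η‖) ^ 2) := (memLp_wt_fhat f).integrable_sq

/-- Comparison of Sobolev norms on the Fourier side. -/
lemma norm_le_of_fhat_le {r r' C : ℝ} (hC : 0 ≤ C) {g : SobolevH r'} {f : SobolevH r}
    (h : ∀ᵐ η, wt r' η * ‖fhat g η‖ ≤ C * (wt r η * ‖fhat f η‖)) : ‖g‖ ≤ C * ‖f‖ := by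
  refine le_of_sq_le_sq ?_ (by positivity) 
  rw [mul_pow, norm_sq_eq, norm_sq_eq, ← integral_const_mul]
  refine integral_mono_ae (integrable_norm_sq g) ((integrable_norm_sq f).const_mul _) ?_
  filter_upwards [h] with η hη
  rw [← mul_pow]
  exact pow_le_pow_left₀ (mul_nonneg (wt_pos _ _).le (norm_nonneg _)) hη 2

/-- An element of `H^r` with a given Fourier transform. -/
lemma exists_fhat_eq {r : ℝ} (hr : 0 ≤ r) {G : ℝ → ℂ} (hG : AEStronglyMeasurable G volume)
    (hw : MemLp (fun η => wt r η * ‖G η‖) 2 volume)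
    (h : ∀ᵐ η, G (-η) = (starRingEnd ℂ) (G η)) :
    ∃ f : SobolevH r, fhat f =ᵐ[volume] G := by
  have hm : MemLp G 2 volume := hw.mono hG (Filter.Eventually.of_forall fun η => by
    rw [Real.norm_of_nonneg (mul_nonneg (wt_pos _ _).le (norm_nonneg _))]
    exact le_mul_of_one_le_left (norm_nonneg _) (one_le_wt hr η))
  obtain ⟨f, hf⟩ := exists_hat_eq hm h
  have hmem : sobolevENorm r f < ∞ := by
    have h1 : eLpNorm (weightedFourier r f) 2 volume
        = eLpNorm (fun η => wt r η * ‖G η‖) 2 volume := by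
      refine eLpNorm_congr_norm_ae ?_
      filter_upwards [hf] with η hη
      rw [norm_mul, norm_norm, ← hη]
      exact norm_smul _ _
    rw [sobolevENorm, h1]
    exact hw.2
  exact ⟨⟨f, hmem⟩, hf⟩

lemma fhat_herm {r : ℝ} (f : SobolevH r) :
    ∀ᵐ η, fhat f (-η) = (starRingEnd ℂ) (fhat f η) := hat_neg _

/-- The isometry `weighted r` has a closed range in `L²`: the functions whose reflection `N G`
equals their conjugate `K G`. Completeness is needed for the fixed point theorem. -/
instance instCompleteSpace (r : ℝ) [hr : Fact (0 ≤ r)] : CompleteSpace (SobolevH r) := by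
  have hiso : Isometry (weighted r) := fun _ _ => rfl
  let N : Lp ℂ 2 (volume : Measure ℝ) → Lp ℂ 2 (volume : Measure ℝ) :=
    Lp.compMeasurePreserving (fun x : ℝ => -x) (Measure.measurePreserving_neg volume)
  let K : Lp ℂ 2 (volume : Measure ℝ) →L[ℝ] Lp ℂ 2 (volume : Measure ℝ) :=
    (Complex.conjCLE : ℂ →L[ℝ] ℂ).compLpL 2 volume
  have hN (G : Lp ℂ 2 (volume : Measure ℝ)) : N G =ᵐ[volume] fun η => G (-η) :=
    Lp.coeFn_compMeasurePreserving G (Measure.measurePreserving_neg volume)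
  have hK (G : Lp ℂ 2 (volume : Measure ℝ)) :
      K G =ᵐ[volume] fun η => (starRingEnd ℂ) (G η) :=
    (Complex.conjCLE : ℂ →L[ℝ] ℂ).coeFn_compLpL (p := 2) (μ := (volume : Measure ℝ)) G
  have hNc : Continuous N :=
    (Lp.isometry_compMeasurePreserving (Measure.measurePreserving_neg volume)).continuous
  have hr' : range (weighted r) = {G | N G = K G} := by
    ext G
    constructor
    · rintro ⟨f, rfl⟩
      refine Lp.ext ?_
      have h1 : weighted r f =ᵐ[volume] weightedFourier r (toL2 r f) := (memLp f).coeFn_toLp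
      have h2 := (Measure.measurePreserving_neg
        (volume : Measure ℝ)).quasiMeasurePreserving.ae_eq_comp h1
      filter_upwards [hN (weighted r f), hK (weighted r f), h1, h2, fhat_herm f]
        with η e1 e2 e3 e4 e5
      simp only [Function.comp_apply] at e4
      rw [e1, e2, e3, e4]
      change (wt r (-η) : ℝ) • fhat f (-η) = (starRingEnd ℂ) ((wt r η : ℝ) • fhat f η)
      rw [e5, wt_neg, Complex.real_smul, Complex.real_smul, map_mul, Complex.conj_ofReal]
    · intro hG
      have hG' : ∀ᵐ η, G (-η) = (starRingEnd ℂ) (G η) := by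
        filter_upwards [hN G, hK G] with η e1 e2
        rw [← e1, ← e2, show N G = K G from hG]
      have hmeas : AEStronglyMeasurable (fun η => ((wt r η)⁻¹ : ℝ) • G η) volume :=
        (measurable_wt r).inv.aestronglyMeasurable.smul (Lp.aestronglyMeasurable G)
      have hn (η : ℝ) : wt r η * ‖((wt r η)⁻¹ : ℝ) • G η‖ = ‖G η‖ := by
        rw [norm_smul, Real.norm_of_nonneg (inv_nonneg.2 (wt_pos r η).le),
          mul_inv_cancel_left₀ (wt_pos r η).ne']
      obtain ⟨f, hf⟩ := exists_fhat_eq hr.out hmeas (by simpa only [hn] using (Lp.memLp G).norm) (by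
        filter_upwards [hG'] with η hη
        rw [hη, wt_neg, Complex.real_smul, Complex.real_smul, map_mul, Complex.conj_ofReal])
      refine ⟨f, Lp.ext ?_⟩
      have h1 : weighted r f =ᵐ[volume] weightedFourier r (toL2 r f) := (memLp f).coeFn_toLp
      filter_upwards [h1, hf] with η e1 e2
      rw [e1]
      change (wt r η : ℝ) • fhat f η = _
      rw [e2, smul_inv_smul₀ (wt_pos r η).ne']
  refine (completeSpace_iff_isComplete_range hiso.isUniformInducing).2 ?_
  rw [hr']
  exact (isClosed_eq hNc K.continuous).isComplete

end SobolevH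

open SobolevH

/-! ### Fourier multipliers between Sobolev spaces. -/

/-- `m` is the symbol of a real Fourier multiplier from `H^r` to `H^{r'}` of norm at most `C`. -/
structure IsSymb (r r' C : ℝ) (m : ℝ → ℂ) : Prop where
  nonneg : 0 ≤ r'
  meas : Measurable m
  herm : ∀ η, m (-η) = (starRingEnd ℂ) (m η)
  bound : ∀ η, ‖m η‖ * wt r' η ≤ C * wt r η

lemma IsSymb.const_nonneg {r r' C : ℝ} {m : ℝ → ℂ} (h : IsSymb r r' C m) : 0 ≤ C :=
  nonneg_of_mul_nonneg_left
    ((mul_nonneg (norm_nonneg _) (wt_pos r' 0).le).trans (h.bound 0)) (wt_pos r 0)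

lemma IsSymb.weighted_le {r r' C : ℝ} {m : ℝ → ℂ} (h : IsSymb r r' C m) (η : ℝ) (z : ℂ) :
    wt r' η * ‖m η * z‖ ≤ C * (wt r η * ‖z‖) := by
  rw [norm_mul, ← mul_assoc, ← mul_assoc, mul_comm (wt r' η)]
  exact mul_le_mul_of_nonneg_right (h.bound η) (norm_nonneg _)

lemma IsSymb.exists_fhat {r r' C : ℝ} {m : ℝ → ℂ} (h : IsSymb r r' C m) (f : SobolevH r) :
    ∃ g : SobolevH r', fhat g =ᵐ[volume] fun η => m η * fhat f η := by
  refine exists_fhat_eq h.nonneg (h.meas.aestronglyMeasurable.mul (aestronglyMeasurable_fhat f))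
    ?_ ?_
  · refine ((memLp_wt_fhat f).const_mul C).mono ((measurable_wt r').aestronglyMeasurable.mul
      (h.meas.aestronglyMeasurable.mul (aestronglyMeasurable_fhat f)).norm)
      (Filter.Eventually.of_forall fun η => ?_)
    rw [Real.norm_of_nonneg (mul_nonneg (wt_pos _ _).le (norm_nonneg _))]
    exact (h.weighted_le η _).trans (le_abs_self _)
  · filter_upwards [fhat_herm f] with η hη
    rw [hη, h.herm, map_mul]

open Classical in
/-- The Fourier multiplier with symbol `m`, as an operator from `H^r` to `H^{r'}`. -/
noncomputable def op (r r' : ℝ) (m : ℝ → ℂ) : SobolevH r →L[ℝ] SobolevH r' :=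
  -- The bound is kept existential, so that the operator depends only on the symbol and the two
  -- spaces; it is zero for inadmissible symbols.
  if h : ∃ C, IsSymb r r' C m then
    LinearMap.mkContinuousOfExistsBound
      { toFun := fun f => (h.choose_spec.exists_fhat f).choose
        map_add' := fun f g => by
          refine ext_fhat ?_
          filter_upwards [(h.choose_spec.exists_fhat (f + g)).choose_spec,
            (h.choose_spec.exists_fhat f).choose_spec, (h.choose_spec.exists_fhat g).choose_spec,
            fhat_add f g, fhat_add (h.choose_spec.exists_fhat f).choose
              (h.choose_spec.exists_fhat g).choose] with η h1 h2 h3 h4 h5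
          rw [h1, h5, h2, h3, h4, mul_add]
        map_smul' := fun c f => by
          refine ext_fhat ?_
          filter_upwards [(h.choose_spec.exists_fhat (c • f)).choose_spec,
            (h.choose_spec.exists_fhat f).choose_spec,
            fhat_smul c f, fhat_smul c (h.choose_spec.exists_fhat f).choose] with η h1 h2 h3 h4
          rw [h1, RingHom.id_apply, h4, h2, h3, mul_left_comm] }
      ⟨h.choose, fun f => norm_le_of_fhat_le h.choose_spec.const_nonneg (by
        filter_upwards [(h.choose_spec.exists_fhat f).choose_spec] with η hη
        refine le_trans (le_of_eq ?_) (h.choose_spec.weighted_le η (fhat f η))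
        rw [← hη]
        rfl)⟩
  else 0

section op

variable {r r' C : ℝ} {m : ℝ → ℂ}

lemma IsSymb.fhat_op (h : IsSymb r r' C m) (f : SobolevH r) :
    fhat (op r r' m f) =ᵐ[volume] fun η => m η * fhat f η := by
  have h' : ∃ C, IsSymb r r' C m := ⟨C, h⟩
  have h1 : op r r' m f = (h'.choose_spec.exists_fhat f).choose := by
    rw [op, dif_pos h']; rfl
  rw [h1]
  exact (h'.choose_spec.exists_fhat f).choose_spec

lemma IsSymb.norm_op_le (h : IsSymb r r' C m) (f : SobolevH r) : ‖op r r' m f‖ ≤ C * ‖f‖ :=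
  norm_le_of_fhat_le h.const_nonneg (by
    filter_upwards [h.fhat_op f] with η hη
    rw [hη]
    exact h.weighted_le η _)

lemma IsSymb.op_opNorm_le (h : IsSymb r r' C m) : ‖op r r' m‖ ≤ C :=
  ContinuousLinearMap.opNorm_le_bound _ h.const_nonneg h.norm_op_le

/-- Dominated convergence for Fourier multipliers. -/
lemma op_tendsto {ι : Type*} {l : Filter ι} [l.IsCountablyGenerated] {M : ι → ℝ → ℂ}
    (hM : ∀ᶠ i in l, IsSymb r r' C (M i)) (h : IsSymb r r' C m)
    (hlim : ∀ η, Filter.Tendsto (fun i => M i η) l (nhds (m η))) (f : SobolevH r) :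
    Filter.Tendsto (fun i => op r r' (M i) f) l (nhds (op r r' m f)) := by
  rw [tendsto_iff_norm_sub_tendsto_zero]
  have hsq : Filter.Tendsto (fun i => ‖op r r' (M i) f - op r r' m f‖ ^ 2) l (nhds 0) := by
    have hdc := tendsto_integral_filter_of_dominated_convergence (μ := (volume : Measure ℝ)) (l := l)
      (F := fun i η => (wt r' η * ‖(M i η - m η) * fhat f η‖) ^ 2) (f := fun _ => (0 : ℝ))
      (fun η => (2 * C) ^ 2 * (wt r η * ‖fhat f η‖) ^ 2) ?_ ?_
      ((integrable_norm_sq f).const_mul _) ?_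
    · rw [integral_zero] at hdc
      refine hdc.congr' ?_
      filter_upwards [hM] with i hi
      rw [norm_sq_eq]
      refine integral_congr_ae ?_
      filter_upwards [fhat_sub (op r r' (M i) f) (op r r' m f), hi.fhat_op f, h.fhat_op f]
        with η h1 h2 h3
      rw [h1, h2, h3, sub_mul]
    · filter_upwards [hM] with i hi
      exact ((measurable_wt r').aestronglyMeasurable.mul
        ((hi.meas.sub h.meas).aestronglyMeasurable.mul (aestronglyMeasurable_fhat f)).norm).pow 2
    · filter_upwards [hM] with i hi
      refine Filter.Eventually.of_forall fun η => ?_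
      rw [Real.norm_of_nonneg (sq_nonneg _), ← mul_pow]
      refine pow_le_pow_left₀ (mul_nonneg (wt_pos _ _).le (norm_nonneg _)) ?_ 2
      have h1 := hi.weighted_le η (fhat f η)
      have h2 := h.weighted_le η (fhat f η)
      have h3 : ‖(M i η - m η) * fhat f η‖ ≤ ‖M i η * fhat f η‖ + ‖m η * fhat f η‖ := by
        rw [sub_mul]; exact norm_sub_le _ _
      have h4 := mul_le_mul_of_nonneg_left h3 (wt_pos r' η).le
      linarith
    · refine Filter.Eventually.of_forall fun η => ?_
      have h1 : Filter.Tendsto (fun i => (wt r' η * ‖(M i η - m η) * fhat f η‖) ^ 2) l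
          (nhds ((wt r' η * ‖(m η - m η) * fhat f η‖) ^ 2)) :=
        ((((hlim η).sub_const _).mul_const _).norm.const_mul _).pow 2
      simpa using h1
  have := hsq.sqrt
  simpa [Real.sqrt_sq (norm_nonneg _)] using this

end op

/-- The inclusion of `H^r` in `H^{r'}` for `r' ≤ r`. -/
noncomputable def emb (r r' : ℝ) : SobolevH r →L[ℝ] SobolevH r' := op r r' fun _ => 1

lemma isSymb_one {r r' : ℝ} (h0 : 0 ≤ r') (h : r' ≤ r) : IsSymb r r' 1 fun _ => 1 where
  nonneg := h0
  meas := measurable_const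
  herm := by simp
  bound η := by simpa using wt_mono h η

lemma fhat_emb {r r' : ℝ} (h0 : 0 ≤ r') (h : r' ≤ r) (f : SobolevH r) :
    fhat (emb r r' f) =ᵐ[volume] fhat f := by
  filter_upwards [(isSymb_one h0 h).fhat_op f] with η hη
  rw [emb, hη, one_mul]

lemma toL2_emb {r r' : ℝ} (h0 : 0 ≤ r') (h : r' ≤ r) (f : SobolevH r) :
    toL2 r' (emb r r' f) = toL2 r f := hat_ext (fhat_emb h0 h f)

lemma norm_emb_le {r r' : ℝ} (h0 : 0 ≤ r') (h : r' ≤ r) (f : SobolevH r) : ‖emb r r' f‖ ≤ ‖f‖ := by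
  exact ((isSymb_one h0 h).norm_op_le f).trans_eq (one_mul _)

lemma emb_self {r : ℝ} (h0 : 0 ≤ r) (f : SobolevH r) : emb r r f = f :=
  ext_toL2 (toL2_emb h0 le_rfl f)

/-- The inclusion of `H^r` in `L²` as a continuous linear map. -/
noncomputable def toL2L (r : ℝ) (hr : 0 ≤ r) : SobolevH r →L[ℝ] L2 :=
  (toL2 r).mkContinuous 1 fun f => by
    rw [← norm_hat]
    have h1 : ‖hat (toL2 r f)‖ ^ 2 = ∫ η, ‖fhat f η‖ ^ 2 := norm_sq_Lp_two _
    refine le_of_sq_le_sq ?_ (by positivity)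
    rw [h1, one_mul, norm_sq_eq]
    refine integral_mono_ae (memLp_fhat f).norm.integrable_sq (integrable_norm_sq f)
      (Filter.Eventually.of_forall fun η => ?_)
    exact pow_le_pow_left₀ (norm_nonneg _)
      (le_mul_of_one_le_left (norm_nonneg _) (one_le_wt hr η)) 2

/-- Strong convergence of bounded operators, applied to a convergent family. -/
lemma tendsto_clm_apply {E F ι : Type*} [NormedAddCommGroup E] [NormedSpace ℝ E]
    [NormedAddCommGroup F] [NormedSpace ℝ F] {l : Filter ι} {T : ι → E →L[ℝ] F} {g : ι → E}
    {g₀ : E} {y : F} {c : ℝ} (hT : ∀ᶠ i in l, ‖T i‖ ≤ c)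
    (hg : Filter.Tendsto g l (nhds g₀)) (hy : Filter.Tendsto (fun i => T i g₀) l (nhds y)) :
    Filter.Tendsto (fun i => T i (g i)) l (nhds y) := by
  have h0 : Filter.Tendsto (fun i => T i (g i - g₀)) l (nhds 0) := by
    refine squeeze_zero_norm' (a := fun i => c * ‖g i - g₀‖) ?_ ?_
    · filter_upwards [hT] with i hi
      exact (T i).le_of_opNorm_le hi _
    · simpa using (tendsto_iff_norm_sub_tendsto_zero.1 hg).const_mul c
  have := h0.add hy
  simpa using this

open SobolevH

/-! ### The algebra property of `H^r` for `r > 1/2`. -/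

lemma integrable_wt {r : ℝ} (hr : 1 / 2 < r) : Integrable (fun η => wt (-r) η ^ 2) := by
  have h1 : Integrable (fun x : ℝ => (1 + ‖x‖ ^ 2) ^ (-(2 * r) / 2)) :=
    integrable_rpow_neg_one_add_norm_sq (by simp; linarith)
  have h2 := h1.comp_mul_left' (R := 2 * Real.pi) (by positivity)
  refine h2.congr (Filter.Eventually.of_forall fun η => ?_)
  simp only [Real.norm_eq_abs, sq_abs]
  rw [wt, ← Real.rpow_mul_natCast (by positivity)]
  congr 1
  push_cast
  ring

lemma wt_neg_exp (r η : ℝ) : wt (-r) η * wt r η = 1 := by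
  rw [← wt_add]; simp

lemma memLp_wt {r : ℝ} (hr : 1 / 2 < r) : MemLp (wt (-r)) 2 volume :=
  (memLp_two_iff_integrable_sq (measurable_wt _).aestronglyMeasurable).2 (integrable_wt hr)

lemma integrable_fhat {r : ℝ} (hr : 1 / 2 < r) (f : SobolevH r) : Integrable (fhat f) := by
  have h1 : Integrable (fun η => wt (-r) η * (wt r η * ‖fhat f η‖)) :=
    MemLp.integrable_mul (p := 2) (q := 2) (memLp_wt hr) (memLp_wt_fhat f)
  refine (integrable_norm_iff (aestronglyMeasurable_fhat f)).1 (h1.congr ?_)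
  refine Filter.Eventually.of_forall fun η => ?_
  simp only
  rw [← mul_assoc, wt_neg_exp, one_mul]

/-- The Cauchy-Schwarz inequality for a measure with a density. -/
lemma lintegral_mul_sq_le {a b : ℝ → ℝ≥0∞} (ha : AEMeasurable a) (hb : AEMeasurable b) :
    (∫⁻ y, b y * a y) ^ 2 ≤ (∫⁻ y, b y) * ∫⁻ y, b y * a y ^ 2 := by
  have h := ENNReal.lintegral_mul_le_Lp_mul_Lq volume Real.HolderConjugate.two_two
    (f := fun y => b y ^ (1 / 2 : ℝ)) (g := fun y => b y ^ (1 / 2 : ℝ) * a y)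
    (hb.pow_const _) ((hb.pow_const _).mul ha)
  have e1 (y : ℝ) : b y ^ (1 / 2 : ℝ) * (b y ^ (1 / 2 : ℝ) * a y) = b y * a y := by
    rw [← mul_assoc, ← ENNReal.rpow_add_of_nonneg _ _ (by norm_num) (by norm_num)]
    norm_num
  have e2 (y : ℝ) : (b y ^ (1 / 2 : ℝ)) ^ (2 : ℝ) = b y := by
    rw [← ENNReal.rpow_mul]; norm_num
  have e3 (y : ℝ) : (b y ^ (1 / 2 : ℝ) * a y) ^ (2 : ℝ) = b y * a y ^ 2 := by
    rw [ENNReal.mul_rpow_of_nonneg _ _ (by norm_num), e2]; norm_num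
  simp only [Pi.mul_apply, e1, e2, e3] at h
  refine (pow_le_pow_left' h 2).trans (le_of_eq ?_)
  have e4 (x : ℝ≥0∞) : (x ^ (1 / 2 : ℝ)) ^ 2 = x := by
    rw [← ENNReal.rpow_natCast, ← ENNReal.rpow_mul]; norm_num
  rw [mul_pow, e4, e4]

/-- Young's inequality `‖b ⋆ a‖₂ ≤ ‖b‖₁ ‖a‖₂`. -/
lemma lintegral_convolution_sq_le {a b : ℝ → ℝ≥0∞} (ha : Measurable a) (hb : Measurable b) :
    ∫⁻ x, (∫⁻ y, b y * a (x - y)) ^ 2 ≤ (∫⁻ y, b y) ^ 2 * ∫⁻ y, a y ^ 2 := by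
  calc ∫⁻ x, (∫⁻ y, b y * a (x - y)) ^ 2
      ≤ ∫⁻ x, (∫⁻ y, b y) * ∫⁻ y, b y * a (x - y) ^ 2 :=
        lintegral_mono fun x => lintegral_mul_sq_le (by fun_prop) hb.aemeasurable
    _ = (∫⁻ y, b y) * ∫⁻ y, ∫⁻ x, b y * a (x - y) ^ 2 := by
        rw [lintegral_const_mul _ (by fun_prop), lintegral_lintegral_swap]
        fun_prop
    _ = (∫⁻ y, b y) ^ 2 * ∫⁻ y, a y ^ 2 := by
        have h1 (y : ℝ) : ∫⁻ x, b y * a (x - y) ^ 2 = b y * ∫⁻ x, a x ^ 2 := by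
          rw [lintegral_const_mul _ (by fun_prop),
            lintegral_sub_right_eq_self (fun x => a x ^ 2) y]
        simp only [h1]
        rw [lintegral_mul_const _ hb, sq, mul_assoc]

/-- One of the frequencies `y` and `x - y` is at least half as large as `x`. This replaces the
Leibniz rule: in a product, all derivatives may be put on one of the factors. -/
lemma wt_le_add {r : ℝ} (hr : 0 ≤ r) (x y : ℝ) :
    wt r x ≤ 4 ^ (r / 2) * (wt r y + wt r (x - y)) := by
  wlog h : (2 * Real.pi * (x - y)) ^ 2 ≤ (2 * Real.pi * y) ^ 2 generalizing y
  · have h1 := this (x - y) (by rw [sub_sub_cancel]; exact (not_le.1 h).le)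
    rw [sub_sub_cancel] at h1
    linarith
  have h1 : 1 + (2 * Real.pi * x) ^ 2 ≤ 4 * (1 + (2 * Real.pi * y) ^ 2) := by
    nlinarith [sq_nonneg (2 * Real.pi * (x - y) - 2 * Real.pi * y)]
  have h2 : wt r x ≤ 4 ^ (r / 2) * wt r y := by
    rw [wt, wt, ← Real.mul_rpow (by norm_num) (by positivity)]
    exact Real.rpow_le_rpow (by positivity) h1 (by positivity)
  have h3 : 0 ≤ (4 : ℝ) ^ (r / 2) * wt r (x - y) :=
    mul_nonneg (by positivity) (wt_pos _ _).le
  linarith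

lemma continuous_fourierInv_of_integrable {G : ℝ → ℂ} (hG : Integrable G) :
    Continuous (𝓕⁻ G) := by
  have h : 𝓕⁻ G = fun x => 𝓕 G (-x) := funext fun x => Real.fourierInv_eq_fourier_neg G x
  rw [h]
  exact (VectorFourier.fourierIntegral_continuous Real.continuous_fourierChar
    (by exact continuous_inner) hG).comp continuous_neg

/-- The Fourier inversion formula for a square integrable function with integrable transform. -/
lemma ae_eq_fourierInv {g : Lp ℂ 2 (volume : Measure ℝ)} {G : ℝ → ℂ} (hG : Integrable G)
    (h : (𝓕 g : Lp ℂ 2 (volume : Measure ℝ)) =ᵐ[volume] G) : g =ᵐ[volume] 𝓕⁻ G := by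
  have hc := continuous_fourierInv_of_integrable hG
  have h0 : (fun x => g x - 𝓕⁻ G x) =ᵐ[volume] 0 := by
    refine ae_eq_zero_of_integral_schwartz ((locallyIntegrable_of_memLp_two (Lp.memLp g)).sub
      hc.locallyIntegrable) fun ψ => ?_
    -- Every Schwartz function is a transform, and testing with `𝓕 φ` turns both pairings into the
    -- integral of `φ * G`.
    obtain ⟨φ, rfl⟩ : ∃ φ : 𝓢(ℝ, ℂ), 𝓕 φ = ψ := ⟨𝓕⁻ ψ, FourierTransform.fourier_fourierInv_eq ψ⟩
    have hb : ∀ x, ‖𝓕⁻ G x‖ ≤ ∫ y, ‖G y‖ := fun x => by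
      rw [Real.fourierInv_eq_fourier_neg]
      exact VectorFourier.norm_fourierIntegral_le_integral_norm _ _ _ _ _
    have i1 : Integrable (fun x => (𝓕 φ) x * 𝓕⁻ G x) :=
      (𝓕 φ).integrable.mul_bdd hc.aestronglyMeasurable (Filter.Eventually.of_forall hb)
    simp only [mul_sub]
    rw [integral_sub (integrable_schwartz_mul _ (Lp.memLp g)) i1, ← integral_mul_fourier,
      sub_eq_zero]
    have e1 : ∫ x, (𝓕 φ) x * 𝓕⁻ G x = ∫ x, (𝓕⁻ (𝓕 φ)) x * G x := by
      have e2 := VectorFourier.integral_fourierIntegral_smul_eq_flip (μ := (volume : Measure ℝ))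
        (ν := (volume : Measure ℝ)) (L := -innerₗ ℝ) (e := Real.fourierChar)
        (f := (𝓕 φ : 𝓢(ℝ, ℂ))) (g := G) Real.continuous_fourierChar
        (by simp only [LinearMap.neg_apply, innerₗ_apply_apply]; fun_prop) (𝓕 φ).integrable hG
      have e3 : (-innerₗ ℝ : ℝ →ₗ[ℝ] ℝ →ₗ[ℝ] ℝ).flip = -innerₗ ℝ := by
        ext; simp
      rw [e3] at e2
      rw [SchwartzMap.fourierInv_coe]
      exact e2.symm
    rw [e1, FourierTransform.fourierInv_fourier_eq]
    refine integral_congr_ae ?_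
    filter_upwards [h] with η hη
    rw [hη]
  filter_upwards [h0] with x hx
  exact sub_eq_zero.1 hx

/-- Cauchy-Schwarz for `F = wt (-r) * (wt r * F)`. The first factor on the right is finite when `r >
1/2`; the integrability of the transform plays the role of the embedding of `H^r` in the bounded
functions. -/
lemma lintegral_enorm_fhat_le {r : ℝ} (f : SobolevH r) {F : ℝ → ℂ} (hF : Measurable F)
    (hf : fhat f =ᵐ[volume] F) :
    (∫⁻ η, ‖F η‖ₑ) ^ 2 ≤ (∫⁻ η, ENNReal.ofReal (wt (-r) η ^ 2)) * ENNReal.ofReal (‖f‖ ^ 2) := by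
  have hn : ENNReal.ofReal (‖f‖ ^ 2) = ∫⁻ η, (ENNReal.ofReal (wt r η) * ‖F η‖ₑ) ^ 2 := by
    rw [norm_sq_eq, ofReal_integral_eq_lintegral_ofReal (integrable_norm_sq f)
      (Filter.Eventually.of_forall fun η => sq_nonneg _)]
    refine lintegral_congr_ae ?_
    filter_upwards [hf] with η hη
    rw [ENNReal.ofReal_pow (mul_nonneg (wt_pos _ _).le (norm_nonneg _)),
      ENNReal.ofReal_mul (wt_pos _ _).le, ofReal_norm, hη]
  rw [hn]
  have hm := ENNReal.lintegral_mul_le_Lp_mul_Lq volume Real.HolderConjugate.two_two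
    (f := fun η => ENNReal.ofReal (wt (-r) η)) (g := fun η => ENNReal.ofReal (wt r η) * ‖F η‖ₑ)
    (by fun_prop) (by fun_prop)
  have e1 (η : ℝ) : ENNReal.ofReal (wt (-r) η) * (ENNReal.ofReal (wt r η) * ‖F η‖ₑ) = ‖F η‖ₑ := by
    rw [← mul_assoc, ← ENNReal.ofReal_mul (wt_pos _ _).le, wt_neg_exp, ENNReal.ofReal_one, one_mul]
  have e4 (x : ℝ≥0∞) : (x ^ (1 / 2 : ℝ)) ^ 2 = x := by
    rw [← ENNReal.rpow_natCast, ← ENNReal.rpow_mul]; norm_num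
  simp only [Pi.mul_apply, e1, ENNReal.rpow_two] at hm
  refine (pow_le_pow_left' hm 2).trans (le_of_eq ?_)
  rw [mul_pow, e4, e4]
  simp only [ENNReal.ofReal_pow (wt_pos _ _).le]

lemma ofReal_norm_sq_eq {r : ℝ} (f : SobolevH r) {F : ℝ → ℂ} (hf : fhat f =ᵐ[volume] F) :
    ENNReal.ofReal (‖f‖ ^ 2) = ∫⁻ η, (ENNReal.ofReal (wt r η) * ‖F η‖ₑ) ^ 2 := by
  rw [norm_sq_eq, ofReal_integral_eq_lintegral_ofReal (integrable_norm_sq f)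
    (Filter.Eventually.of_forall fun η => sq_nonneg _)]
  refine lintegral_congr_ae ?_
  filter_upwards [hf] with η hη
  rw [ENNReal.ofReal_pow (mul_nonneg (wt_pos _ _).le (norm_nonneg _)),
    ENNReal.ofReal_mul (wt_pos _ _).le, ofReal_norm, hη]

open Convolution in
/-- The weighted `L²` bound for the convolution of the transforms of two functions of `H^r`. -/
lemma lintegral_wt_convolution_le {r : ℝ} (hr : 0 ≤ r) (f g : SobolevH r) {F G : ℝ → ℂ}
    (hF : Measurable F) (hG : Measurable G) (hf : fhat f =ᵐ[volume] F)
    (hg : fhat g =ᵐ[volume] G) :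
    ∫⁻ x, (ENNReal.ofReal (wt r x) * ‖(F ⋆[ContinuousLinearMap.mul ℂ ℂ] G) x‖ₑ) ^ 2
      ≤ ENNReal.ofReal (4 ^ (r / 2)) ^ 2 * (4 * ((∫⁻ η, ENNReal.ofReal (wt (-r) η ^ 2))
        * (ENNReal.ofReal (‖f‖ ^ 2) * ENNReal.ofReal (‖g‖ ^ 2)))) := by
  set c := ENNReal.ofReal (4 ^ (r / 2))
  set w : ℝ → ℝ≥0∞ := fun x => ENNReal.ofReal (wt r x) with hw
  have hwm : Measurable w := by fun_prop
  have hpt (x : ℝ) : w x * ‖(F ⋆[ContinuousLinearMap.mul ℂ ℂ] G) x‖ₑ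
      ≤ c * ((∫⁻ y, ‖F y‖ₑ * (w (x - y) * ‖G (x - y)‖ₑ))
        + ∫⁻ y, ‖G y‖ₑ * (w (x - y) * ‖F (x - y)‖ₑ)) := by
    have h1 : ‖(F ⋆[ContinuousLinearMap.mul ℂ ℂ] G) x‖ₑ ≤ ∫⁻ y, ‖F y‖ₑ * ‖G (x - y)‖ₑ := by
      refine (enorm_integral_le_lintegral_enorm _).trans (le_of_eq ?_)
      refine lintegral_congr fun y => ?_
      rw [ContinuousLinearMap.mul_apply', enorm_mul]
    have h2 (y : ℝ) : w x ≤ c * (w (x - y) + w y) := by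
      rw [hw, ← ENNReal.ofReal_add (wt_pos _ _).le (wt_pos _ _).le,
        ← ENNReal.ofReal_mul (by positivity)]
      refine ENNReal.ofReal_le_ofReal ?_
      rw [add_comm]
      exact wt_le_add hr x y
    -- The convolution with the weight on `F` is reflected, so that both integrals run over the same
    -- pairs of frequencies and `h2` applies under the integral sign.
    have h3 : ∫⁻ y, ‖G y‖ₑ * (w (x - y) * ‖F (x - y)‖ₑ)
        = ∫⁻ y, ‖G (x - y)‖ₑ * (w y * ‖F y‖ₑ) := by
      rw [← lintegral_sub_left_eq_self _ x]
      simp only [sub_sub_cancel]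
    rw [h3, ← lintegral_add_left (by fun_prop), ← lintegral_const_mul _ (by fun_prop)]
    refine (mul_le_mul_right h1 _).trans ?_
    rw [← lintegral_const_mul _ (by fun_prop)]
    refine lintegral_mono fun y => ?_
    refine (mul_le_mul_left (h2 y) _).trans (le_of_eq ?_)
    ring
  have hsq (p q : ℝ≥0∞) : (p + q) ^ 2 ≤ 2 * (p ^ 2 + q ^ 2) := by
    have := ENNReal.rpow_add_le_mul_rpow_add_rpow p q (p := 2) (by norm_num)
    norm_num at this
    exact this
  have hI1 := lintegral_convolution_sq_le (a := fun y => w y * ‖G y‖ₑ) (b := fun y => ‖F y‖ₑ)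
    (by fun_prop) (by fun_prop)
  have hI2 := lintegral_convolution_sq_le (a := fun y => w y * ‖F y‖ₑ) (b := fun y => ‖G y‖ₑ)
    (by fun_prop) (by fun_prop)
  have hm1 : Measurable fun x => ∫⁻ y, ‖F y‖ₑ * (w (x - y) * ‖G (x - y)‖ₑ) := by fun_prop
  have hm2 : Measurable fun x => ∫⁻ y, ‖G y‖ₑ * (w (x - y) * ‖F (x - y)‖ₑ) := by fun_prop
  calc _ ≤ ∫⁻ x, c ^ 2 * (2 * ((∫⁻ y, ‖F y‖ₑ * (w (x - y) * ‖G (x - y)‖ₑ)) ^ 2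
        + (∫⁻ y, ‖G y‖ₑ * (w (x - y) * ‖F (x - y)‖ₑ)) ^ 2)) := by
        refine lintegral_mono fun x => ?_
        refine (pow_le_pow_left' (hpt x) 2).trans ?_
        rw [mul_pow]
        exact mul_le_mul_right (hsq _ _) _
    _ = c ^ 2 * (2 * ((∫⁻ x, (∫⁻ y, ‖F y‖ₑ * (w (x - y) * ‖G (x - y)‖ₑ)) ^ 2)
        + ∫⁻ x, (∫⁻ y, ‖G y‖ₑ * (w (x - y) * ‖F (x - y)‖ₑ)) ^ 2)) := by
        rw [lintegral_const_mul _ (by fun_prop), lintegral_const_mul _ (by fun_prop),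
          lintegral_add_left (by fun_prop)]
    _ ≤ _ := by
        refine mul_le_mul_right ?_ _
        rw [ofReal_norm_sq_eq f hf, ofReal_norm_sq_eq g hg]
        have hA := lintegral_enorm_fhat_le f hF hf
        have hB := lintegral_enorm_fhat_le g hG hg
        rw [ofReal_norm_sq_eq f hf] at hA
        rw [ofReal_norm_sq_eq g hg] at hB
        set Q := ∫⁻ η, ENNReal.ofReal (wt (-r) η ^ 2)
        set X := ∫⁻ η, (w η * ‖F η‖ₑ) ^ 2
        set Y := ∫⁻ η, (w η * ‖G η‖ₑ) ^ 2
        have k1 := hI1.trans (mul_le_mul_left hA Y)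
        have k2 := hI2.trans (mul_le_mul_left hB X)
        calc _ ≤ 2 * (Q * X * Y + Q * Y * X) := mul_le_mul_right (add_le_add k1 k2) _
          _ = 4 * (Q * (X * Y)) := by ring

open Convolution in
/-- `H^r` is an algebra for `r > 1/2`. -/
lemma exists_mul {r : ℝ} (hr : 1 / 2 < r) : ∃ K : ℝ, 0 ≤ K ∧ ∀ f g : SobolevH r,
    ∃ h : SobolevH r, toL2 r h =ᵐ[volume] (fun x => toL2 r f x * toL2 r g x) ∧
      ‖h‖ ≤ K * ‖f‖ * ‖g‖ := by
  set Q := ∫⁻ η, ENNReal.ofReal (wt (-r) η ^ 2) with hQ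
  have hQt : Q < ∞ := (integrable_wt hr).lintegral_lt_top
  -- The constant is the square root of the one in `lintegral_wt_convolution_le`, with `Q` for the
  -- integral of the squared weight.
  refine ⟨4 ^ (r / 2) * (2 * Real.sqrt Q.toReal), by positivity, fun f g => ?_⟩
  set F := (aestronglyMeasurable_fhat f).mk _
  set G := (aestronglyMeasurable_fhat g).mk _
  have hF : Measurable F := (aestronglyMeasurable_fhat f).stronglyMeasurable_mk.measurable
  have hG : Measurable G := (aestronglyMeasurable_fhat g).stronglyMeasurable_mk.measurable
  have hf : fhat f =ᵐ[volume] F := (aestronglyMeasurable_fhat f).ae_eq_mk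
  have hg : fhat g =ᵐ[volume] G := (aestronglyMeasurable_fhat g).ae_eq_mk
  have hFi : Integrable F := (integrable_fhat hr f).congr hf
  have hGi : Integrable G := (integrable_fhat hr g).congr hg
  set H := F ⋆[ContinuousLinearMap.mul ℂ ℂ] G with hH
  have hHi : Integrable H := hFi.integrable_convolution _ hGi
  have hbound := lintegral_wt_convolution_le (by linarith) f g hF hG hf hg
  rw [← hH] at hbound
  have hlt : ∫⁻ x, (ENNReal.ofReal (wt r x) * ‖H x‖ₑ) ^ 2 < ∞ :=
    hbound.trans_lt (by finiteness)
  have hwH : MemLp (fun η => wt r η * ‖H η‖) 2 volume := by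
    refine ⟨(measurable_wt r).aestronglyMeasurable.mul hHi.1.norm, ?_⟩
    rw [eLpNorm_lt_top_iff_lintegral_rpow_enorm_lt_top (by norm_num) (by norm_num)]
    refine lt_of_le_of_lt (le_of_eq (lintegral_congr fun η => ?_)) hlt
    rw [enorm_mul, enorm_norm, Real.enorm_of_nonneg (wt_pos r η).le]
    norm_num
  have hH2 : MemLp H 2 volume := hwH.mono hHi.1 (Filter.Eventually.of_forall fun η => by
    rw [Real.norm_of_nonneg (mul_nonneg (wt_pos _ _).le (norm_nonneg _))]
    exact le_mul_of_one_le_left (norm_nonneg _) (one_le_wt (by linarith) η))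
  set k : Lp ℂ 2 (volume : Measure ℝ) := 𝓕⁻ (hH2.toLp H) with hk
  have hkF : (𝓕 k : Lp ℂ 2 (volume : Measure ℝ)) =ᵐ[volume] H := by
    rw [hk, FourierTransform.fourier_fourierInv_eq]; exact hH2.coeFn_toLp
  -- All three transforms are integrable, so pointwise inversion holds for each of them and the
  -- inverse transform of the convolution is the product.
  have hkx : k =ᵐ[volume] fun x => ((toL2 r f x * toL2 r g x : ℝ) : ℂ) := by
    filter_upwards [ae_eq_fourierInv hHi hkF, ae_eq_fourierInv hFi hf, ae_eq_fourierInv hGi hg,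
      coeFn_complexify (toL2 r f), coeFn_complexify (toL2 r g)] with x h1 h2 h3 h4 h5
    have h6 : 𝓕⁻ F x = (toL2 r f x : ℂ) := h2.symm.trans h4
    have h7 : 𝓕⁻ G x = (toL2 r g x : ℂ) := h3.symm.trans h5
    rw [h1, Real.fourierInv_eq_fourier_neg, Real.fourier_mul_convolution_eq hFi hGi,
      ← Real.fourierInv_eq_fourier_neg, ← Real.fourierInv_eq_fourier_neg, h6, h7]
    push_cast; rfl
  set p : L2 := Complex.reCLM.compLpL 2 volume k with hp
  have hpx : p =ᵐ[volume] fun x => toL2 r f x * toL2 r g x := by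
    filter_upwards [Complex.reCLM.coeFn_compLpL (p := 2) (μ := (volume : Measure ℝ)) k, hkx]
      with x h1 h2
    rw [hp, h1, h2]; simp
  have hpk : complexify p = k := by
    refine Lp.ext ?_
    filter_upwards [coeFn_complexify p, hpx, hkx] with x h1 h2 h3
    rw [h1, h2, h3]
  have hph : hat p =ᵐ[volume] H := by rw [hat_apply, hpk]; exact hkF
  have hmem : sobolevENorm r p < ∞ := by
    refine lt_of_le_of_lt (le_of_eq (eLpNorm_congr_norm_ae ?_)) hwH.2
    filter_upwards [hph] with η hη
    rw [norm_mul, norm_norm, ← hη]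
    exact norm_smul _ _
  obtain ⟨h, hh⟩ : ∃ h : SobolevH r, toL2 r h = p := ⟨⟨p, hmem⟩, rfl⟩
  refine ⟨h, hh ▸ hpx, ?_⟩
  have hle := hbound
  rw [← ofReal_norm_sq_eq h (show fhat h =ᵐ[volume] H by rw [fhat, hh]; exact hph), ← hQ] at hle
  refine le_of_sq_le_sq ?_ (by positivity)
  have h4 : (4 : ℝ≥0∞) = ENNReal.ofReal 4 := by norm_num
  rw [← ENNReal.ofReal_toReal hQt.ne, h4, ← ENNReal.ofReal_pow (by positivity),
    ← ENNReal.ofReal_mul (by positivity), ← ENNReal.ofReal_mul (by positivity),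
    ← ENNReal.ofReal_mul (by positivity), ← ENNReal.ofReal_mul (by positivity),
    ENNReal.ofReal_le_ofReal_iff (by positivity)] at hle
  refine hle.trans (le_of_eq ?_)
  rw [mul_pow, mul_pow, mul_pow, mul_pow, Real.sq_sqrt ENNReal.toReal_nonneg]
  ring

open Classical in
/-- The product of two functions of `H^r`, `r > 1/2`. -/
noncomputable def sobMul (r : ℝ) : SobolevH r →L[ℝ] SobolevH r →L[ℝ] SobolevH r :=
  if hr : 1 / 2 < r then
    LinearMap.mkContinuous₂
      (LinearMap.mk₂ ℝ (fun f g => ((exists_mul hr).choose_spec.2 f g).choose)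
        (fun f f' g => ext_toL2 (Lp.ext (by
          filter_upwards [((exists_mul hr).choose_spec.2 (f + f') g).choose_spec.1,
            ((exists_mul hr).choose_spec.2 f g).choose_spec.1,
            ((exists_mul hr).choose_spec.2 f' g).choose_spec.1,
            Lp.coeFn_add (toL2 r f) (toL2 r f'),
            Lp.coeFn_add (toL2 r ((exists_mul hr).choose_spec.2 f g).choose)
              (toL2 r ((exists_mul hr).choose_spec.2 f' g).choose)] with x h1 h2 h3 h4 h5
          rw [h1, map_add, map_add, h4, h5, Pi.add_apply, Pi.add_apply, h2, h3, add_mul])))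
        (fun c f g => ext_toL2 (Lp.ext (by
          filter_upwards [((exists_mul hr).choose_spec.2 (c • f) g).choose_spec.1,
            ((exists_mul hr).choose_spec.2 f g).choose_spec.1,
            Lp.coeFn_smul c (toL2 r f),
            Lp.coeFn_smul c (toL2 r ((exists_mul hr).choose_spec.2 f g).choose)]
            with x h1 h2 h3 h4
          rw [h1, map_smul, map_smul, h3, h4, Pi.smul_apply, Pi.smul_apply, h2, smul_eq_mul,
            smul_eq_mul, mul_assoc])))
        (fun f g g' => ext_toL2 (Lp.ext (by
          filter_upwards [((exists_mul hr).choose_spec.2 f (g + g')).choose_spec.1,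
            ((exists_mul hr).choose_spec.2 f g).choose_spec.1,
            ((exists_mul hr).choose_spec.2 f g').choose_spec.1,
            Lp.coeFn_add (toL2 r g) (toL2 r g'),
            Lp.coeFn_add (toL2 r ((exists_mul hr).choose_spec.2 f g).choose)
              (toL2 r ((exists_mul hr).choose_spec.2 f g').choose)] with x h1 h2 h3 h4 h5
          rw [h1, map_add, map_add, h4, h5, Pi.add_apply, Pi.add_apply, h2, h3, mul_add])))
        (fun c f g => ext_toL2 (Lp.ext (by
          filter_upwards [((exists_mul hr).choose_spec.2 f (c • g)).choose_spec.1,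
            ((exists_mul hr).choose_spec.2 f g).choose_spec.1,
            Lp.coeFn_smul c (toL2 r g),
            Lp.coeFn_smul c (toL2 r ((exists_mul hr).choose_spec.2 f g).choose)]
            with x h1 h2 h3 h4
          rw [h1, map_smul, map_smul, h3, h4, Pi.smul_apply, Pi.smul_apply, h2, smul_eq_mul,
            smul_eq_mul, mul_left_comm]))))
      (exists_mul hr).choose fun f g => ((exists_mul hr).choose_spec.2 f g).choose_spec.2
  else 0

lemma toL2_sobMul {r : ℝ} (hr : 1 / 2 < r) (f g : SobolevH r) :
    toL2 r (sobMul r f g) =ᵐ[volume] fun x => toL2 r f x * toL2 r g x := by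
  have h1 : sobMul r f g = ((exists_mul hr).choose_spec.2 f g).choose := by
    rw [sobMul, dif_pos hr]; rfl
  rw [h1]
  exact ((exists_mul hr).choose_spec.2 f g).choose_spec.1

/-- Both sides are the same pointwise product in `L²`. This permits estimating one product in
different Sobolev norms. -/
lemma emb_sobMul {r r' : ℝ} (hr' : 1 / 2 < r') (h : r' ≤ r) (f g : SobolevH r) :
    emb r r' (sobMul r f g) = sobMul r' (emb r r' f) (emb r r' g) :=
  ext_toL2 (Lp.ext (by
    filter_upwards [toL2_sobMul (hr'.trans_le h) f g, toL2_sobMul hr' (emb r r' f) (emb r r' g)]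
      with x h1 h2
    rw [toL2_emb (by linarith) h, h2, h1, toL2_emb (by linarith) h, toL2_emb (by linarith) h]))

open SobolevH

/-! ### Distributional equations on the Fourier side. -/

/-- Multiplication by `-2πix` on the Schwartz space. -/
noncomputable def schwartzX : 𝓢(ℝ, ℂ) →L[ℂ] 𝓢(ℝ, ℂ) :=
  SchwartzMap.smulLeftCLM ℂ fun x : ℝ => (-(2 * Real.pi * Complex.I) * (x : ℂ) : ℂ)

lemma schwartzX_apply (ψ : 𝓢(ℝ, ℂ)) (x : ℝ) :
    schwartzX ψ x = -(2 * Real.pi * Complex.I) * x * ψ x := by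
  have h : Function.HasTemperateGrowth
      (fun x : ℝ => (-(2 * Real.pi * Complex.I) * (x : ℂ) : ℂ)) := by
    have h1 : Function.HasTemperateGrowth (fun x : ℝ => (x : ℂ)) :=
      Complex.ofRealCLM.hasTemperateGrowth
    fun_prop
  rw [schwartzX, SchwartzMap.smulLeftCLM_apply_apply h, smul_eq_mul]

lemma derivCLM_fourier (ψ : 𝓢(ℝ, ℂ)) :
    SchwartzMap.derivCLM ℂ ℂ (𝓕 ψ) = 𝓕 (schwartzX ψ) := by
  ext x
  have h1 : Integrable (fun x : ℝ => x • ψ x) := by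
    refine (SchwartzMap.integrable (schwartzX ψ)).const_mul
      ((-(2 * Real.pi * Complex.I))⁻¹) |>.congr (Filter.Eventually.of_forall fun x => ?_)
    have : (2 * Real.pi * Complex.I : ℂ) ≠ 0 := by
      simp [Real.pi_ne_zero, Complex.I_ne_zero]
    simp only [schwartzX_apply, Complex.real_smul]
    field_simp
  rw [SchwartzMap.derivCLM_apply, SchwartzMap.fourier_coe, SchwartzMap.fourier_coe,
    Real.deriv_fourier ψ.integrable h1]
  refine congrArg (fun h : ℝ → ℂ => 𝓕 h x) (funext fun y => ?_)
  rw [schwartzX_apply, smul_eq_mul]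
  ring

lemma integral_add_four {a b c d : ℝ → ℂ} (ha : Integrable a) (hb : Integrable b)
    (hc : Integrable c) (hd : Integrable d) :
    ∫ x, (a x + b x + c x + d x) = (∫ x, a x) + (∫ x, b x) + (∫ x, c x) + ∫ x, d x := by
  have h1 : ∫ x, (a x + b x + c x + d x) = (∫ x, (a x + b x + c x)) + ∫ x, d x :=
    integral_add ((ha.add hb).add hc) hd
  have h2 : ∫ x, (a x + b x + c x) = (∫ x, (a x + b x)) + ∫ x, c x :=
    integral_add (ha.add hb) hc
  rw [h1, h2, integral_add ha hb]

/-- The pairing of `f₀ - f₁' + f₂'' - f₃'''` with a test function. -/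
lemma integral_fourier_combination (f₀ f₁ f₂ f₃ : L2) (ψ : 𝓢(ℝ, ℂ)) :
    ∫ x, ((f₀ x : ℂ) * (𝓕 ψ) x + f₁ x * SchwartzMap.derivCLM ℂ ℂ (𝓕 ψ) x
        + f₂ x * SchwartzMap.derivCLM ℂ ℂ (SchwartzMap.derivCLM ℂ ℂ (𝓕 ψ)) x
        + f₃ x * SchwartzMap.derivCLM ℂ ℂ (SchwartzMap.derivCLM ℂ ℂ
          (SchwartzMap.derivCLM ℂ ℂ (𝓕 ψ))) x)
      = ∫ η, ψ η * (hat f₀ η - (2 * Real.pi * η * Complex.I) * hat f₁ η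
        + (2 * Real.pi * η * Complex.I) ^ 2 * hat f₂ η
        - (2 * Real.pi * η * Complex.I) ^ 3 * hat f₃ η) := by
  have hi (f : L2) (φ : 𝓢(ℝ, ℂ)) : Integrable (fun x => (f x : ℂ) * φ x) :=
    (integrable_schwartz_mul φ (Lp.memLp f).ofReal).congr
      (Filter.Eventually.of_forall fun x => mul_comm _ _)
  have hj (f : L2) (φ : 𝓢(ℝ, ℂ)) : Integrable (fun η => φ η * hat f η) :=
    integrable_schwartz_mul φ (Lp.memLp (hat f))
  have hij (f : L2) (φ : 𝓢(ℝ, ℂ)) : ∫ x, (f x : ℂ) * (𝓕 φ) x = ∫ η, φ η * hat f η := by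
    rw [integral_mul_hat]; simp only [mul_comm]
  simp only [derivCLM_fourier]
  rw [integral_add_four (hi _ _) (hi _ _) (hi _ _) (hi _ _), hij, hij, hij, hij,
    ← integral_add_four (hj _ _) (hj _ _) (hj _ _) (hj _ _)]
  refine integral_congr_ae (Filter.Eventually.of_forall fun η => ?_)
  simp only [schwartzX_apply]
  ring

lemma iteratedDeriv_schwartz (φ : 𝓢(ℝ, ℝ)) :
    iteratedDeriv 2 φ = SchwartzMap.derivCLM ℝ ℝ (SchwartzMap.derivCLM ℝ ℝ φ) ∧
    iteratedDeriv 3 φ = SchwartzMap.derivCLM ℝ ℝ (SchwartzMap.derivCLM ℝ ℝ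
      (SchwartzMap.derivCLM ℝ ℝ φ)) := by
  have h (ψ : 𝓢(ℝ, ℝ)) : (SchwartzMap.derivCLM ℝ ℝ ψ : ℝ → ℝ) = deriv ψ := rfl
  constructor
  · rw [h, h, iteratedDeriv_succ, iteratedDeriv_one]
  · rw [h, h, h, iteratedDeriv_succ, iteratedDeriv_succ, iteratedDeriv_one]

lemma derivCLM_postcomp {A B : Type*} [NormedAddCommGroup A] [NormedSpace ℝ A]
    [NormedAddCommGroup B] [NormedSpace ℝ B] (L : A →L[ℝ] B) (φ : 𝓢(ℝ, A)) :
    SchwartzMap.derivCLM ℝ B (φ.postcompCLM L)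
      = (SchwartzMap.derivCLM ℝ A φ).postcompCLM L := by
  ext x
  exact (L.hasFDerivAt.comp_hasDerivAt x (φ.hasDerivAt x)).deriv

/-- A distributional equation of order three on the line, in terms of Fourier transforms. -/
lemma weak_iff (f₀ f₁ f₂ f₃ : L2) :
    (∀ φ : 𝓢(ℝ, ℝ), ∫ x, (f₀ x * φ x + f₁ x * deriv φ x + f₂ x * iteratedDeriv 2 φ x
        + f₃ x * iteratedDeriv 3 φ x) = 0) ↔
      ∀ᵐ η, hat f₀ η - (2 * Real.pi * η * Complex.I) * hat f₁ η
        + (2 * Real.pi * η * Complex.I) ^ 2 * hat f₂ η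
        - (2 * Real.pi * η * Complex.I) ^ 3 * hat f₃ η = 0 := by
  have hD (φ : 𝓢(ℝ, ℂ)) : SchwartzMap.derivCLM ℂ ℂ φ = SchwartzMap.derivCLM ℝ ℂ φ := rfl
  constructor
  · intro h
    refine ae_eq_zero_of_integral_schwartz ?_ fun ψ => ?_
    · have hl (f : L2) : LocallyIntegrable (hat f) := locallyIntegrable_of_memLp_two (Lp.memLp _)
      refine (((hl f₀).sub ((hl f₁).continuous_mul ?_)).add ((hl f₂).continuous_mul ?_)).sub
        ((hl f₃).continuous_mul ?_) <;> fun_prop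
    · rw [← integral_fourier_combination]
      set Φ : 𝓢(ℝ, ℂ) := 𝓕 ψ
      have hi (f : L2) (φ : 𝓢(ℝ, ℂ)) : Integrable (fun x => (f x : ℂ) * φ x) :=
        (integrable_schwartz_mul φ (Lp.memLp f).ofReal).congr
          (Filter.Eventually.of_forall fun x => mul_comm _ _)
      have hint := (((hi f₀ Φ).add (hi f₁ (SchwartzMap.derivCLM ℂ ℂ Φ))).add
        (hi f₂ (SchwartzMap.derivCLM ℂ ℂ (SchwartzMap.derivCLM ℂ ℂ Φ)))).add
        (hi f₃ (SchwartzMap.derivCLM ℂ ℂ (SchwartzMap.derivCLM ℂ ℂ (SchwartzMap.derivCLM ℂ ℂ Φ))))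
      -- The hypothesis concerns real test functions only; it is applied to the real and imaginary
      -- parts of `Φ`.
      have key (L : ℂ →L[ℝ] ℝ) (hL : ∀ (a : ℝ) (z : ℂ), L (a * z) = a * L z) :
          L (∫ x, ((f₀ x : ℂ) * Φ x + f₁ x * SchwartzMap.derivCLM ℂ ℂ Φ x
            + f₂ x * SchwartzMap.derivCLM ℂ ℂ (SchwartzMap.derivCLM ℂ ℂ Φ) x
            + f₃ x * SchwartzMap.derivCLM ℂ ℂ (SchwartzMap.derivCLM ℂ ℂ
              (SchwartzMap.derivCLM ℂ ℂ Φ)) x)) = 0 := by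
        rw [← h (Φ.postcompCLM L)]
        refine (L.integral_comp_comm hint).symm.trans ?_
        refine integral_congr_ae (Filter.Eventually.of_forall fun x => ?_)
        simp only
        rw [(iteratedDeriv_schwartz _).1, (iteratedDeriv_schwartz _).2,
          ← SchwartzMap.derivCLM_apply ℝ, derivCLM_postcomp, derivCLM_postcomp, derivCLM_postcomp]
        simp only [hD, Pi.add_apply, map_add, hL, SchwartzMap.postcompCLM_apply]
      refine Complex.ext ?_ ?_
      · exact key Complex.reCLM (by simp)
      · exact key Complex.imCLM (by simp)
  · intro h φ
    obtain ⟨ψ, hψ⟩ : ∃ ψ : 𝓢(ℝ, ℂ), 𝓕 ψ = φ.postcompCLM Complex.ofRealCLM :=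
      ⟨𝓕⁻ _, FourierTransform.fourier_fourierInv_eq _⟩
    have h1 := integral_fourier_combination f₀ f₁ f₂ f₃ ψ
    have h2 : ∫ η, ψ η * (hat f₀ η - (2 * Real.pi * η * Complex.I) * hat f₁ η
        + (2 * Real.pi * η * Complex.I) ^ 2 * hat f₂ η
        - (2 * Real.pi * η * Complex.I) ^ 3 * hat f₃ η) = 0 := by
      refine integral_eq_zero_of_ae ?_
      filter_upwards [h] with η hη
      rw [hη, mul_zero, Pi.zero_apply]
    rw [h2, hψ] at h1
    simp only [hD, derivCLM_postcomp] at h1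
    refine Complex.ofReal_injective (Eq.trans ?_ h1)
    rw [← integral_complex_ofReal]
    refine integral_congr_ae (Filter.Eventually.of_forall fun x => ?_)
    simp only
    rw [(iteratedDeriv_schwartz _).1, (iteratedDeriv_schwartz _).2,
      ← SchwartzMap.derivCLM_apply ℝ]
    simp only [SchwartzMap.postcompCLM_apply, Complex.ofRealCLM_apply]
    push_cast
    rfl

/-- The Fourier side of the Benjamin-Bona-Mahony equation at a fixed time. -/
lemma bbm_weak_iff (σ ε δ : ℝ) {W V P : L2} (hP : P =ᵐ[volume] fun x => W x * W x) :
    (∀ φ : 𝓢(ℝ, ℝ),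
      ∫ x, (V x * φ x
        - σ * (W x * deriv φ x)
        - σ * ε * (W x ^ 2 / 2 * deriv φ x)
        + σ * (3 / 4) * δ ^ 2 * (W x * iteratedDeriv 3 φ x)
        - (5 / 4) * δ ^ 2 * (V x * iteratedDeriv 2 φ x)) = 0) ↔
      ∀ᵐ η : ℝ, (1 + 5 / 4 * δ ^ 2 * (2 * Real.pi * η) ^ 2 : ℂ) * hat V η
        + σ * (2 * Real.pi * η * Complex.I) * (1 + 3 / 4 * δ ^ 2 * (2 * Real.pi * η) ^ 2)
          * hat W η + σ * (ε / 2) * (2 * Real.pi * η * Complex.I) * hat P η = 0 := by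
  have h := weak_iff V ((-σ) • W + (-(σ * ε / 2)) • P) ((-(5 / 4 * δ ^ 2)) • V)
    ((σ * (3 / 4) * δ ^ 2) • W)
  refine Iff.trans (Iff.trans (forall_congr' fun φ => ?_) h) ?_
  · refine Eq.congr_left (integral_congr_ae ?_)
    filter_upwards [hP, Lp.coeFn_add ((-σ) • W) ((-(σ * ε / 2)) • P), Lp.coeFn_smul (-σ) W,
      Lp.coeFn_smul (-(σ * ε / 2)) P, Lp.coeFn_smul (-(5 / 4 * δ ^ 2)) V,
      Lp.coeFn_smul (σ * (3 / 4) * δ ^ 2) W] with x h1 h2 h3 h4 h5 h6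
    rw [h2, Pi.add_apply, h3, h4, h5, h6]
    simp only [Pi.smul_apply, smul_eq_mul, h1]
    ring
  · refine Filter.eventually_congr ?_
    filter_upwards [hat_add_ae ((-σ) • W) ((-(σ * ε / 2)) • P), hat_smul_ae (-σ) W,
      hat_smul_ae (-(σ * ε / 2)) P, hat_smul_ae (-(5 / 4 * δ ^ 2)) V,
      hat_smul_ae (σ * (3 / 4) * δ ^ 2) W] with η h2 h3 h4 h5 h6
    rw [h2, h3, h4, h5, h6]
    push_cast
    refine Eq.congr_left ?_
    have hI2 : (2 * Real.pi * η * Complex.I : ℂ) ^ 2 = -(2 * Real.pi * η) ^ 2 := by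
      rw [mul_pow, Complex.I_sq]; ring
    have hI3 : (2 * Real.pi * η * Complex.I : ℂ) ^ 3
        = -(2 * Real.pi * η) ^ 2 * (2 * Real.pi * η * Complex.I) := by
      rw [pow_succ, hI2]
    rw [hI3, hI2]
    ring

/-- The Fourier side of the improved Boussinesq equation at a fixed time. -/
lemma ib_weak_iff (ε δ : ℝ) {U V P : L2} (hP : P =ᵐ[volume] fun x => U x * U x) :
    (∀ φ : 𝓢(ℝ, ℝ),
      ∫ x, (V x * φ x - U x * iteratedDeriv 2 φ x - δ ^ 2 * (V x * iteratedDeriv 2 φ x)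
        - ε * (U x ^ 2 * iteratedDeriv 2 φ x)) = 0) ↔
      ∀ᵐ η : ℝ, (1 + δ ^ 2 * (2 * Real.pi * η) ^ 2 : ℂ) * hat V η
        + (2 * Real.pi * η) ^ 2 * (hat U η + ε * hat P η) = 0 := by
  have h := weak_iff V 0 ((-1 : ℝ) • U + ((-(δ ^ 2)) • V + (-ε) • P)) 0
  refine Iff.trans (Iff.trans (forall_congr' fun φ => ?_) h) ?_
  · refine Eq.congr_left (integral_congr_ae ?_)
    filter_upwards [hP, Lp.coeFn_add ((-1 : ℝ) • U) ((-(δ ^ 2)) • V + (-ε) • P),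
      Lp.coeFn_add ((-(δ ^ 2)) • V) ((-ε) • P), Lp.coeFn_smul (-1 : ℝ) U,
      Lp.coeFn_smul (-(δ ^ 2)) V, Lp.coeFn_smul (-ε) P,
      Lp.coeFn_zero ℝ 2 (volume : Measure ℝ)] with x h1 h2 h3 h4 h5 h6 h7
    rw [h2, Pi.add_apply, h3, Pi.add_apply, h4, h5, h6, h7]
    simp only [Pi.smul_apply, smul_eq_mul, h1, Pi.zero_apply]
    ring
  · refine Filter.eventually_congr ?_
    filter_upwards [hat_add_ae ((-1 : ℝ) • U) ((-(δ ^ 2)) • V + (-ε) • P),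
      hat_add_ae ((-(δ ^ 2)) • V) ((-ε) • P), hat_smul_ae (-1) U, hat_smul_ae (-(δ ^ 2)) V,
      hat_smul_ae (-ε) P, Lp.coeFn_zero ℂ 2 (volume : Measure ℝ)] with η h2 h3 h4 h5 h6 h7
    rw [h2, h3, h4, h5, h6, map_zero, h7, Pi.zero_apply]
    push_cast
    refine Eq.congr_left ?_
    have hI2 : (2 * Real.pi * η * Complex.I : ℂ) ^ 2 = -(2 * Real.pi * η) ^ 2 := by
      rw [mul_pow, Complex.I_sq]; ring
    rw [hI2]
    ring

lemma isWeakDeriv_iff (f g : L2) :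
    IsWeakDeriv f g ↔ ∀ᵐ η : ℝ, hat g η = (2 * Real.pi * η * Complex.I) * hat f η := by
  have hi (f : L2) (φ : 𝓢(ℝ, ℝ)) : Integrable (fun x => f x * φ x) :=
    MemLp.integrable_mul (p := 2) (q := 2) (Lp.memLp f) (φ.memLp 2 volume)
  refine Iff.trans (Iff.trans (forall_congr' fun φ => ?_) (weak_iff g f 0 0)) ?_
  · have h2 := hi f (SchwartzMap.derivCLM ℝ ℝ φ)
    simp only [SchwartzMap.derivCLM_apply] at h2
    rw [eq_neg_iff_add_eq_zero, ← integral_add (hi g φ) h2]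
    refine Eq.congr_left (integral_congr_ae ?_)
    filter_upwards [Lp.coeFn_zero ℝ 2 (volume : Measure ℝ)] with x hx
    rw [hx]; simp
  · refine Filter.eventually_congr ?_
    filter_upwards [Lp.coeFn_zero ℂ 2 (volume : Measure ℝ)] with η h7
    rw [map_zero, h7, Pi.zero_apply, mul_zero, mul_zero, add_zero, sub_zero, sub_eq_zero]

/-! ### Differential equations with a small nonlinearity on a prescribed time interval. -/

section ODE

variable {E X : Type*} [NormedAddCommGroup E] [NormedSpace ℝ E]
  [NormedAddCommGroup X] [NormedSpace ℝ X]

/-- The weight `e^{-2Kt}` turns the Volterra operator with Lipschitz constant `K` into a contraction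
with factor `1/2`, whatever the length of the interval. -/
lemma integral_exp_mul_le (K t : ℝ) :
    Real.exp (-(2 * K * t)) * ∫ τ in (0 : ℝ)..t, K * Real.exp (2 * K * τ) ≤ 1 / 2 := by
  have h1 : ∫ τ in (0 : ℝ)..t, K * Real.exp (2 * K * τ)
      = Real.exp (2 * K * t) / 2 - Real.exp (2 * K * 0) / 2 := by
    refine intervalIntegral.integral_eq_sub_of_hasDerivAt (f := fun τ => Real.exp (2 * K * τ) / 2)
      (fun τ _ => ?_) (Continuous.intervalIntegrable (by fun_prop) _ _)
    have := (((hasDerivAt_id τ).const_mul (2 * K)).exp).div_const 2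
    refine this.congr_deriv ?_
    simp only [id]
    ring
  rw [h1, mul_zero, Real.exp_zero, mul_sub, ← mul_div_assoc, ← Real.exp_add]
  have := Real.exp_pos (-(2 * K * t))
  norm_num
  positivity

/-- Existence on a prescribed time interval for an equation that is Lipschitz continuous on the unit
ball and almost has the trivial solution. -/
lemma exists_small_solution [CompleteSpace E] {f : ℝ → E → E} {T K η : ℝ} (hT : 0 < T) (hK : 0 < K)
    (hf : ∀ z : ℝ → E, Continuous z → Continuous fun t => f t (z t))
    (hLip : ∀ t ∈ Icc 0 T, ∀ z z', ‖z‖ ≤ 1 → ‖z'‖ ≤ 1 → ‖f t z - f t z'‖ ≤ K * ‖z - z'‖)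
    (h0 : ∀ t ∈ Icc 0 T, ‖f t 0‖ ≤ η) (hη : 2 * T * η * Real.exp (2 * K * T) ≤ 1) :
    ∃ Z : ℝ → E, Continuous Z ∧ Z 0 = 0 ∧ (∀ t ∈ Icc 0 T, ‖Z t‖ ≤ 1) ∧
      ∀ t ∈ Icc 0 T, HasDerivWithinAt Z (f t (Z t)) (Icc 0 T) t := by
  have hT' : (0 : ℝ) ≤ T := hT.le
  set ρ := Real.exp (-(2 * K * T)) with hρ
  have hρ0 : 0 < ρ := Real.exp_pos _
  have hη' : T * η ≤ ρ / 2 := by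
    have h1 : Real.exp (2 * K * T) * ρ = 1 := by rw [hρ, ← Real.exp_add]; simp
    nlinarith
  have hη0 : 0 ≤ η := (norm_nonneg _).trans (h0 0 ⟨le_rfl, hT'⟩)
  -- The unknown of the fixed point problem is `Y = e^{-2Kt} Z` on `[0,T]`, and `ext Y` is `Z`,
  -- continued by constants to the line. For `‖Y‖ ≤ ρ = e^{-2KT}` the function `Z` stays in the unit
  -- ball, where `f` is Lipschitz continuous.
  let ext (Y : C(Icc (0 : ℝ) T, E)) (t : ℝ) : E :=
    Real.exp (2 * K * (projIcc 0 T hT' t : ℝ)) • Y (projIcc 0 T hT' t)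
  have hproj : Continuous (projIcc 0 T hT') := continuous_projIcc
  have hextc (Y : C(Icc (0 : ℝ) T, E)) : Continuous (ext Y) := by
    have := hproj.subtype_val
    have h2 := Y.continuous.comp hproj
    exact (by fun_prop : Continuous fun t => Real.exp (2 * K * (projIcc 0 T hT' t : ℝ))).smul h2
  have hext_of (Y : C(Icc (0 : ℝ) T, E)) {t : ℝ} (ht : t ∈ Icc 0 T) :
      ext Y t = Real.exp (2 * K * t) • Y ⟨t, ht⟩ := by
    simp only [ext, projIcc_of_mem hT' ht]
  have hFc (Y : C(Icc (0 : ℝ) T, E)) : Continuous fun t => f t (ext Y t) := hf _ (hextc Y)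
  have hIc (Y : C(Icc (0 : ℝ) T, E)) :
      Continuous fun t : ℝ => ∫ τ in (0 : ℝ)..t, f τ (ext Y τ) :=
    intervalIntegral.continuous_primitive (fun a b => (hFc Y).intervalIntegrable a b) 0
  let Φ (Y : C(Icc (0 : ℝ) T, E)) : C(Icc (0 : ℝ) T, E) :=
    ⟨fun t => Real.exp (-(2 * K * (t : ℝ))) • ∫ τ in (0 : ℝ)..(t : ℝ), f τ (ext Y τ),
      (by fun_prop : Continuous fun t : Icc (0 : ℝ) T => Real.exp (-(2 * K * (t : ℝ)))).smul
        ((hIc Y).comp continuous_subtype_val)⟩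
  let s : Set C(Icc (0 : ℝ) T, E) := Metric.closedBall 0 ρ
  have hext1 (Y : C(Icc (0 : ℝ) T, E)) (hY : Y ∈ s) {t : ℝ} (ht : t ∈ Icc 0 T) : ‖ext Y t‖ ≤ 1 := by
    rw [hext_of Y ht, norm_smul, Real.norm_of_nonneg (Real.exp_pos _).le]
    have h1 : ‖Y ⟨t, ht⟩‖ ≤ ρ := (Y.norm_coe_le_norm _).trans (by simpa [s] using hY)
    calc Real.exp (2 * K * t) * ‖Y ⟨t, ht⟩‖ ≤ Real.exp (2 * K * T) * ρ := by
          gcongr; exact ht.2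
      _ = 1 := by rw [hρ, ← Real.exp_add]; simp
  have hdiff (Y Y' : C(Icc (0 : ℝ) T, E)) (hY : Y ∈ s) (hY' : Y' ∈ s) :
      ‖Φ Y - Φ Y'‖ ≤ 1 / 2 * ‖Y - Y'‖ := by
    refine (ContinuousMap.norm_le _ (by positivity)).2 fun t => ?_
    have e1 : (Φ Y - Φ Y') t = Real.exp (-(2 * K * (t : ℝ))) •
        ∫ τ in (0 : ℝ)..(t : ℝ), (f τ (ext Y τ) - f τ (ext Y' τ)) := by
      rw [intervalIntegral.integral_sub ((hFc Y).intervalIntegrable _ _)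
        ((hFc Y').intervalIntegrable _ _), smul_sub]
      rfl
    rw [e1, norm_smul, Real.norm_of_nonneg (Real.exp_pos _).le]
    have e2 : ‖∫ τ in (0 : ℝ)..(t : ℝ), (f τ (ext Y τ) - f τ (ext Y' τ))‖
        ≤ ∫ τ in (0 : ℝ)..(t : ℝ), K * Real.exp (2 * K * τ) * ‖Y - Y'‖ := by
      refine intervalIntegral.norm_integral_le_of_norm_le t.2.1 ?_
        (Continuous.intervalIntegrable (by fun_prop) _ _)
      refine Filter.Eventually.of_forall fun τ hτ => ?_
      have hτ' : τ ∈ Icc 0 T := ⟨hτ.1.le, hτ.2.trans t.2.2⟩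
      refine (hLip τ hτ' _ _ (hext1 Y hY hτ') (hext1 Y' hY' hτ')).trans ?_
      rw [hext_of Y hτ', hext_of Y' hτ', ← smul_sub, norm_smul,
        Real.norm_of_nonneg (Real.exp_pos _).le]
      exact (mul_le_mul_of_nonneg_left (mul_le_mul_of_nonneg_left
        ((Y - Y').norm_coe_le_norm ⟨τ, hτ'⟩) (Real.exp_pos _).le) hK.le).trans_eq
        (mul_assoc _ _ _).symm
    rw [intervalIntegral.integral_mul_const] at e2
    calc _ ≤ Real.exp (-(2 * K * (t : ℝ))) *
          ((∫ τ in (0 : ℝ)..(t : ℝ), K * Real.exp (2 * K * τ)) * ‖Y - Y'‖) := by gcongr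
      _ = (Real.exp (-(2 * K * (t : ℝ))) * ∫ τ in (0 : ℝ)..(t : ℝ), K * Real.exp (2 * K * τ))
          * ‖Y - Y'‖ := by ring
      _ ≤ _ := by gcongr; exact integral_exp_mul_le K t
  have hzero : (0 : C(Icc (0 : ℝ) T, E)) ∈ s := Metric.mem_closedBall_self hρ0.le
  have hΦ0 : ‖Φ 0‖ ≤ ρ / 2 := by
    refine (ContinuousMap.norm_le _ (by positivity)).2 fun t => ?_
    change ‖Real.exp (-(2 * K * (t : ℝ))) • ∫ τ in (0 : ℝ)..(t : ℝ), f τ (ext 0 τ)‖ ≤ _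
    rw [norm_smul, Real.norm_of_nonneg (Real.exp_pos _).le]
    have e2 : ‖∫ τ in (0 : ℝ)..(t : ℝ), f τ (ext 0 τ)‖ ≤ η * |(t : ℝ) - 0| := by
      refine intervalIntegral.norm_integral_le_of_norm_le_const fun τ hτ => ?_
      rw [uIoc_of_le t.2.1] at hτ
      have hτ' : τ ∈ Icc 0 T := ⟨hτ.1.le, hτ.2.trans t.2.2⟩
      have e3 : ext 0 τ = 0 := by simp [ext]
      rw [e3]
      exact h0 τ hτ'
    rw [sub_zero, abs_of_nonneg t.2.1] at e2
    have e4 : Real.exp (-(2 * K * (t : ℝ))) ≤ 1 :=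
      Real.exp_le_one_iff.2 (by have := t.2.1; nlinarith)
    calc _ ≤ 1 * (η * (t : ℝ)) := by gcongr
      _ ≤ T * η := by nlinarith [t.2.2]
      _ ≤ ρ / 2 := hη'
  -- One half of the radius is used up by the contraction, the other by `Φ 0`; the smallness
  -- hypothesis on `η` bounds the latter.
  have hmaps : MapsTo Φ s s := fun Y hY => by
    have hY1 : ‖Y‖ ≤ ρ := by simpa [s] using hY
    have h1 := hdiff Y 0 hY hzero
    rw [sub_zero] at h1
    have h2 : ‖Φ Y‖ ≤ ‖Φ Y - Φ 0‖ + ‖Φ 0‖ := by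
      simpa using norm_add_le (Φ Y - Φ 0) (Φ 0)
    simp only [s, Metric.mem_closedBall, dist_zero_right]
    linarith
  have hcontr : ContractingWith (1 / 2) (hmaps.restrict Φ s s) := by
    refine ⟨by norm_num, LipschitzWith.of_dist_le_mul fun Y Y' => ?_⟩
    simp only [Subtype.dist_eq, MapsTo.val_restrict_apply, dist_eq_norm]
    simpa using hdiff Y Y' Y.2 Y'.2
  obtain ⟨Y, hYs, hYfix, -⟩ := hcontr.exists_fixedPoint' (Metric.isClosed_closedBall.isComplete)
    hmaps hzero (edist_ne_top _ _)
  have hZ {t : ℝ} (ht : t ∈ Icc 0 T) : ext Y t = ∫ τ in (0 : ℝ)..t, f τ (ext Y τ) := by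
    have h1 : Y ⟨t, ht⟩ = Real.exp (-(2 * K * t)) • ∫ τ in (0 : ℝ)..t, f τ (ext Y τ) := by
      conv_lhs => rw [← show Φ Y = Y from hYfix]
      rfl
    rw [hext_of Y ht, h1, smul_smul, ← Real.exp_add]
    simp
  refine ⟨ext Y, hextc Y, ?_, fun t ht => hext1 Y hYs ht, fun t ht => ?_⟩
  · rw [hZ ⟨le_rfl, hT'⟩, intervalIntegral.integral_same]
  · have h1 := (intervalIntegral.integral_hasDerivAt_right ((hFc Y).intervalIntegrable 0 t)
      (hFc Y).aestronglyMeasurable.stronglyMeasurableAtFilter (hFc Y).continuousAt)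
    exact h1.hasDerivWithinAt.congr (fun x hx => hZ hx) (hZ ht)

/-- Strong continuity with a uniform bound suffices; groups with unbounded generators are not
continuous in the operator norm. -/
lemma continuous_clm_apply {S : ℝ → E →L[ℝ] X} {c : ℝ} (hS : ∀ z, Continuous fun t => S t z)
    (hb : ∀ t, ‖S t‖ ≤ c) {z : ℝ → E} (hz : Continuous z) : Continuous fun t => S t (z t) :=
  continuous_iff_continuousAt.2 fun t => tendsto_clm_apply (Filter.Eventually.of_forall hb)
    hz.continuousAt ((hS (z t)).continuousAt)

lemma norm_square_sub_le (B : X →L[ℝ] X →L[ℝ] X) (x y : X) :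
    ‖B x x - B y y‖ ≤ ‖B‖ * (‖x‖ + ‖y‖) * ‖x - y‖ := by
  have h : B x x - B y y = B x (x - y) + B (x - y) y := by
    simp only [map_sub, sub_apply]; abel
  rw [h]
  refine (norm_add_le _ _).trans ?_
  have h1 := B.le_opNorm₂ x (x - y)
  have h2 := B.le_opNorm₂ (x - y) y
  linarith

/-- Existence on a prescribed time interval for equations with a small quadratic nonlinearity. -/
lemma exists_small_quadratic [CompleteSpace E] {S : ℝ → E →L[ℝ] X} {R : ℝ → X →L[ℝ] E}
    (B : X →L[ℝ] X →L[ℝ] X) {a : E} {T κ M η : ℝ} (hT : 0 < T)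
    (hS : ∀ z, Continuous fun t => S t z) (hSb : ∀ t, ‖S t‖ ≤ 2)
    (hR : ∀ z, Continuous fun t => R t z) (hRb : ∀ t, ‖R t‖ ≤ κ) (ha : ‖a‖ ≤ M)
    (h0 : ∀ t, ‖R t (B (S t a) (S t a))‖ ≤ η)
    (hη : 2 * T * η * Real.exp (2 * (8 * κ * ‖B‖ * (M + 1) + 1) * T) ≤ 1) :
    ∃ Z : ℝ → E, Continuous Z ∧ Z 0 = 0 ∧ (∀ t ∈ Icc 0 T, ‖Z t‖ ≤ 1) ∧
      ∀ t ∈ Icc 0 T, HasDerivWithinAt Z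
        (R t (B (S t (a + Z t)) (S t (a + Z t)))) (Icc 0 T) t := by
  have hκ : 0 ≤ κ := (norm_nonneg _).trans (hRb 0)
  have hM : 0 ≤ M := (norm_nonneg _).trans ha
  -- On the unit ball `‖S t (a + z)‖ ≤ 2(M + 1)`. The two arguments of `B` give `4(M + 1)` and the
  -- difference in `z` another factor `2`; the summand `1` only makes the constant positive.
  refine exists_small_solution (f := fun t z => R t (B (S t (a + z)) (S t (a + z)))) hT
    (K := 8 * κ * ‖B‖ * (M + 1) + 1) (by positivity) (fun z hz => ?_) (fun t _ z z' hz hz' => ?_)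
    (fun t _ => by simpa using h0 t) hη
  · have h1 : Continuous fun t => S t (a + z t) := continuous_clm_apply hS hSb (by fun_prop)
    have h2 : Continuous fun t => B (S t (a + z t)) (S t (a + z t)) :=
      (B.continuous.comp h1).clm_apply h1
    exact continuous_clm_apply hR hRb h2
  · have hx (y : E) (hy : ‖y‖ ≤ 1) : ‖S t (a + y)‖ ≤ 2 * (M + 1) :=
      ((S t).le_of_opNorm_le (hSb t) _).trans (by
        have := norm_add_le a y
        gcongr
        linarith)
    have hd : ‖S t (a + z) - S t (a + z')‖ ≤ 2 * ‖z - z'‖ := by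
      rw [← map_sub, add_sub_add_left_eq_sub]
      exact (S t).le_of_opNorm_le (hSb t) _
    rw [← map_sub]
    calc _ ≤ κ * ‖B (S t (a + z)) (S t (a + z)) - B (S t (a + z')) (S t (a + z'))‖ :=
          (R t).le_of_opNorm_le (hRb t) _
      _ ≤ κ * (‖B‖ * (2 * (M + 1) + 2 * (M + 1)) * (2 * ‖z - z'‖)) := by
          gcongr
          refine (norm_square_sub_le B _ _).trans ?_
          gcongr
          · exact hx z hz
          · exact hx z' hz'
      _ = 8 * κ * ‖B‖ * (M + 1) * ‖z - z'‖ := by ring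
      _ ≤ _ := by gcongr; linarith

end ODE

open SobolevH

/-! ### Unitary groups with an odd phase, and their generators. -/

/-- Measurable odd functions: the dispersion relations of real, skew-adjoint operators. -/
structure IsPhase (θ : ℝ → ℝ) : Prop where
  meas : Measurable θ
  odd : ∀ η, θ (-η) = -θ η

lemma IsPhase.neg {θ : ℝ → ℝ} (h : IsPhase θ) : IsPhase (-θ) :=
  ⟨h.meas.neg, fun η => by simp [h.odd]⟩

lemma IsPhase.const_mul {θ : ℝ → ℝ} (h : IsPhase θ) (c : ℝ) : IsPhase fun η => c * θ η :=
  ⟨h.meas.const_mul c, fun η => by simp [h.odd]⟩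

/-- The symbol `e^{-iθt}`. -/
noncomputable def grpSymb (θ : ℝ → ℝ) (t η : ℝ) : ℂ := Complex.exp (-((θ η * t : ℝ) : ℂ) * Complex.I)

lemma norm_grpSymb (θ : ℝ → ℝ) (t η : ℝ) : ‖grpSymb θ t η‖ = 1 := by
  rw [grpSymb, ← Complex.ofReal_neg, Complex.norm_exp_ofReal_mul_I]

lemma grpSymb_zero (θ : ℝ → ℝ) (η : ℝ) : grpSymb θ 0 η = 1 := by simp [grpSymb]

lemma grpSymb_add (θ : ℝ → ℝ) (s t η : ℝ) :
    grpSymb θ (s + t) η = grpSymb θ s η * grpSymb θ t η := by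
  rw [grpSymb, grpSymb, grpSymb, ← Complex.exp_add]
  congr 1
  push_cast
  ring

lemma grpSymb_neg (θ : ℝ → ℝ) (t : ℝ) : grpSymb θ (-t) = grpSymb (-θ) t := by
  funext η; simp [grpSymb]

lemma hasDerivAt_grpSymb (θ : ℝ → ℝ) (t η : ℝ) :
    HasDerivAt (fun t => grpSymb θ t η) (-(θ η : ℂ) * Complex.I * grpSymb θ t η) t := by
  have h1 : HasDerivAt (fun t : ℝ => ((θ η * t : ℝ) : ℂ)) (θ η : ℂ) t := by
    simpa using ((hasDerivAt_id t).const_mul (θ η)).ofReal_comp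
  refine ((h1.neg.mul_const Complex.I).cexp).congr_deriv ?_
  rw [grpSymb, Pi.neg_apply]
  ring

section

variable {θ : ℝ → ℝ}

lemma isSymb_grp (hθ : IsPhase θ) {r : ℝ} (hr : 0 ≤ r) (t : ℝ) : IsSymb r r 1 (grpSymb θ t) where
  nonneg := hr
  meas := by
    have := hθ.meas
    unfold grpSymb
    fun_prop
  herm η := by
    rw [grpSymb, grpSymb, ← Complex.exp_conj, hθ.odd]
    simp
  bound η := by rw [norm_grpSymb]

/-- The unitary group with the symbol `e^{-iθt}` on `H^r`. -/
noncomputable def grp (θ : ℝ → ℝ) (r t : ℝ) : SobolevH r →L[ℝ] SobolevH r := op r r (grpSymb θ t)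

lemma fhat_grp (hθ : IsPhase θ) {r : ℝ} (hr : 0 ≤ r) (t : ℝ) (f : SobolevH r) :
    fhat (grp θ r t f) =ᵐ[volume] fun η => grpSymb θ t η * fhat f η :=
  (isSymb_grp hθ hr t).fhat_op f

lemma grp_neg (θ : ℝ → ℝ) (r t : ℝ) : grp θ r (-t) = grp (-θ) r t := by
  rw [grp, grpSymb_neg, grp]

lemma norm_grp_le (hθ : IsPhase θ) {r : ℝ} (hr : 0 ≤ r) (t : ℝ) : ‖grp θ r t‖ ≤ 1 :=
  (isSymb_grp hθ hr t).op_opNorm_le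

lemma norm_grp_apply_le (hθ : IsPhase θ) {r : ℝ} (hr : 0 ≤ r) (t : ℝ) (f : SobolevH r) :
    ‖grp θ r t f‖ ≤ ‖f‖ := by
  simpa using (grp θ r t).le_of_opNorm_le (norm_grp_le hθ hr t) f

lemma continuous_grp (hθ : IsPhase θ) {r : ℝ} (hr : 0 ≤ r) (f : SobolevH r) :
    Continuous fun t => grp θ r t f :=
  continuous_iff_continuousAt.2 fun t => op_tendsto
    (Filter.Eventually.of_forall fun t => isSymb_grp hθ hr t) (isSymb_grp hθ hr t)
    (fun η => (hasDerivAt_grpSymb θ t η).continuousAt.tendsto) f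

lemma grp_zero (hθ : IsPhase θ) {r : ℝ} (hr : 0 ≤ r) (f : SobolevH r) : grp θ r 0 f = f :=
  ext_fhat (by
    filter_upwards [fhat_grp hθ hr 0 f] with η h1
    rw [h1, grpSymb_zero, one_mul])

lemma grp_grp (hθ : IsPhase θ) {r : ℝ} (hr : 0 ≤ r) (s t : ℝ) (f : SobolevH r) :
    grp θ r s (grp θ r t f) = grp θ r (s + t) f :=
  ext_fhat (by
    filter_upwards [fhat_grp hθ hr s (grp θ r t f), fhat_grp hθ hr t f, fhat_grp hθ hr (s + t) f]
      with η h1 h2 h3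
    rw [h1, h2, h3, grpSymb_add, mul_assoc])

lemma grp_grp_neg (hθ : IsPhase θ) {r : ℝ} (hr : 0 ≤ r) (t : ℝ) (f : SobolevH r) :
    grp θ r t (grp θ r (-t) f) = f := by
  rw [grp_grp hθ hr, add_neg_cancel, grp_zero hθ hr]

lemma emb_grp (hθ : IsPhase θ) {r r' : ℝ} (hr' : 0 ≤ r') (h : r' ≤ r) (t : ℝ) (f : SobolevH r) :
    emb r r' (grp θ r t f) = grp θ r' t (emb r r' f) :=
  ext_fhat (by
    filter_upwards [fhat_emb hr' h (grp θ r t f), fhat_grp hθ (hr'.trans h) t f,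
      fhat_grp hθ hr' t (emb r r' f), fhat_emb hr' h f] with η h1 h2 h3 h4
    rw [h1, h2, h3, h4])

/-- The skew-adjoint operator with the symbol `iθ`. -/
noncomputable def skew (θ : ℝ → ℝ) (r r' : ℝ) : SobolevH r →L[ℝ] SobolevH r' :=
  op r r' fun η => (θ η : ℂ) * Complex.I

/-- `iθ` is the symbol of an operator from `H^r` to `H^{r'}` of norm at most `C`. -/
structure IsSkew (r r' C : ℝ) (θ : ℝ → ℝ) : Prop where
  nonneg : 0 ≤ r'
  phase : IsPhase θ
  bound : ∀ η, |θ η| * wt r' η ≤ C * wt r η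

lemma IsSkew.isSymb {r r' C : ℝ} (h : IsSkew r r' C θ) :
    IsSymb r r' C fun η => (θ η : ℂ) * Complex.I where
  nonneg := h.nonneg
  meas := by have := h.phase.meas; fun_prop
  herm η := by simp [h.phase.odd]
  bound η := by simpa using h.bound η

lemma IsSkew.fhat_skew {r r' C : ℝ} (h : IsSkew r r' C θ) (f : SobolevH r) :
    fhat (skew θ r r' f) =ᵐ[volume] fun η => (θ η : ℂ) * Complex.I * fhat f η := h.isSymb.fhat_op f

lemma IsSkew.norm_skew_le {r r' C : ℝ} (h : IsSkew r r' C θ) (f : SobolevH r) :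
    ‖skew θ r r' f‖ ≤ C * ‖f‖ := h.isSymb.norm_op_le f

lemma skew_grp {r r' C : ℝ} {θ' : ℝ → ℝ} (h : IsSkew r r' C θ') (hr : 0 ≤ r) (hθ : IsPhase θ)
    (t : ℝ) (f : SobolevH r) : skew θ' r r' (grp θ r t f) = grp θ r' t (skew θ' r r' f) :=
  ext_fhat (by
    filter_upwards [h.fhat_skew (grp θ r t f), fhat_grp hθ hr t f,
      fhat_grp hθ h.nonneg t (skew θ' r r' f), h.fhat_skew f] with η h1 h2 h3 h4
    rw [h1, h2, h3, h4]
    ring)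

/-- The action of a multiplier does not depend on the Sobolev spaces between which it acts. -/
lemma skew_compat {r₁ r₁' C₁ r₂ r₂' C₂ : ℝ} (h₁ : IsSkew r₁ r₁' C₁ θ) (h₂ : IsSkew r₂ r₂' C₂ θ)
    {f : SobolevH r₁} {g : SobolevH r₂} (hfg : toL2 r₁ f = toL2 r₂ g) :
    toL2 r₁' (skew θ r₁ r₁' f) = toL2 r₂' (skew θ r₂ r₂' g) :=
  hat_ext (by
    have e : fhat f = fhat g := by rw [fhat, fhat, hfg]
    filter_upwards [h₁.fhat_skew f, h₂.fhat_skew g] with η h1 h2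
    rw [fhat] at h1 h2
    rw [h1, h2, e])

/-- The derivative of `e^{-iθt} A(t)`. -/
lemma hasDerivWithinAt_grp {r r' C : ℝ} (h : IsSkew r r' C θ) (hrr : r' ≤ r)
    {A : ℝ → SobolevH r} {A' : SobolevH r} {s : Set ℝ} {t : ℝ} (hA : HasDerivWithinAt A A' s t) :
    HasDerivWithinAt (fun t => emb r r' (grp θ r t (A t)))
      (emb r r' (grp θ r t A') - skew θ r r' (grp θ r t (A t))) s t := by
  have hθ := h.phase
  have hr : 0 ≤ r := h.nonneg.trans hrr
  rw [hasDerivWithinAt_iff_tendsto_slope] at hA ⊢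
  -- The difference quotient is the group at time `y` applied to the slope of `A`, plus the slope of
  -- the group applied to the fixed element `A t`. This is the limit of the first part.
  have h1 : Filter.Tendsto (fun y => emb r r' (grp θ r y (slope A t y)))
      (nhdsWithin t (s \ {t})) (nhds (emb r r' (grp θ r t A'))) := by
    refine ((emb r r').continuous.tendsto _).comp ?_
    exact tendsto_clm_apply (Filter.Eventually.of_forall fun y => norm_grp_le hθ hr y) hA
      ((continuous_grp hθ hr A').continuousAt.tendsto.mono_left nhdsWithin_le_nhds)
  -- The slope of the group is itself a multiplier. By the mean value inequality it is bounded by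
  -- `|θ|` uniformly in `y`, so it obeys the symbol bound of the generator, and dominated
  -- convergence gives the limit in `H^{r'}`.
  set m : ℝ → ℝ → ℂ := fun y η => slope (fun y => grpSymb θ y η) t y with hm
  have hslope (y η : ℝ) : m y η = ((y - t : ℝ) : ℂ)⁻¹ * (grpSymb θ y η - grpSymb θ t η) := by
    simp only [hm, slope, vsub_eq_sub, Complex.real_smul]
    push_cast
    rfl
  have hsm (y : ℝ) : IsSymb r r' C (m y) := by
    refine ⟨h.nonneg, ?_, fun η => ?_, fun η => ?_⟩
    · have h1 := (isSymb_grp hθ hr y).meas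
      have h2 := (isSymb_grp hθ hr t).meas
      have : m y = fun η => ((y - t : ℝ) : ℂ)⁻¹ * (grpSymb θ y η - grpSymb θ t η) :=
        funext fun η => hslope y η
      rw [this]
      fun_prop
    · rw [hslope, hslope, (isSymb_grp hθ hr y).herm, (isSymb_grp hθ hr t).herm, map_mul, map_sub,
        ← Complex.ofReal_inv, Complex.conj_ofReal]
    · refine le_trans (mul_le_mul_of_nonneg_right ?_ (wt_pos r' η).le) (h.bound η)
      have hb : ‖grpSymb θ y η - grpSymb θ t η‖ ≤ |θ η| * ‖y - t‖ :=
        Convex.norm_image_sub_le_of_norm_hasDerivWithin_le (s := univ)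
          (fun x _ => (hasDerivAt_grpSymb θ x η).hasDerivWithinAt)
          (fun x _ => by simp [norm_grpSymb]) convex_univ (mem_univ t) (mem_univ y)
      rw [hslope, norm_mul, norm_inv, Complex.norm_real]
      rcases eq_or_ne y t with rfl | hne
      · simp
      · rw [inv_mul_le_iff₀ (norm_pos_iff.2 (sub_ne_zero.2 hne))]
        linarith
  have hlimS : IsSymb r r' C fun η => -(θ η : ℂ) * Complex.I * grpSymb θ t η := by
    have hg := isSymb_grp hθ hr t
    refine ⟨h.nonneg, ?_, fun η => ?_, fun η => ?_⟩
    · have h1 := hg.meas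
      have h2 := hθ.meas
      fun_prop
    · simp [hg.herm, hθ.odd]
    · simpa [norm_grpSymb] using h.bound η
  have h2 : Filter.Tendsto (fun y => op r r' (m y) (A t)) (nhdsWithin t (s \ {t}))
      (nhds (op r r' (fun η => -(θ η : ℂ) * Complex.I * grpSymb θ t η) (A t))) := by
    refine op_tendsto (Filter.Eventually.of_forall hsm) hlimS (fun η => ?_) (A t)
    have h3 := (hasDerivAt_grpSymb θ t η).hasDerivWithinAt (s := s)
    exact hasDerivWithinAt_iff_tendsto_slope.1 h3
  have h3 : op r r' (fun η => -(θ η : ℂ) * Complex.I * grpSymb θ t η) (A t)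
      = - skew θ r r' (grp θ r t (A t)) := by
    refine ext_fhat ?_
    filter_upwards [hlimS.fhat_op (A t), fhat_neg (skew θ r r' (grp θ r t (A t))),
      h.fhat_skew (grp θ r t (A t)), fhat_grp hθ hr t (A t)] with η e1 e2 e3 e4
    rw [e1, e2, e3, e4]
    ring
  rw [h3] at h2
  have h4 := h1.add h2
  rw [← sub_eq_add_neg] at h4
  refine h4.congr' (Filter.Eventually.of_forall fun y => ?_)
  simp only [slope, vsub_eq_sub]
  rw [map_smul, map_smul]
  have h5 : op r r' (m y) (A t) = (y - t)⁻¹ • (emb r r' (grp θ r y (A t)) - emb r r' (grp θ r t (A t))) := by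
    refine ext_fhat ?_
    filter_upwards [(hsm y).fhat_op (A t), fhat_smul (y - t)⁻¹
      (emb r r' (grp θ r y (A t)) - emb r r' (grp θ r t (A t))),
      fhat_sub (emb r r' (grp θ r y (A t))) (emb r r' (grp θ r t (A t))),
      fhat_emb h.nonneg hrr (grp θ r y (A t)), fhat_emb h.nonneg hrr (grp θ r t (A t)),
      fhat_grp hθ hr y (A t), fhat_grp hθ hr t (A t)] with η e1 e2 e3 e4 e5 e6 e7
    rw [e1, e2, e3, e4, e5, e6, e7, hslope]
    push_cast
    ring
  rw [h5, ← smul_add, map_sub, map_sub]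
  congr 1
  abel

end

/-! ### Regularity in time, and uniqueness for locally Lipschitz fields. -/

section regularity

variable {r T : ℝ}

lemma contDiffOn_one_of_hasDerivWithinAt {F : Type*} [NormedAddCommGroup F] [NormedSpace ℝ F]
    (hT : 0 < T) {U V : ℝ → F} (hU : ∀ t ∈ Icc 0 T, HasDerivWithinAt U (V t) (Icc 0 T) t)
    (hV : ContinuousOn V (Icc 0 T)) : ContDiffOn ℝ 1 U (Icc 0 T) := by
  rw [show (1 : WithTop ℕ∞) = 0 + 1 by norm_num, contDiffOn_succ_iff_derivWithin (uniqueDiffOn_Icc hT)]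
  refine ⟨fun t ht => (hU t ht).differentiableWithinAt, by simp, ?_⟩
  rw [contDiffOn_zero]
  exact hV.congr fun t ht => (hU t ht).derivWithin (uniqueDiffOn_Icc hT t ht)

lemma contDiffOn_two_of_hasDerivWithinAt {F : Type*} [NormedAddCommGroup F] [NormedSpace ℝ F]
    (hT : 0 < T) {U V W : ℝ → F} (hU : ∀ t ∈ Icc 0 T, HasDerivWithinAt U (V t) (Icc 0 T) t)
    (hV : ∀ t ∈ Icc 0 T, HasDerivWithinAt V (W t) (Icc 0 T) t)
    (hW : ContinuousOn W (Icc 0 T)) : ContDiffOn ℝ 2 U (Icc 0 T) := by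
  rw [show (2 : WithTop ℕ∞) = 1 + 1 by norm_num, contDiffOn_succ_iff_derivWithin (uniqueDiffOn_Icc hT)]
  refine ⟨fun t ht => (hU t ht).differentiableWithinAt, by simp, ?_⟩
  exact (contDiffOn_one_of_hasDerivWithinAt hT hV hW).congr fun t ht =>
    (hU t ht).derivWithin (uniqueDiffOn_Icc hT t ht)

/-- The inclusion of `H^r` in `L²` is bounded, so the derivative in `L²` used by the equations is
the one in `H^r`. Positivity of `T` makes one-sided derivatives unique. -/
lemma timeDeriv_eq (hr : 0 ≤ r) (hT : 0 < T) {u : ℝ → L2} {U : ℝ → SobolevH r} {V : SobolevH r}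
    {t : ℝ} (ht : t ∈ Icc 0 T) (hu : ∀ t ∈ Icc 0 T, toL2 r (U t) = u t)
    (hU : HasDerivWithinAt U V (Icc 0 T) t) : timeDeriv T u t = toL2 r V := by
  have h1 : HasDerivWithinAt (fun t => toL2L r hr (U t)) (toL2L r hr V) (Icc 0 T) t :=
    (toL2L r hr).hasFDerivAt.comp_hasDerivWithinAt t hU
  exact (h1.congr (fun x hx => (hu x hx).symm) (hu t ht).symm).derivWithin
    (uniqueDiffOn_Icc hT t ht)

end regularity

open SobolevH

section

variable {E X : Type*} [NormedAddCommGroup E] [NormedSpace ℝ E]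
  [NormedAddCommGroup X] [NormedSpace ℝ X]

/-- Uniqueness for equations that are Lipschitz continuous on bounded sets. -/
lemma eqOn_of_hasDerivWithinAt {v : ℝ → E → E} {T : ℝ}
    (hv : ∀ ρ : ℝ, ∃ K : NNReal, ∀ t ∈ Icc 0 T, LipschitzOnWith K (v t) (Metric.closedBall 0 ρ))
    {f g : ℝ → E} (hf : ∀ t ∈ Icc 0 T, HasDerivWithinAt f (v t (f t)) (Icc 0 T) t)
    (hg : ∀ t ∈ Icc 0 T, HasDerivWithinAt g (v t (g t)) (Icc 0 T) t) (h0 : f 0 = g 0) :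
    EqOn f g (Icc 0 T) := by
  have hfc : ContinuousOn f (Icc 0 T) := fun t ht => (hf t ht).continuousWithinAt
  have hgc : ContinuousOn g (Icc 0 T) := fun t ht => (hg t ht).continuousWithinAt
  obtain ⟨c₁, h₁⟩ := isCompact_Icc.exists_bound_of_continuousOn hfc
  obtain ⟨c₂, h₂⟩ := isCompact_Icc.exists_bound_of_continuousOn hgc
  -- Both curves are continuous on a compact interval and hence lie in one ball, on which a single
  -- Lipschitz constant serves.
  obtain ⟨K, hK⟩ := hv (max c₁ c₂)
  have hsub : Ico 0 T ⊆ Icc 0 T := Ico_subset_Icc_self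
  have hIci {h : ℝ → E} {h' : E} {t : ℝ} (ht : t ∈ Ico 0 T)
      (hh : HasDerivWithinAt h h' (Icc 0 T) t) : HasDerivWithinAt h h' (Ici t) t :=
    hh.mono_of_mem_nhdsWithin (Icc_mem_nhdsGE_of_mem ht)
  refine ODE_solution_unique_of_mem_Icc_right (v := v) (s := fun _ => Metric.closedBall 0 (max c₁ c₂))
    (fun t ht => hK t (hsub ht)) hfc (fun t ht => hIci ht (hf t (hsub ht))) (fun t ht => ?_) hgc
    (fun t ht => hIci ht (hg t (hsub ht))) (fun t ht => ?_) h0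
  · simpa using Or.inl (h₁ t (hsub ht))
  · simpa using Or.inr (h₂ t (hsub ht))

lemma lipschitzOn_square (B : X →L[ℝ] X →L[ℝ] X) {S : E →L[ℝ] X} {R : X →L[ℝ] E} {κ : ℝ}
    (hκ : 0 ≤ κ) (hS : ‖S‖ ≤ 2) (hR : ‖R‖ ≤ κ) (ρ : ℝ) :
    LipschitzOnWith (Real.toNNReal (κ * (‖B‖ * (4 * |ρ|) * 2)))
      (fun z => R (B (S z) (S z))) (Metric.closedBall 0 ρ) := by
  refine LipschitzOnWith.of_dist_le_mul fun z hz z' hz' => ?_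
  have hb (y : E) (hy : y ∈ Metric.closedBall 0 ρ) : ‖S y‖ ≤ 2 * |ρ| := by
    refine (S.le_of_opNorm_le hS y).trans ?_
    have : ‖y‖ ≤ ρ := by simpa using hy
    linarith [le_abs_self ρ]
  have h1 : ‖S z - S z'‖ ≤ 2 * ‖z - z'‖ := by
    rw [← map_sub]; exact S.le_of_opNorm_le hS _
  rw [Real.coe_toNNReal _ (by positivity), dist_eq_norm, dist_eq_norm, ← map_sub]
  calc _ ≤ κ * ‖B (S z) (S z) - B (S z') (S z')‖ := R.le_of_opNorm_le hR _
    _ ≤ κ * (‖B‖ * (2 * |ρ| + 2 * |ρ|) * (2 * ‖z - z'‖)) := by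
        gcongr
        refine (norm_square_sub_le B _ _).trans ?_
        gcongr
        · exact hb z hz
        · exact hb z' hz'
    _ = _ := by ring

end

lemma isSkew_of_le_xi {r r' : ℝ} (hr' : 0 ≤ r') (h : r' + 1 ≤ r) {θ : ℝ → ℝ} (hθ : IsPhase θ)
    (hb : ∀ η, |θ η| ≤ |2 * Real.pi * η|) : IsSkew r r' 1 θ where
  nonneg := hr'
  phase := hθ
  bound η := by
    rw [one_mul]
    refine le_trans ?_ (wt_mono h η)
    rw [wt_add, mul_comm]
    exact mul_le_mul_of_nonneg_left ((hb η).trans (abs_le_wt_one η)) (wt_pos _ _).le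

lemma isSkew_of_le_const {r C : ℝ} (hr : 0 ≤ r) {θ : ℝ → ℝ} (hθ : IsPhase θ)
    (hb : ∀ η, |θ η| ≤ C) : IsSkew r r C θ :=
  ⟨hr, hθ, fun η => mul_le_mul_of_nonneg_right (hb η) (wt_pos _ _).le⟩

/-! ### Symbols of the Benjamin-Bona-Mahony equation and the Duhamel operator. -/

/-- The dispersion relation of the linear Benjamin-Bona-Mahony equation. -/
noncomputable def kap (δ η : ℝ) : ℝ :=
  2 * Real.pi * η * (1 + 3 / 4 * δ ^ 2 * (2 * Real.pi * η) ^ 2)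
    / (1 + 5 / 4 * δ ^ 2 * (2 * Real.pi * η) ^ 2)

/-- The regularized derivative in the nonlinear term of the Benjamin-Bona-Mahony equation. -/
noncomputable def bbmD (δ η : ℝ) : ℝ :=
  2 * Real.pi * η / (1 + 5 / 4 * δ ^ 2 * (2 * Real.pi * η) ^ 2)

lemma isPhase_kap (δ : ℝ) : IsPhase (kap δ) :=
  ⟨by unfold kap; fun_prop, fun η => by simp [kap, neg_div]⟩

lemma isPhase_bbmD (δ : ℝ) : IsPhase (bbmD δ) :=
  ⟨by unfold bbmD; fun_prop, fun η => by simp [bbmD, neg_div]⟩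

lemma abs_kap_le (δ η : ℝ) : |kap δ η| ≤ |2 * Real.pi * η| := by
  set x := 2 * Real.pi * η with hx
  have h0 : 0 ≤ δ ^ 2 * x ^ 2 := by positivity
  rw [kap, abs_div, abs_mul, abs_of_nonneg (a := 1 + 3 / 4 * δ ^ 2 * x ^ 2) (by positivity),
    abs_of_nonneg (a := 1 + 5 / 4 * δ ^ 2 * x ^ 2) (by positivity), div_le_iff₀ (by positivity)]
  exact mul_le_mul_of_nonneg_left (by nlinarith) (abs_nonneg _)

lemma abs_bbmD_le (δ η : ℝ) : |bbmD δ η| ≤ |2 * Real.pi * η| := by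
  set x := 2 * Real.pi * η with hx
  have h0 : 0 ≤ δ ^ 2 * x ^ 2 := by positivity
  rw [bbmD, abs_div, abs_of_nonneg (a := 1 + 5 / 4 * δ ^ 2 * x ^ 2) (by positivity)]
  exact div_le_self (abs_nonneg _) (by nlinarith)

/-- With `x` for the wave number, this is `|x| δ ≤ 1 + (5/4) δ²x²`, a consequence of `(|x| δ - 1)² ≥
0`. -/
lemma abs_bbmD_le_inv {δ : ℝ} (hδ : 0 < δ) (η : ℝ) : |bbmD δ η| ≤ 1 / δ := by
  set x := 2 * Real.pi * η with hx
  rw [bbmD, abs_div, abs_of_nonneg (a := 1 + 5 / 4 * δ ^ 2 * x ^ 2) (by positivity),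
    div_le_div_iff₀ (by positivity) hδ]
  have h1 : (|x| * δ) ^ 2 = δ ^ 2 * x ^ 2 := by rw [mul_pow, sq_abs]; ring
  nlinarith [sq_nonneg (|x| * δ - 1)]

/-- The phase of the Benjamin-Bona-Mahony equation of waves in the direction `σ`. -/
noncomputable def bbmPhase (σ δ : ℝ) : ℝ → ℝ := fun η => σ * kap δ η

lemma isPhase_bbmPhase (σ δ : ℝ) : IsPhase (bbmPhase σ δ) := (isPhase_kap δ).const_mul σ

lemma isSkew_bbmPhase {σ δ r r' : ℝ} (hσ : |σ| = 1) (hr' : 0 ≤ r') (h : r' + 1 ≤ r) :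
    IsSkew r r' 1 (bbmPhase σ δ) :=
  isSkew_of_le_xi hr' h (isPhase_bbmPhase σ δ) fun η => by
    rw [bbmPhase, abs_mul, hσ, one_mul]; exact abs_kap_le δ η

/-- The factor `1 + (5/4) δ²ξ²` of the time derivative never vanishes, and dividing by it solves the
equation for `V`. -/
lemma bbm_weak_iff_fhat (σ ε δ : ℝ) {q q' : ℝ} (hq : 1 / 2 < q) (U : SobolevH q) (V : SobolevH q') :
    (∀ φ : 𝓢(ℝ, ℝ),
      ∫ x, (toL2 q' V x * φ x
        - σ * (toL2 q U x * deriv φ x)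
        - σ * ε * (toL2 q U x ^ 2 / 2 * deriv φ x)
        + σ * (3 / 4) * δ ^ 2 * (toL2 q U x * iteratedDeriv 3 φ x)
        - (5 / 4) * δ ^ 2 * (toL2 q' V x * iteratedDeriv 2 φ x)) = 0) ↔
      fhat V =ᵐ[volume] fun η => -((bbmPhase σ δ η : ℂ) * Complex.I * fhat U η)
        - (σ * ε / 2 : ℝ) * ((bbmD δ η : ℂ) * Complex.I * fhat (sobMul q U U) η) := by
  rw [bbm_weak_iff σ ε δ (toL2_sobMul hq U U)]
  refine Filter.eventually_congr (Filter.Eventually.of_forall fun η => ?_)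
  have hne : (1 + 5 / 4 * δ ^ 2 * (2 * Real.pi * η) ^ 2 : ℂ) ≠ 0 := by
    have h1 : (1 + 5 / 4 * δ ^ 2 * (2 * Real.pi * η) ^ 2 : ℝ) ≠ 0 := by positivity
    have h2 := Complex.ofReal_ne_zero.2 h1
    push_cast at h2
    exact h2
  rw [← sub_eq_zero (a := fhat V η)]
  refine Iff.trans (Eq.congr_left ?_) (mul_eq_zero_iff_left hne)
  unfold bbmPhase kap bbmD fhat
  push_cast
  generalize (1 + 5 / 4 * δ ^ 2 * (2 * Real.pi * η) ^ 2 : ℂ) = c at hne ⊢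
  field_simp
  ring

/-- Odd symbols of order one which are bounded by `1/δ`. -/
structure IsSmoothing (δ : ℝ) (D : ℝ → ℝ) : Prop where
  pos : 0 < δ
  phase : IsPhase D
  le_xi : ∀ η, |D η| ≤ |2 * Real.pi * η|
  le_inv : ∀ η, |D η| ≤ 1 / δ

lemma isSmoothing_bbmD {δ : ℝ} (hδ : 0 < δ) : IsSmoothing δ (bbmD δ) :=
  ⟨hδ, isPhase_bbmD δ, abs_bbmD_le δ, abs_bbmD_le_inv hδ⟩

section duhamel

variable {θ D : ℝ → ℝ} {r ε δ c : ℝ}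

lemma IsSmoothing.isSkew (h : IsSmoothing δ D) (hr : 0 ≤ r) : IsSkew r r (1 / δ) D :=
  isSkew_of_le_const hr h.phase h.le_inv

lemma IsSmoothing.isSkew_one (h : IsSmoothing δ D) {r' : ℝ} (hr' : 0 ≤ r') (hrr : r' + 1 ≤ r) :
    IsSkew r r' 1 D := isSkew_of_le_xi hr' hrr h.phase h.le_xi

/-- The operator `c e^{iθt} D`, which occurs in Duhamel's formula. -/
noncomputable def duhamel (θ D : ℝ → ℝ) (c r t : ℝ) : SobolevH r →L[ℝ] SobolevH r :=
  c • (grp θ r (-t)).comp (skew D r r)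

lemma duhamel_apply (t : ℝ) (x : SobolevH r) :
    duhamel θ D c r t x = c • grp θ r (-t) (skew D r r x) := rfl

/-- The bound `1/δ` on the symbol is compensated by `|c| ≤ ε ≤ δ`. This is the use of `ε ≤ δ`: no
derivative is lost and the bound is uniform in both parameters. -/
lemma norm_duhamel_le (hθ : IsPhase θ) (hD : IsSmoothing δ D) (hr : 0 ≤ r) (hc : |c| ≤ ε)
    (hεδ : ε ≤ δ) (t : ℝ) : ‖duhamel θ D c r t‖ ≤ 1 := by
  refine ContinuousLinearMap.opNorm_le_bound _ zero_le_one fun x => ?_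
  rw [duhamel_apply, norm_smul, Real.norm_eq_abs]
  have h1 := norm_grp_apply_le hθ hr (-t) (skew D r r x)
  have h2 := (hD.isSkew hr).norm_skew_le x
  calc |c| * ‖grp θ r (-t) (skew D r r x)‖ ≤ δ * (1 / δ * ‖x‖) :=
        mul_le_mul (hc.trans hεδ) (h1.trans h2) (norm_nonneg _) hD.pos.le
    _ = 1 * ‖x‖ := by rw [← mul_assoc, mul_one_div_cancel hD.pos.ne']

lemma emb_duhamel {r' : ℝ} (hθ : IsPhase θ) (hD : IsSmoothing δ D) (hr' : 0 ≤ r') (h : r' ≤ r)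
    (t : ℝ) (x : SobolevH r) :
    emb r r' (duhamel θ D c r t x) = duhamel θ D c r' t (emb r r' x) := by
  rw [duhamel_apply, duhamel_apply, map_smul, emb_grp hθ hr' h]
  congr 2
  refine ext_toL2 ?_
  rw [toL2_emb hr' h]
  exact skew_compat (hD.isSkew (hr'.trans h)) (hD.isSkew hr') (toL2_emb hr' h x).symm

/-- Here the symbol is bounded by `|ξ|` instead: one derivative is lost and the full factor `ε` is
retained. -/
lemma norm_duhamel_emb_le {r' : ℝ} (hθ : IsPhase θ) (hD : IsSmoothing δ D) (hr' : 0 ≤ r')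
    (h : r' + 1 ≤ r) (hc : |c| ≤ ε) (t : ℝ) (x : SobolevH r) :
    ‖duhamel θ D c r' t (emb r r' x)‖ ≤ ε * ‖x‖ := by
  have e : skew D r' r' (emb r r' x) = skew D r r' x :=
    ext_toL2 (skew_compat (hD.isSkew hr') (hD.isSkew_one hr' h) (toL2_emb hr' (by linarith) x))
  rw [duhamel_apply, e, norm_smul, Real.norm_eq_abs]
  have h1 := norm_grp_apply_le hθ hr' (-t) (skew D r r' x)
  have h2 := (hD.isSkew_one hr' h).norm_skew_le x
  rw [one_mul] at h2
  exact mul_le_mul hc (h1.trans h2) (norm_nonneg _) ((abs_nonneg c).trans hc)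

lemma grp_duhamel (hθ : IsPhase θ) (hr : 0 ≤ r) (t : ℝ) (x : SobolevH r) :
    grp θ r t (duhamel θ D c r t x) = c • skew D r r x := by
  rw [duhamel_apply, map_smul, grp_grp_neg hθ hr]

lemma continuous_duhamel (hθ : IsPhase θ) (hr : 0 ≤ r) (x : SobolevH r) :
    Continuous fun t => duhamel θ D c r t x :=
  ((continuous_grp hθ hr (skew D r r x)).comp continuous_neg).const_smul c

end duhamel

/-! ### Existence and uniqueness for the Benjamin-Bona-Mahony equation. -/

section existence

variable {r σ ε δ T M : ℝ}

lemma abs_coeff_le (hσ : |σ| = 1) (hε : 0 < ε) : |-(σ * ε / 2)| ≤ ε := by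
  rw [abs_neg, abs_div, abs_mul, hσ, one_mul, abs_of_pos hε, abs_two]
  linarith

/-- Solutions of the Benjamin-Bona-Mahony equation on `[0,T]`, for small `ε`, which stay close to
those of the linear equation. -/
theorem exists_bbmSolution (hr : 3 / 2 < r) (hσ : |σ| = 1) (hT : 0 < T) (hε : 0 < ε) (hεδ : ε ≤ δ)
    (a : SobolevH (r + 1)) (ha : ‖a‖ ≤ M)
    (hsmall : 2 * T * (ε * (‖sobMul (r + 1)‖ * M ^ 2))
      * Real.exp (2 * (8 * 1 * ‖sobMul r‖ * (M + 1) + 1) * T) ≤ 1) :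
    ∃ W : ℝ → SobolevH r, IsBBMSolution σ r ε δ (toL2 (r + 1) a) T (fun t => toL2 r (W t)) ∧
      ∀ t ∈ Icc 0 T, ‖emb r (r - 1) (W t - grp (bbmPhase σ δ) r t (emb (r + 1) r a))‖
        ≤ ε * (‖sobMul r‖ * (M + 1) ^ 2) * t := by
  have hD := isSmoothing_bbmD (hε.trans_le hεδ)
  have hc := abs_coeff_le hσ hε
  have hr0 : 0 ≤ r := by linarith
  have hr1 : 0 ≤ r - 1 := by linarith
  have hM : 0 ≤ M := (norm_nonneg _).trans ha
  have hθ := isPhase_bbmPhase σ δ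
  have : Fact (0 ≤ r) := ⟨hr0⟩
  set θ := bbmPhase σ δ with hθdef
  set a' := emb (r + 1) r a with ha'
  have ha'M : ‖a'‖ ≤ M := (norm_emb_le hr0 (by linarith) a).trans ha
  -- In `W = e^{-iθt}(a' + Z)` the linear flow is removed from the unknown. The forcing at `Z = 0`
  -- is `O(ε)` in `H^r` because the linear solution and its square lie in `H^{r+1}`.
  obtain ⟨Z, hZc, hZ0, hZb, hZd⟩ := exists_small_quadratic (S := grp θ r)
    (R := duhamel θ (bbmD δ) (-(σ * ε / 2)) r) (sobMul r) (a := a') (T := T) (κ := 1) (M := M)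
    (η := ε * (‖sobMul (r + 1)‖ * M ^ 2)) hT (continuous_grp hθ hr0)
    (fun t => (norm_grp_le hθ hr0 t).trans one_le_two) (continuous_duhamel hθ hr0)
    (norm_duhamel_le hθ hD hr0 hc hεδ) ha'M (fun t => by
      rw [ha', ← emb_grp hθ hr0 (by linarith), ← emb_sobMul (by linarith) (by linarith)]
      refine (norm_duhamel_emb_le hθ hD hr0 le_rfl hc t _).trans ?_
      gcongr
      have h1 : ‖grp θ (r + 1) t a‖ ≤ M := (norm_grp_apply_le hθ (by linarith) t a).trans ha
      refine ((sobMul (r + 1)).le_opNorm₂ _ _).trans ?_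
      rw [mul_assoc, sq]
      gcongr) hsmall
  set W : ℝ → SobolevH r := fun t => grp θ r t (a' + Z t) with hW
  have hWc : Continuous W := continuous_clm_apply (continuous_grp hθ hr0) (norm_grp_le hθ hr0)
    (by fun_prop)
  -- The phase grows linearly in the frequency, so `W` is differentiable only with values in
  -- `H^{r-1}`.
  set V : ℝ → SobolevH (r - 1) := fun t =>
    emb r (r - 1) ((-(σ * ε / 2)) • skew (bbmD δ) r r (sobMul r (W t) (W t)))
      - skew θ r (r - 1) (W t) with hV
  have hsk : IsSkew r (r - 1) 1 θ := isSkew_bbmPhase hσ hr1 (by linarith)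
  have hVd (t : ℝ) (ht : t ∈ Icc 0 T) :
      HasDerivWithinAt (fun t => emb r (r - 1) (W t)) (V t) (Icc 0 T) t := by
    have h1 := hasDerivWithinAt_grp hsk (by linarith) ((hZd t ht).const_add a')
    rw [grp_duhamel hθ hr0] at h1
    exact h1
  have hVc : Continuous V := by
    have hB : Continuous fun t => sobMul r (W t) (W t) :=
      ((sobMul r).continuous.comp hWc).clm_apply hWc
    fun_prop
  refine ⟨W, ⟨⟨W, fun t _ => rfl, ?_⟩, ⟨fun t => emb r (r - 1) (W t), fun t _ => ?_, ?_⟩, ?_, ?_⟩, ?_⟩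
  · simpa using hWc.continuousOn
  · exact toL2_emb hr1 (by linarith) _
  · simpa using contDiffOn_one_of_hasDerivWithinAt hT hVd hVc.continuousOn
  · intro t ht
    rw [timeDeriv_eq hr1 hT ht (fun t _ => toL2_emb hr1 (by linarith) _) (hVd t ht)]
    refine (bbm_weak_iff_fhat σ ε δ (by linarith) (W t) (V t)).2 ?_
    have hsb := hD.isSkew hr0
    filter_upwards [fhat_sub (emb r (r - 1)
        ((-(σ * ε / 2)) • skew (bbmD δ) r r (sobMul r (W t) (W t)))) (skew θ r (r - 1) (W t)),
      fhat_emb hr1 (by linarith) ((-(σ * ε / 2)) • skew (bbmD δ) r r (sobMul r (W t) (W t))),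
      fhat_smul (-(σ * ε / 2)) (skew (bbmD δ) r r (sobMul r (W t) (W t))),
      hsb.fhat_skew (sobMul r (W t) (W t)), hsk.fhat_skew (W t)] with η h1 h2 h3 h4 h5
    rw [hV]
    simp only
    rw [h1, h2, h3, h4, h5]
    push_cast
    ring
  · simp only [hW, hZ0, add_zero]
    rw [grp_zero hθ hr0, ha', toL2_emb hr0 (by linarith)]
  · intro t ht
    have hd (x : ℝ) (hx : x ∈ Icc 0 T) : HasDerivWithinAt (fun t => emb r (r - 1) (Z t))
        (emb r (r - 1) (duhamel θ (bbmD δ) (-(σ * ε / 2)) r x (sobMul r (W x) (W x)))) (Icc 0 T) x :=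
      (emb r (r - 1)).hasFDerivAt.comp_hasDerivWithinAt x (hZd x hx)
    -- Since `Z` is already known to lie in the unit ball of `H^r`, the bound in `H^{r-1}` gains the
    -- factor `ε`, with a constant that does not involve `T`.
    have hbd (x : ℝ) (hx : x ∈ Icc 0 T) :
        ‖emb r (r - 1) (duhamel θ (bbmD δ) (-(σ * ε / 2)) r x (sobMul r (W x) (W x)))‖
          ≤ ε * (‖sobMul r‖ * (M + 1) ^ 2) := by
      rw [emb_duhamel hθ hD hr1 (by linarith)]
      refine (norm_duhamel_emb_le hθ hD hr1 (by linarith) hc x _).trans ?_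
      gcongr
      have h1 : ‖W x‖ ≤ M + 1 := (norm_grp_apply_le hθ hr0 x _).trans
        ((norm_add_le _ _).trans (add_le_add ha'M (hZb x hx)))
      refine ((sobMul r).le_opNorm₂ _ _).trans ?_
      rw [mul_assoc, sq]
      gcongr
    have hmv := norm_image_sub_le_of_norm_deriv_le_segment' hd
      (fun x hx => hbd x (Ico_subset_Icc_self hx)) t ht
    rw [hZ0, map_zero, sub_zero, sub_zero] at hmv
    have e : W t - grp θ r t a' = grp θ r t (Z t) := by
      simp only [hW, map_add, add_sub_cancel_left]
    rw [e, emb_grp hθ hr1 (by linarith)]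
    exact (norm_grp_apply_le hθ hr1 t _).trans hmv

/-- Uniqueness for the Benjamin-Bona-Mahony equation. -/
theorem bbmSolution_unique (hr : 5 / 2 < r) (hσ : |σ| = 1) (hT : 0 < T) (hε : 0 < ε) (hεδ : ε ≤ δ)
    {w₀ : L2} {w w' : ℝ → L2} (hw : IsBBMSolution σ r ε δ w₀ T w)
    (hw' : IsBBMSolution σ r ε δ w₀ T w') : EqOn w' w (Icc 0 T) := by
  have hD := isSmoothing_bbmD (hε.trans_le hεδ)
  have hc := abs_coeff_le hσ hε
  have hr1 : 0 ≤ r - 1 := by linarith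
  have hr2 : 0 ≤ r - 1 - 1 := by linarith
  set θ := bbmPhase σ δ with hθdef
  have hθ : IsPhase θ := isPhase_bbmPhase σ δ
  set q := r - 1 with hq
  set p := q - 1 with hp
  have hpq : p ≤ q := by linarith
  have hsk : IsSkew q p 1 θ := isSkew_bbmPhase hσ hr2 (by linarith)
  have hskn : IsSkew q p 1 (-θ) := ⟨hr2, hθ.neg, fun η => by simpa using hsk.bound η⟩
  obtain ⟨U, hU, hUd⟩ := hw.regular_deriv
  obtain ⟨U', hU', hUd'⟩ := hw'.regular_deriv
  -- The BBM field loses a derivative through `skew θ`. Conjugation by the inverse group cancels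
  -- this term and leaves a locally Lipschitz field, but differentiating the group costs one more
  -- derivative. The comparison thus takes place in `H^{r-2}`, which is an algebra because `r >
  -- 5/2`.
  have key {w : ℝ → L2} (hw : IsBBMSolution σ r ε δ w₀ T w) {U : ℝ → SobolevH q}
      (hU : ∀ t ∈ Icc 0 T, toL2 q (U t) = w t) (hUd : ContDiffOn ℝ (1 : ℕ) U (Icc 0 T)) (t : ℝ)
      (ht : t ∈ Icc 0 T) :
      HasDerivWithinAt (fun t => emb q p (grp (-θ) q t (U t)))
        (duhamel θ (bbmD δ) (-(σ * ε / 2)) p t (sobMul p (grp θ p t (emb q p (grp (-θ) q t (U t))))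
          (grp θ p t (emb q p (grp (-θ) q t (U t)))))) (Icc 0 T) t := by
    have hd : HasDerivWithinAt U (derivWithin U (Icc 0 T) t) (Icc 0 T) t :=
      ((hUd.differentiableOn (by simp)) t ht).hasDerivWithinAt
    set V := derivWithin U (Icc 0 T) t
    have heq := hw.equation t ht
    rw [timeDeriv_eq hr1 hT ht hU hd, ← hU t ht] at heq
    have hV := (bbm_weak_iff_fhat σ ε δ (by linarith) (U t) V).1 heq
    have hVe : emb q p V = (-(σ * ε / 2)) • skew (bbmD δ) p p (emb q p (sobMul q (U t) (U t)))
        - skew θ q p (U t) := by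
      refine ext_fhat ?_
      filter_upwards [fhat_emb hr2 hpq V, hV, hsk.fhat_skew (U t),
        fhat_sub ((-(σ * ε / 2)) • skew (bbmD δ) p p (emb q p (sobMul q (U t) (U t))))
          (skew θ q p (U t)), fhat_smul (-(σ * ε / 2))
          (skew (bbmD δ) p p (emb q p (sobMul q (U t) (U t)))),
        (hD.isSkew hr2).fhat_skew (emb q p (sobMul q (U t) (U t))),
        fhat_emb hr2 hpq (sobMul q (U t) (U t))] with η h1 h2 h3 h4 h5 h6 h7
      rw [h1, h2, h4, h3, h5, h6, h7]
      push_cast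
      ring
    have h1 := hasDerivWithinAt_grp hskn hpq hd
    refine h1.congr_deriv ?_
    have e1 : grp θ p t (emb q p (grp (-θ) q t (U t))) = emb q p (U t) := by
      rw [← grp_neg, ← emb_grp hθ hr2 hpq, grp_grp_neg hθ hr1]
    have e2 : skew (-θ) q p (grp (-θ) q t (U t)) = - grp (-θ) p t (skew θ q p (U t)) := by
      rw [skew_grp hskn hr1 hθ.neg, ← map_neg]
      congr 1
      refine ext_fhat ?_
      filter_upwards [hskn.fhat_skew (U t), hsk.fhat_skew (U t), fhat_neg (skew θ q p (U t))]
        with η h1 h2 h3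
      rw [h1, h3, h2]
      simp
    rw [e1, e2, emb_grp hθ.neg hr2 hpq, hVe, ← emb_sobMul (by linarith) hpq, duhamel_apply, grp_neg, map_sub, map_smul]
    abel
  have h0 : U 0 = U' 0 := ext_toL2 (by
    rw [hU 0 ⟨le_rfl, hT.le⟩, hU' 0 ⟨le_rfl, hT.le⟩, hw.initial, hw'.initial])
  have huniq := eqOn_of_hasDerivWithinAt (T := T)
    (v := fun t z => duhamel θ (bbmD δ) (-(σ * ε / 2)) p t (sobMul p (grp θ p t z) (grp θ p t z)))
    (fun ρ => ⟨_, fun t _ => lipschitzOn_square (sobMul p) (S := grp θ p t)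
      (R := duhamel θ (bbmD δ) (-(σ * ε / 2)) p t) zero_le_one
      ((norm_grp_le hθ hr2 t).trans one_le_two) (norm_duhamel_le hθ hD hr2 hc hεδ t) ρ⟩)
    (key hw' hU' hUd') (key hw hU hUd) (by simp only [h0])
  intro t ht
  have h1 := congrArg (grp θ p t) (huniq ht)
  simp only [← grp_neg] at h1
  rw [← emb_grp hθ hr2 hpq, ← emb_grp hθ hr2 hpq, grp_grp_neg hθ hr1, grp_grp_neg hθ hr1] at h1
  rw [← hU t ht, ← hU' t ht, ← toL2_emb hr2 hpq (U t), ← h1, toL2_emb hr2 hpq]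

end existence

open SobolevH

/-! ### Existence and uniqueness for the improved Boussinesq equation. -/

/-- The dispersion relation of the linear improved Boussinesq equation. -/
noncomputable def om (δ η : ℝ) : ℝ :=
  2 * Real.pi * η / Real.sqrt (1 + δ ^ 2 * (2 * Real.pi * η) ^ 2)

lemma one_le_sqrt (δ x : ℝ) : 1 ≤ Real.sqrt (1 + δ ^ 2 * x ^ 2) := by
  rw [Real.one_le_sqrt]; nlinarith [mul_nonneg (sq_nonneg δ) (sq_nonneg x)]

lemma isSmoothing_om {δ : ℝ} (hδ : 0 < δ) : IsSmoothing δ (om δ) where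
  pos := hδ
  phase := ⟨by unfold om; fun_prop, fun η => by simp [om, neg_div]⟩
  le_xi η := by
    have h := one_le_sqrt δ (2 * Real.pi * η)
    rw [om, abs_div, abs_of_nonneg (Real.sqrt_nonneg _)]
    exact div_le_self (abs_nonneg _) h
  le_inv η := by
    have h := one_le_sqrt δ (2 * Real.pi * η)
    rw [om, abs_div, abs_of_nonneg (Real.sqrt_nonneg _),
      div_le_div_iff₀ (by linarith) hδ, one_mul]
    refine Real.le_sqrt_of_sq_le ?_
    rw [mul_pow, sq_abs]
    linarith

lemma om_sq_mul (δ η : ℝ) :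
    (1 + δ ^ 2 * (2 * Real.pi * η) ^ 2) * om δ η ^ 2 = (2 * Real.pi * η) ^ 2 := by
  have h : 0 < 1 + δ ^ 2 * (2 * Real.pi * η) ^ 2 := by positivity
  rw [om, div_pow, Real.sq_sqrt h.le, mul_div_cancel₀ _ h.ne']

lemma ib_weak_iff_fhat (ε δ : ℝ) {q q' : ℝ} (hq : 1 / 2 < q) (U : SobolevH q) (V : SobolevH q') :
    (∀ φ : 𝓢(ℝ, ℝ),
      ∫ x, (toL2 q' V x * φ x - toL2 q U x * iteratedDeriv 2 φ x
        - δ ^ 2 * (toL2 q' V x * iteratedDeriv 2 φ x)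
        - ε * (toL2 q U x ^ 2 * iteratedDeriv 2 φ x)) = 0) ↔
      fhat V =ᵐ[volume] fun η =>
        -((om δ η : ℂ) ^ 2 * (fhat U η + ε * fhat (sobMul q U U) η)) := by
  rw [ib_weak_iff ε δ (toL2_sobMul hq U U)]
  refine Filter.eventually_congr (Filter.Eventually.of_forall fun η => ?_)
  have hne : (1 + δ ^ 2 * (2 * Real.pi * η) ^ 2 : ℂ) ≠ 0 := by
    have h1 : (1 + δ ^ 2 * (2 * Real.pi * η) ^ 2 : ℝ) ≠ 0 := by positivity
    have h2 := Complex.ofReal_ne_zero.2 h1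
    push_cast at h2
    exact h2
  rw [← sub_eq_zero (a := fhat V η)]
  refine Iff.trans (Eq.congr_left ?_) (mul_eq_zero_iff_left hne)
  have h2 := congrArg (fun x : ℝ => (x : ℂ)) (om_sq_mul δ η)
  push_cast at h2
  unfold fhat
  linear_combination (-(hat (toL2 q U) η + ε * hat (toL2 q (sobMul q U U)) η)) * h2

section IB

variable {r s ε δ T M : ℝ}

lemma neg_om_skew {θ : ℝ → ℝ} {r r' C : ℝ} (h : IsSkew r r' C θ) (x : SobolevH r) :
    skew (-θ) r r' x = - skew θ r r' x := by
  have hn : IsSkew r r' C (-θ) := ⟨h.nonneg, h.phase.neg, fun η => by simpa using h.bound η⟩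
  refine ext_fhat ?_
  filter_upwards [hn.fhat_skew x, h.fhat_skew x, fhat_neg (skew θ r r' x)] with η h1 h2 h3
  rw [h1, h3, h2]
  simp

/-- The second time derivative in the improved Boussinesq equation. -/
lemma fhat_ib_rhs (hr : 0 ≤ r) (hδ : 0 < δ) (x y : SobolevH r) :
    fhat (skew (om δ) r r (skew (om δ) r r (x + ε • y))) =ᵐ[volume] fun η =>
      -((om δ η : ℂ) ^ 2 * (fhat x η + ε * fhat y η)) := by
  have hsk := (isSmoothing_om hδ).isSkew hr
  filter_upwards [hsk.fhat_skew (skew (om δ) r r (x + ε • y)), hsk.fhat_skew (x + ε • y),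
    fhat_add x (ε • y), fhat_smul ε y] with η h1 h2 h3 h4
  rw [h1, h2, h3, h4]
  linear_combination ((om δ η : ℂ) ^ 2 * (fhat x η + ε * fhat y η)) * Complex.I_sq

/-- The linear flow of the improved Boussinesq equation in characteristic variables. -/
noncomputable def ibFlow (θ : ℝ → ℝ) (r t : ℝ) : SobolevH r × SobolevH r →L[ℝ] SobolevH r :=
  (grp θ r t).coprod (grp θ r (-t))

lemma ibFlow_apply (θ : ℝ → ℝ) (r t : ℝ) (z : SobolevH r × SobolevH r) :
    ibFlow θ r t z = grp θ r t z.1 + grp θ r (-t) z.2 := rfl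

lemma norm_ibFlow_le {θ : ℝ → ℝ} (hθ : IsPhase θ) (hr : 0 ≤ r) (t : ℝ) : ‖ibFlow θ r t‖ ≤ 2 := by
  refine ContinuousLinearMap.opNorm_le_bound _ (by norm_num) fun z => ?_
  rw [ibFlow_apply]
  have h1 := norm_grp_apply_le hθ hr t z.1
  have h2 := norm_grp_apply_le hθ hr (-t) z.2
  have h3 := norm_fst_le z
  have h4 := norm_snd_le z
  exact (norm_add_le _ _).trans (by linarith)

/-- The nonlinear part of the improved Boussinesq equation in characteristic variables. -/
noncomputable def ibDuhamel (ε δ r t : ℝ) : SobolevH r →L[ℝ] SobolevH r × SobolevH r :=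
  (duhamel (om δ) (om δ) (-(ε / 2)) r t).prod (duhamel (-om δ) (om δ) (ε / 2) r t)

/-- Solutions of the improved Boussinesq equation on `[0,T]`, for small `ε`, which stay close to
those of the linear equation. -/
theorem exists_ibSolution (hr : 3 / 2 < r) (hs : 1 / 2 < s) (hsr : s ≤ r) (hT : 0 < T) (hε : 0 < ε)
    (hεδ : ε ≤ δ) (a b : SobolevH (r + 1)) (ha : ‖a‖ ≤ M) (hb : ‖b‖ ≤ M) {v₀ : L2}
    (hv₀ : IsWeakDeriv v₀ (toL2 (r + 1) (skew (om δ) (r + 1) (r + 1) (b - a))))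
    (hsmall : 2 * T * (ε * (‖sobMul (r + 1)‖ * (2 * M) ^ 2))
      * Real.exp (2 * (8 * 1 * ‖sobMul r‖ * (M + 1) + 1) * T) ≤ 1) :
    ∃ U : ℝ → SobolevH r,
      IsIBSolution s ε δ (toL2 (r + 1) (a + b)) v₀ T (fun t => toL2 r (U t)) ∧
      ∀ t ∈ Icc 0 T, ‖emb r (r - 1) (U t - grp (om δ) r t (emb (r + 1) r a)
        - grp (om δ) r (-t) (emb (r + 1) r b))‖
        ≤ ε * (2 * (‖sobMul r‖ * (2 * (M + 1)) ^ 2)) * t := by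
  have hδ := hε.trans_le hεδ
  have hr0 : 0 ≤ r := by linarith
  have hs0 : 0 ≤ s := by linarith
  have hr1 : 0 ≤ r - 1 := by linarith
  have hM : 0 ≤ M := (norm_nonneg _).trans ha
  have : Fact (0 ≤ r) := ⟨hr0⟩
  have hD := isSmoothing_om hδ
  set θ := om δ with hθdef
  have hθ : IsPhase θ := hD.phase
  have hc1 : |-(ε / 2)| ≤ ε := by rw [abs_neg, abs_of_pos (by positivity)]; linarith
  have hc2 : |ε / 2| ≤ ε := by rw [abs_of_pos (by positivity)]; linarith
  set a' := emb (r + 1) r a with ha'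
  set b' := emb (r + 1) r b with hb'
  have ha'M : ‖a'‖ ≤ M := (norm_emb_le hr0 (by linarith) a).trans ha
  have hb'M : ‖b'‖ ≤ M := (norm_emb_le hr0 (by linarith) b).trans hb
  obtain ⟨Z, hZc, hZ0, hZb, hZd⟩ := exists_small_quadratic (S := ibFlow θ r)
    (R := ibDuhamel ε δ r) (sobMul r) (a := (a', b')) (T := T) (κ := 1) (M := M)
    (η := ε * (‖sobMul (r + 1)‖ * (2 * M) ^ 2)) hT
    (fun z => (continuous_grp hθ hr0 z.1).add ((continuous_grp hθ hr0 z.2).comp continuous_neg))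
    (norm_ibFlow_le hθ hr0)
    (fun x => (continuous_duhamel hθ hr0 x).prodMk (continuous_duhamel hθ.neg hr0 x))
    (fun t => ContinuousLinearMap.opNorm_le_bound _ zero_le_one fun x =>
      norm_prod_le_iff.2 ⟨ContinuousLinearMap.le_of_opNorm_le _
        (norm_duhamel_le hθ hD hr0 hc1 hεδ t) x, ContinuousLinearMap.le_of_opNorm_le _
        (norm_duhamel_le hθ.neg hD hr0 hc2 hεδ t) x⟩)
    (norm_prod_le_iff.2 ⟨ha'M, hb'M⟩) (fun t => by
      have e : ibFlow θ r t (a', b') = emb (r + 1) r (ibFlow θ (r + 1) t (a, b)) := by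
        rw [ibFlow_apply, ibFlow_apply, map_add, emb_grp hθ hr0 (by linarith),
          emb_grp hθ hr0 (by linarith)]
      have h1 : ‖ibFlow θ (r + 1) t (a, b)‖ ≤ 2 * M :=
        (ContinuousLinearMap.le_of_opNorm_le _ (norm_ibFlow_le hθ (by linarith) t) _).trans
          (mul_le_mul_of_nonneg_left (norm_prod_le_iff.2 ⟨ha, hb⟩) zero_le_two)
      have h2 : ε * ‖sobMul (r + 1) (ibFlow θ (r + 1) t (a, b)) (ibFlow θ (r + 1) t (a, b))‖
          ≤ ε * (‖sobMul (r + 1)‖ * (2 * M) ^ 2) := by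
        gcongr
        refine ((sobMul (r + 1)).le_opNorm₂ _ _).trans ?_
        rw [mul_assoc, sq]
        gcongr
      rw [e, ← emb_sobMul (by linarith) (by linarith)]
      exact norm_prod_le_iff.2 ⟨(norm_duhamel_emb_le hθ hD hr0 le_rfl hc1 t _).trans h2,
        (norm_duhamel_emb_le hθ.neg hD hr0 le_rfl hc2 t _).trans h2⟩) hsmall
  have hsk := hD.isSkew hr0
  have hskn : IsSkew r r (1 / δ) (-θ) := ⟨hr0, hθ.neg, fun η => by simpa using hsk.bound η⟩
  -- In these characteristic variables the equation reads `P' = -iω(P + (ε/2) U²)`, `Q' = iω(Q +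
  -- (ε/2) U²)`, where `U = P + Q`.
  set P : ℝ → SobolevH r := fun t => grp θ r t (a' + (Z t).1) with hP
  set Q : ℝ → SobolevH r := fun t => grp (-θ) r t (b' + (Z t).2) with hQ
  set U : ℝ → SobolevH r := fun t => P t + Q t with hU
  have hUZ (t : ℝ) : ibFlow θ r t ((a', b') + Z t) = U t := by
    rw [ibFlow_apply, grp_neg]; rfl
  set B : ℝ → SobolevH r := fun t => sobMul r (U t) (U t) with hB
  have hZ1 (t : ℝ) (ht : t ∈ Icc 0 T) : HasDerivWithinAt (fun t => (Z t).1)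
      (duhamel θ θ (-(ε / 2)) r t (B t)) (Icc 0 T) t := by
    have := (hZd t ht).fst
    rw [hUZ] at this
    exact this
  have hZ2 (t : ℝ) (ht : t ∈ Icc 0 T) : HasDerivWithinAt (fun t => (Z t).2)
      (duhamel (-θ) θ (ε / 2) r t (B t)) (Icc 0 T) t := by
    have := (hZd t ht).snd
    rw [hUZ] at this
    exact this
  have hPd (t : ℝ) (ht : t ∈ Icc 0 T) : HasDerivWithinAt P
      ((-(ε / 2)) • skew θ r r (B t) - skew θ r r (P t)) (Icc 0 T) t := by
    have h1 := hasDerivWithinAt_grp hsk le_rfl ((hZ1 t ht).const_add a')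
    rw [grp_duhamel hθ hr0] at h1
    simp only [emb_self hr0] at h1
    exact h1
  have hQd (t : ℝ) (ht : t ∈ Icc 0 T) : HasDerivWithinAt Q
      ((ε / 2) • skew θ r r (B t) + skew θ r r (Q t)) (Icc 0 T) t := by
    have h1 := hasDerivWithinAt_grp hskn le_rfl ((hZ2 t ht).const_add b')
    rw [grp_duhamel hθ.neg hr0, neg_om_skew hsk, sub_neg_eq_add] at h1
    simp only [emb_self hr0] at h1
    exact h1
  -- The nonlinear terms cancel in `P' + Q'`, so `U' = iω(Q - P)`. In `Q' - P'` they add up, and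
  -- `U'' = (iω)²(U + ε U²)`, which is the Boussinesq equation solved for `U''`.
  set V : ℝ → SobolevH r := fun t => skew θ r r (Q t - P t) with hV
  set W : ℝ → SobolevH r := fun t => skew θ r r (skew θ r r (U t + ε • B t)) with hW
  have hUd (t : ℝ) (ht : t ∈ Icc 0 T) : HasDerivWithinAt U (V t) (Icc 0 T) t := by
    refine ((hPd t ht).add (hQd t ht)).congr_deriv ?_
    simp only [hV, map_sub, neg_smul]
    abel
  have hVd (t : ℝ) (ht : t ∈ Icc 0 T) : HasDerivWithinAt V (W t) (Icc 0 T) t := by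
    have h1 := (skew θ r r).hasFDerivAt.comp_hasDerivWithinAt t ((hQd t ht).sub (hPd t ht))
    refine h1.congr_deriv ?_
    simp only [hW]
    congr 1
    simp only [map_add, map_smul, hU]
    module
  have hPc : Continuous P := continuous_clm_apply (continuous_grp hθ hr0) (norm_grp_le hθ hr0)
    (by fun_prop)
  have hQc : Continuous Q := continuous_clm_apply (continuous_grp hθ.neg hr0)
    (norm_grp_le hθ.neg hr0) (by fun_prop)
  have hUc : Continuous U := hPc.add hQc
  have hBc : Continuous B := ((sobMul r).continuous.comp hUc).clm_apply hUc
  have hWc : Continuous W := by fun_prop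
  have hV0 : timeDeriv T (fun t => toL2 r (U t)) 0 = toL2 r (V 0) :=
    timeDeriv_eq hr0 hT ⟨le_rfl, hT.le⟩ (fun t _ => rfl) (hUd 0 ⟨le_rfl, hT.le⟩)
  have hPQ0 : P 0 = a' ∧ Q 0 = b' := by
    simp only [hP, hQ, hZ0, Prod.fst_zero, Prod.snd_zero, add_zero]
    exact ⟨grp_zero hθ hr0 a', grp_zero hθ.neg hr0 b'⟩
  refine ⟨U, ⟨⟨fun t => emb r s (U t), fun t _ => toL2_emb hs0 hsr _, ?_⟩, ?_, ?_, ?_⟩, ?_⟩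
  · have h2 := contDiffOn_two_of_hasDerivWithinAt hT hUd hVd hWc.continuousOn
    exact (emb r s).contDiff.comp_contDiffOn (by simpa using h2)
  · intro t ht
    have hV' (t : ℝ) (ht : t ∈ Icc 0 T) :
        toL2 r (V t) = timeDeriv T (fun t => toL2 r (U t)) t :=
      (timeDeriv_eq hr0 hT ht (fun t _ => rfl) (hUd t ht)).symm
    rw [timeDeriv_eq hr0 hT ht hV' (hVd t ht)]
    refine (ib_weak_iff_fhat ε δ (by linarith) (U t) (W t)).2 ?_
    exact fhat_ib_rhs hr0 hδ (U t) (B t)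
  · simp only [hU, hPQ0]
    rw [ha', hb', ← map_add, toL2_emb hr0 (by linarith)]
  · rw [hV0]
    convert hv₀ using 1
    simp only [hV, hPQ0]
    rw [ha', hb', ← map_sub]
    exact skew_compat hsk (hD.isSkew (by linarith)) (toL2_emb hr0 (by linarith) _)
  · intro t ht
    have hBb (x : ℝ) (hx : x ∈ Icc 0 T) : ‖B x‖ ≤ ‖sobMul r‖ * (2 * (M + 1)) ^ 2 := by
      have h1 : ‖U x‖ ≤ 2 * (M + 1) := by
        have h2 := norm_grp_apply_le hθ hr0 x (a' + (Z x).1)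
        have h3 := norm_grp_apply_le hθ.neg hr0 x (b' + (Z x).2)
        have h4 := norm_add_le a' (Z x).1
        have h5 := norm_add_le b' (Z x).2
        have h6 := (norm_fst_le (Z x)).trans (hZb x hx)
        have h7 := (norm_snd_le (Z x)).trans (hZb x hx)
        have h8 : ‖U x‖ ≤ ‖P x‖ + ‖Q x‖ := norm_add_le _ _
        simp only [hP, hQ] at h8
        linarith
      refine ((sobMul r).le_opNorm₂ _ _).trans ?_
      rw [mul_assoc, sq]
      gcongr
    have hgen {ϑ : ℝ → ℝ} {c : ℝ} {z : ℝ → SobolevH r} (hϑ : IsPhase ϑ) (hc : |c| ≤ ε)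
        (hz0 : z 0 = 0) (hz : ∀ x ∈ Icc 0 T,
          HasDerivWithinAt z (duhamel ϑ θ c r x (B x)) (Icc 0 T) x) :
        ‖emb r (r - 1) (z t)‖ ≤ ε * (‖sobMul r‖ * (2 * (M + 1)) ^ 2) * t := by
      have hd (x : ℝ) (hx : x ∈ Icc 0 T) : HasDerivWithinAt (fun t => emb r (r - 1) (z t))
          (emb r (r - 1) (duhamel ϑ θ c r x (B x))) (Icc 0 T) x :=
        (emb r (r - 1)).hasFDerivAt.comp_hasDerivWithinAt x (hz x hx)
      have hmv := norm_image_sub_le_of_norm_deriv_le_segment' hd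
        (C := ε * (‖sobMul r‖ * (2 * (M + 1)) ^ 2)) (fun x hx => by
          rw [emb_duhamel hϑ hD hr1 (by linarith)]
          refine (norm_duhamel_emb_le hϑ hD hr1 (by linarith) hc x _).trans ?_
          gcongr
          exact hBb x (Ico_subset_Icc_self hx)) t ht
      rwa [hz0, map_zero, sub_zero, sub_zero] at hmv
    have k1 := hgen hθ hc1 (by rw [hZ0]; rfl) hZ1
    have k2 := hgen hθ.neg hc2 (by rw [hZ0]; rfl) hZ2
    have e : U t - grp θ r t a' - grp θ r (-t) b' = grp θ r t (Z t).1 + grp (-θ) r t (Z t).2 := by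
      simp only [hU, hP, hQ, map_add, grp_neg]
      abel
    rw [e, map_add, emb_grp hθ hr1 (by linarith), emb_grp hθ.neg hr1 (by linarith)]
    refine (norm_add_le _ _).trans ?_
    have k3 := (norm_grp_apply_le hθ hr1 t _).trans k1
    have k4 := (norm_grp_apply_le hθ.neg hr1 t _).trans k2
    linarith

/-- The first-order form of the improved Boussinesq equation. -/
noncomputable def ibField (ε δ s : ℝ) (z : SobolevH s × SobolevH s) : SobolevH s × SobolevH s :=
  (z.2, skew (om δ) s s (skew (om δ) s s (z.1 + ε • sobMul s z.1 z.1)))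

/-- Unlike `kap δ`, the symbol `om δ` is bounded for `δ > 0`, so the field is a bounded linear map
plus a bounded quadratic one, without loss of derivatives, and no conjugation is needed. -/
lemma lipschitzOn_ibField (ε δ s ρ : ℝ) :
    ∃ K : NNReal, LipschitzOnWith K (ibField ε δ s) (Metric.closedBall 0 ρ) := by
  let L := (skew (om δ) s s).comp (skew (om δ) s s)
  have h1 := lipschitzOn_square (E := SobolevH s × SobolevH s) (sobMul s)
    (S := ContinuousLinearMap.fst ℝ _ _) (R := (ContinuousLinearMap.inr ℝ _ _).comp (ε • L))
    (norm_nonneg _) ((ContinuousLinearMap.norm_fst_le ℝ _ _).trans one_le_two) le_rfl ρ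
  have h2 := ((ContinuousLinearMap.snd ℝ (SobolevH s) (SobolevH s)).prod
    (L.comp (ContinuousLinearMap.fst ℝ _ _))).lipschitz.lipschitzOnWith
    (s := Metric.closedBall 0 ρ)
  have e : ibField ε δ s = fun z =>
      (ContinuousLinearMap.snd ℝ (SobolevH s) (SobolevH s)).prod
        (L.comp (ContinuousLinearMap.fst ℝ _ _)) z
      + (ContinuousLinearMap.inr ℝ (SobolevH s) (SobolevH s)).comp (ε • L)
        (sobMul s (ContinuousLinearMap.fst ℝ _ _ z) (ContinuousLinearMap.fst ℝ _ _ z)) :=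
    funext fun z => Prod.ext (by simp [ibField]) (by simp [ibField, L])
  rw [e]
  exact ⟨_, h2.add h1⟩

lemma IsCkSobolev.exists_hasDerivWithinAt (hT : 0 < T) {u : ℝ → L2} (h : IsCkSobolev 2 s T u) :
    ∃ U V W : ℝ → SobolevH s, (∀ t ∈ Icc 0 T, toL2 s (U t) = u t) ∧
      (∀ t ∈ Icc 0 T, HasDerivWithinAt U (V t) (Icc 0 T) t) ∧
      ∀ t ∈ Icc 0 T, HasDerivWithinAt V (W t) (Icc 0 T) t := by
  obtain ⟨U, hU, hUc⟩ := h
  have hUc' : ContDiffOn ℝ (1 + 1) U (Icc 0 T) := hUc.of_le (by norm_num)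
  rw [contDiffOn_succ_iff_derivWithin (uniqueDiffOn_Icc hT)] at hUc'
  obtain ⟨hd1, -, hd2⟩ := hUc'
  exact ⟨U, _, _, hU, fun t ht => (hd1 t ht).hasDerivWithinAt, fun t ht =>
    ((hd2.differentiableOn (by simp)) t ht).hasDerivWithinAt⟩

lemma IsCkSobolev.mono {k : ℕ} {T' : ℝ} {u : ℝ → L2} (h : IsCkSobolev k s T u) (hT' : T' ≤ T) :
    IsCkSobolev k s T' u := by
  obtain ⟨U, hU, hUc⟩ := h
  have hsub : Icc 0 T' ⊆ Icc 0 T := Icc_subset_Icc_right hT'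
  exact ⟨U, fun t ht => hU t (hsub ht), hUc.mono hsub⟩

/-- The function `timeDeriv T u` depends on the interval, since the derivative is one-sided at its
end points. Differentiability on the larger interval makes the two versions agree. -/
lemma IsIBSolution.mono (hs : 0 ≤ s) {T' : ℝ} (hT' : 0 < T') (hTT' : T' ≤ T) {u₀ v₀ : L2}
    {u : ℝ → L2} (hu : IsIBSolution s ε δ u₀ v₀ T u) : IsIBSolution s ε δ u₀ v₀ T' u := by
  have hT := hT'.trans_le hTT'
  have hsub : Icc 0 T' ⊆ Icc 0 T := Icc_subset_Icc_right hTT'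
  obtain ⟨U, V, W, hU, hUd, hVd⟩ := hu.regular.exists_hasDerivWithinAt hT
  have e1 {t : ℝ} (ht : t ∈ Icc 0 T) : timeDeriv T u t = toL2 s (V t) :=
    timeDeriv_eq hs hT ht hU (hUd t ht)
  have e2 {t : ℝ} (ht : t ∈ Icc 0 T') : timeDeriv T' u t = toL2 s (V t) :=
    timeDeriv_eq hs hT' ht (fun x hx => hU x (hsub hx)) ((hUd t (hsub ht)).mono hsub)
  refine ⟨hu.regular.mono hTT', fun t ht => ?_, hu.initial, ?_⟩
  · have h1 := hu.equation t (hsub ht)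
    rw [timeDeriv_eq hs hT (hsub ht) (fun x hx => (e1 hx).symm) (hVd t (hsub ht))] at h1
    rwa [timeDeriv_eq hs hT' ht (fun x hx => (e2 hx).symm) ((hVd t (hsub ht)).mono hsub)]
  · rw [e2 ⟨le_rfl, hT'.le⟩, ← e1 ⟨le_rfl, hT.le⟩]
    exact hu.initial_deriv

lemma IsBBMSolution.mono (hr : 1 ≤ r) {σ : ℝ} {T' : ℝ} (hT' : 0 < T') (hTT' : T' ≤ T) {w₀ : L2}
    {w : ℝ → L2} (hw : IsBBMSolution σ r ε δ w₀ T w) : IsBBMSolution σ r ε δ w₀ T' w := by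
  have hT := hT'.trans_le hTT'
  have hsub : Icc 0 T' ⊆ Icc 0 T := Icc_subset_Icc_right hTT'
  have hr1 : 0 ≤ r - 1 := by linarith
  refine ⟨hw.regular.mono hTT', hw.regular_deriv.mono hTT', fun t ht => ?_, hw.initial⟩
  obtain ⟨U, hU, hUc⟩ := hw.regular_deriv
  have hd : HasDerivWithinAt U (derivWithin U (Icc 0 T) t) (Icc 0 T) t :=
    ((hUc.differentiableOn (by simp)) t (hsub ht)).hasDerivWithinAt
  have h1 := hw.equation t (hsub ht)
  rw [timeDeriv_eq hr1 hT (hsub ht) hU hd] at h1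
  rwa [timeDeriv_eq hr1 hT' ht (fun x hx => hU x (hsub hx)) (hd.mono hsub)]

lemma IsIBSolution.exists_firstOrder (hs : 1 / 2 < s) (hT : 0 < T) (hδ : 0 < δ) {u₀ v₀ : L2}
    {u : ℝ → L2} (hu : IsIBSolution s ε δ u₀ v₀ T u) : ∃ f : ℝ → SobolevH s × SobolevH s,
      (∀ t ∈ Icc 0 T, toL2 s (f t).1 = u t) ∧ IsWeakDeriv v₀ (toL2 s (f 0).2) ∧
      ∀ t ∈ Icc 0 T, HasDerivWithinAt f (ibField ε δ s (f t)) (Icc 0 T) t := by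
  have hs0 : 0 ≤ s := by linarith
  have h0T : (0 : ℝ) ∈ Icc 0 T := ⟨le_rfl, hT.le⟩
  obtain ⟨U, V, W, hU, hUd, hVd⟩ := hu.regular.exists_hasDerivWithinAt hT
  have hV (t : ℝ) (ht : t ∈ Icc 0 T) : toL2 s (V t) = timeDeriv T u t :=
    (timeDeriv_eq hs0 hT ht hU (hUd t ht)).symm
  refine ⟨fun t => (U t, V t), hU, ?_, fun t ht => ?_⟩
  · rw [hV 0 h0T]; exact hu.initial_deriv
  · refine ((hUd t ht).prodMk (hVd t ht)).congr_deriv ?_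
    have heq := hu.equation t ht
    rw [timeDeriv_eq hs0 hT ht hV (hVd t ht), ← hU t ht] at heq
    have h1 := (ib_weak_iff_fhat ε δ hs (U t) _).1 heq
    have h2 : W t = skew (om δ) s s (skew (om δ) s s (U t + ε • sobMul s (U t) (U t))) :=
      ext_fhat (h1.trans (fhat_ib_rhs hs0 hδ _ _).symm)
    rw [h2, ibField]

/-- Uniqueness for the improved Boussinesq equation. -/
theorem ibSolution_unique (hs : 1 / 2 < s) (hT : 0 < T) (hδ : 0 < δ) {u₀ v₀ : L2} {u u' : ℝ → L2}
    (hu : IsIBSolution s ε δ u₀ v₀ T u) (hu' : IsIBSolution s ε δ u₀ v₀ T u') :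
    EqOn u' u (Icc 0 T) := by
  have h0T : (0 : ℝ) ∈ Icc 0 T := ⟨le_rfl, hT.le⟩
  obtain ⟨f, hf, hf0, hfd⟩ := hu.exists_firstOrder hs hT hδ
  obtain ⟨g, hg, hg0, hgd⟩ := hu'.exists_firstOrder hs hT hδ
  -- The initial velocities coincide because a weak derivative is determined by its function.
  have h0 : g 0 = f 0 := by
    refine Prod.ext (ext_toL2 ?_) (ext_toL2 (hat_ext ?_))
    · rw [hf 0 h0T, hg 0 h0T, hu.initial, hu'.initial]
    · filter_upwards [(isWeakDeriv_iff _ _).1 hf0, (isWeakDeriv_iff _ _).1 hg0] with η h1 h2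
      rw [h1, h2]
  have huniq := eqOn_of_hasDerivWithinAt (T := T) (v := fun _ => ibField ε δ s)
    (fun ρ => (lipschitzOn_ibField ε δ s ρ).imp fun K hK t _ => hK) hgd hfd h0
  intro t ht
  rw [← hf t ht, ← hg t ht, huniq ht]

end IB

open SobolevH

/-! ### Comparison of the linear flows and of the initial data. -/

/-- The dispersion relations agree up to terms of order `δ⁴`. -/
lemma abs_om_sub_kap_le (δ η : ℝ) : |om δ η - kap δ η| ≤ δ ^ 4 * |2 * Real.pi * η| ^ 5 := by
  set x := 2 * Real.pi * η with hx
  set y := δ ^ 2 * x ^ 2 with hy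
  have hy0 : 0 ≤ y := by positivity
  set ρ := Real.sqrt (1 + y) with hρ
  have hρ1 : 1 ≤ ρ := one_le_sqrt δ x
  have hρ2 : ρ ^ 2 = 1 + y := Real.sq_sqrt (by positivity)
  have hom : om δ η = x / ρ := rfl
  have hkap : kap δ η = x * (1 + 3 / 4 * y) / (1 + 5 / 4 * y) := by
    rw [kap, ← hx, hy]; ring_nf
  set A := 1 + 5 / 4 * y with hA
  set B := ρ * (1 + 3 / 4 * y) with hB
  have hA1 : 1 ≤ A := by rw [hA]; linarith
  have hB0 : 0 < B := by positivity
  -- Up to the factor `x / (ρ A)`, the difference of the dispersion relations is `A - B`.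
  -- Multiplication by `B + A` removes the root, the terms of order zero and one in `y` cancel, and
  -- `B + A` exceeds the remaining factor `1/2 + (9/16) y`; the bound therefore holds for all `y`,
  -- not only for small ones.
  have hprod : (B - A) * (B + A) = y ^ 2 * (1 / 2 + 9 / 16 * y) := by
    have : (B - A) * (B + A) = ρ ^ 2 * (1 + 3 / 4 * y) ^ 2 - A ^ 2 := by rw [hB]; ring
    rw [this, hρ2, hA]; ring
  have hBA0 : 0 ≤ B - A := by
    by_contra hneg
    have h1 : (B - A) * (B + A) < 0 := mul_neg_of_neg_of_pos (not_le.1 hneg) (by linarith)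
    have h2 : 0 ≤ y ^ 2 * (1 / 2 + 9 / 16 * y) := by positivity
    linarith
  have hBA : B - A ≤ y ^ 2 := by
    have h1 : 1 / 2 + 9 / 16 * y ≤ B + A := by rw [hA]; linarith
    by_contra hneg
    have h2 : y ^ 2 * (B + A) < (B - A) * (B + A) :=
      mul_lt_mul_of_pos_right (not_le.1 hneg) (by linarith)
    have h3 : y ^ 2 * (1 / 2 + 9 / 16 * y) ≤ y ^ 2 * (B + A) :=
      mul_le_mul_of_nonneg_left h1 (sq_nonneg y)
    linarith
  have hdiff : om δ η - kap δ η = x * ((A - B) / (ρ * A)) := by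
    rw [hom, hkap, hB]
    field_simp
  have hρA : 1 ≤ ρ * A := one_le_mul_of_one_le_of_one_le hρ1 hA1
  have h4 : |(A - B) / (ρ * A)| ≤ y ^ 2 := by
    rw [abs_div, abs_sub_comm, abs_of_nonneg hBA0, abs_of_nonneg (by linarith)]
    exact (div_le_self hBA0 hρA).trans hBA
  rw [hdiff, abs_mul]
  refine (mul_le_mul_of_nonneg_left h4 (abs_nonneg x)).trans (le_of_eq ?_)
  rw [hy, mul_pow, ← sq_abs x]
  ring

/-- After extraction of a unimodular factor the difference is `e^{-i(θ₁-θ₂)t} - 1`, to which the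
mean value inequality applies. -/
lemma norm_grpSymb_sub_le (θ₁ θ₂ : ℝ → ℝ) (t η : ℝ) :
    ‖grpSymb θ₁ t η - grpSymb θ₂ t η‖ ≤ |θ₁ η - θ₂ η| * |t| := by
  have h1 : grpSymb θ₁ t η - grpSymb θ₂ t η
      = grpSymb θ₂ t η * (grpSymb (θ₁ - θ₂) t η - grpSymb (θ₁ - θ₂) 0 η) := by
    rw [grpSymb_zero, mul_sub, mul_one]
    congr 1
    rw [grpSymb, grpSymb, grpSymb, ← Complex.exp_add]
    congr 1
    push_cast [Pi.sub_apply]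
    ring
  have hb : ‖grpSymb (θ₁ - θ₂) t η - grpSymb (θ₁ - θ₂) 0 η‖ ≤ |θ₁ η - θ₂ η| * ‖t - 0‖ :=
    Convex.norm_image_sub_le_of_norm_hasDerivWithin_le (s := univ)
      (fun x _ => (hasDerivAt_grpSymb (θ₁ - θ₂) x η).hasDerivWithinAt)
      (fun x _ => by
        rw [norm_mul, norm_grpSymb]
        simp only [Pi.sub_apply, Complex.ofReal_sub, norm_mul, norm_neg, Complex.norm_I, mul_one]
        rw [← Complex.ofReal_sub, Complex.norm_real, Real.norm_eq_abs]) convex_univ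
      (mem_univ 0) (mem_univ t)
  rw [h1, norm_mul, norm_grpSymb, one_mul]
  simpa using hb

/-- Comparison of the linear flows of the two equations. -/
lemma norm_emb_grp_sub_le {r s : ℝ} (hs : 0 ≤ s) (h : s + 5 ≤ r) (δ t : ℝ) (x y : SobolevH r) :
    ‖emb r s (grp (om δ) r t x - grp (kap δ) r t y)‖
      ≤ ‖emb r s (x - y)‖ + δ ^ 4 * |t| * ‖y‖ := by
  have hr : 0 ≤ r := by linarith
  have ho : IsPhase (om δ) := ⟨by unfold om; fun_prop, fun η => by simp [om, neg_div]⟩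
  have hk := isPhase_kap δ
  have e : grp (om δ) r t x - grp (kap δ) r t y
      = grp (om δ) r t (x - y) + (grp (om δ) r t y - grp (kap δ) r t y) := by
    rw [map_sub]; abel
  rw [e, map_add, emb_grp ho hs (by linarith)]
  refine (norm_add_le _ _).trans (add_le_add (norm_grp_apply_le ho hs t _) ?_)
  refine norm_le_of_fhat_le (by positivity) ?_
  filter_upwards [fhat_emb hs (by linarith) (grp (om δ) r t y - grp (kap δ) r t y),
    fhat_sub (grp (om δ) r t y) (grp (kap δ) r t y), fhat_grp ho hr t y, fhat_grp hk hr t y]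
    with η h1 h2 h3 h4
  rw [h1, h2, h3, h4, ← sub_mul, norm_mul]
  have h5 := (norm_grpSymb_sub_le (om δ) (kap δ) t η).trans
    (mul_le_mul_of_nonneg_right (abs_om_sub_kap_le δ η) (abs_nonneg t))
  have h6 : |2 * Real.pi * η| ^ 5 ≤ wt 5 η := by
    rw [show (5 : ℝ) = ((5 : ℕ) : ℝ) by norm_num, wt_natCast]
    exact pow_le_pow_left₀ (abs_nonneg _) (abs_le_wt_one η) 5
  have h7 : wt s η * wt 5 η ≤ wt r η := by rw [← wt_add]; exact wt_mono h η
  calc wt s η * (‖grpSymb (om δ) t η - grpSymb (kap δ) t η‖ * ‖fhat y η‖)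
      ≤ wt s η * (δ ^ 4 * wt 5 η * |t| * ‖fhat y η‖) := by
        gcongr
        · exact (wt_pos _ _).le
        · exact h5.trans (by gcongr)
    _ = δ ^ 4 * |t| * (wt s η * wt 5 η * ‖fhat y η‖) := by ring
    _ ≤ δ ^ 4 * |t| * (wt r η * ‖fhat y η‖) := by gcongr

/-- The symbol `√(1 + δ²ξ²)`. -/
noncomputable def sqrtSymb (δ η : ℝ) : ℂ := (Real.sqrt (1 + δ ^ 2 * (2 * Real.pi * η) ^ 2) : ℂ)

lemma isSymb_sqrtSymb {δ r r' : ℝ} (hδ : 0 ≤ δ) (hδ1 : δ ≤ 1) (hr' : 0 ≤ r') (h : r' + 1 ≤ r) :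
    IsSymb r r' 1 (sqrtSymb δ) where
  nonneg := hr'
  meas := by unfold sqrtSymb; fun_prop
  herm η := by simp [sqrtSymb]
  bound η := by
    rw [one_mul, sqrtSymb, Complex.norm_real, Real.norm_of_nonneg (Real.sqrt_nonneg _)]
    refine le_trans ?_ (wt_mono h η)
    rw [wt_add, mul_comm]
    refine mul_le_mul_of_nonneg_left ?_ (wt_pos _ _).le
    refine Real.sqrt_le_iff.2 ⟨(wt_pos _ _).le, ?_⟩
    rw [wt_one_sq]
    have : δ ^ 2 ≤ 1 := pow_le_one₀ hδ hδ1
    nlinarith [sq_nonneg (2 * Real.pi * η)]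

/-- The source of the error `δ²` that does not grow in time: it measures how far the exact splitting
of the data into waves is from that with `v₀` itself. -/
lemma norm_sqrtSymb_sub_one_le (δ η : ℝ) : ‖sqrtSymb δ η - 1‖ ≤ δ ^ 2 * wt 2 η := by
  have h1 := one_le_sqrt δ (2 * Real.pi * η)
  have h2 : 0 ≤ δ ^ 2 * (2 * Real.pi * η) ^ 2 := by positivity
  rw [sqrtSymb, ← Complex.ofReal_one, ← Complex.ofReal_sub, Complex.norm_real,
    Real.norm_of_nonneg (by linarith), wt_two, sub_le_iff_le_add]
  refine Real.sqrt_le_iff.2 ⟨by positivity, ?_⟩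
  nlinarith [sq_nonneg (δ ^ 2), sq_nonneg δ, mul_nonneg (sq_nonneg δ) h2, mul_nonneg h2 h2]

lemma sobolevENorm_toL2 {s : ℝ} (f : SobolevH s) : sobolevENorm s (toL2 s f) = ENNReal.ofReal ‖f‖ := by
  rw [norm_eq, ENNReal.ofReal_toReal (show sobolevENorm s (toL2 s f) ≠ ∞ from (memLp f).2.ne)]

/-- An explicit choice of the largest admissible small parameter. -/
lemma exists_small_parameter {T N K : ℝ} (hT : 0 < T) (hN : 0 ≤ N) : ∃ δstar : ℝ, 0 < δstar ∧
    δstar ≤ 1 ∧ ∀ ε N', 0 < ε → ε ≤ δstar → N' ≤ N →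
      2 * T * (ε * N') * Real.exp (2 * K * T) ≤ 1 := by
  set X := 2 * T * N * Real.exp (2 * K * T) with hX
  have hX0 : 0 ≤ X := by positivity
  refine ⟨1 / (X + 1), by positivity, ?_, fun ε N' hε h hN' => ?_⟩
  · rw [div_le_one (by positivity)]; linarith
  · have h1 : ε * (X + 1) ≤ 1 := by rwa [le_div_iff₀ (by positivity)] at h
    calc 2 * T * (ε * N') * Real.exp (2 * K * T) ≤ 2 * T * (ε * N) * Real.exp (2 * K * T) := by
          gcongr
      _ = ε * X := by rw [hX]; ring
      _ ≤ 1 := by nlinarith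

end Boussinesq

/-! ### The approximation theorem. -/

open Boussinesq Boussinesq.SobolevH in
theorem theorem5p1 (s : ℝ) (hs : 1 / 2 < s) (u₀ v₀ : Boussinesq.L2)
    (hu₀ : u₀ ∈ Boussinesq.sobolevSubmodule (s + 6))
    (hv₀ : v₀ ∈ Boussinesq.sobolevSubmodule (s + 7)) :
    ∃ C : ℝ, 0 < C ∧ ∀ tstar : ℝ, 0 < tstar →
      ∃ δstar : ℝ, 0 < δstar ∧ δstar ≤ 1 ∧
        ∀ ε δ : ℝ, 0 < ε → ε ≤ δ → δ ≤ δstar →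
          ∃ u wp wm : ℝ → Boussinesq.L2,
            Boussinesq.IsTheSolution (Boussinesq.IsIBSolution s ε δ u₀ v₀) tstar u ∧
            Boussinesq.IsTheSolution
              (Boussinesq.IsBBMSolution 1 (s + 5) ε δ ((1 / 2 : ℝ) • (u₀ - v₀))) tstar wp ∧
            Boussinesq.IsTheSolution
              (Boussinesq.IsBBMSolution (-1) (s + 5) ε δ ((1 / 2 : ℝ) • (u₀ + v₀))) tstar wm ∧
            ∀ t ∈ Set.Icc 0 tstar,
              Boussinesq.sobolevENorm s (u t - wp t - wm t) ≤
                ENNReal.ofReal (C * ((ε + δ ^ 2) + (ε + δ ^ 4) * t)) := by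
  -- The five derivatives are those lost in `abs_om_sub_kap_le`. One more, `u₀ ∈ H^{r+1}`, makes the
  -- forcing small, and `v₀` needs yet another because `√(1 + δ²ξ²)` is of order one.
  obtain ⟨r, hr⟩ : ∃ r, r = s + 5 := ⟨_, rfl⟩
  rw [← hr]
  rw [show s + 6 = r + 1 by rw [hr]; ring] at hu₀
  rw [show s + 7 = r + 2 by rw [hr]; ring] at hv₀
  obtain ⟨u1, rfl⟩ : ∃ f : SobolevH (r + 1), toL2 (r + 1) f = u₀ := ⟨⟨u₀, hu₀⟩, rfl⟩
  obtain ⟨v2, rfl⟩ : ∃ f : SobolevH (r + 2), toL2 (r + 2) f = v₀ := ⟨⟨v₀, hv₀⟩, rfl⟩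
  have hs0 : 0 ≤ s := by linarith
  have hr0 : 0 ≤ r := by linarith
  have hr1 : 0 ≤ r + 1 := by linarith
  have hrm : 0 ≤ r - 1 := by linarith
  have hle21 : r + 1 ≤ r + 2 := by linarith
  have hle10 : r ≤ r + 1 := by linarith
  have hles : s ≤ r - 1 := by linarith
  have hlem : r - 1 ≤ r := by linarith
  have hlesr : s ≤ r := by linarith
  set v1 := emb (r + 2) (r + 1) v2 with hv1
  have hv1L : toL2 (r + 1) v1 = toL2 (r + 2) v2 := toL2_emb hr1 hle21 v2
  set M := ‖u1‖ + ‖v2‖ with hM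
  have hM0 : 0 ≤ M := by positivity
  set B₀ := ‖sobMul r‖ with hB₀
  set N := ‖sobMul (r + 1)‖ * (2 * M) ^ 2 with hN
  set K := 8 * 1 * B₀ * (M + 1) + 1 with hK
  set C₁ := B₀ * (2 * (M + 1)) ^ 2 with hC₁
  have hC₁0 : 0 ≤ C₁ := by positivity
  have hN' : ‖sobMul (r + 1)‖ * M ^ 2 ≤ N := by
    rw [hN]
    refine mul_le_mul_of_nonneg_left ?_ (norm_nonneg (sobMul (r + 1)))
    nlinarith [sq_nonneg M]
  have hC₁' : B₀ * (M + 1) ^ 2 ≤ C₁ := by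
    rw [hC₁]
    refine mul_le_mul_of_nonneg_left ?_ (norm_nonneg (sobMul r))
    nlinarith
  -- The nonlinear errors contribute `2 C₁` for Boussinesq and `C₁` for each BBM equation, the two
  -- linear comparisons `M` each; the `1` ensures positivity. None of this involves `tstar`, which
  -- enters only the choice of `δstar`.
  refine ⟨4 * C₁ + 2 * M + 1, by positivity, fun tstar ht => ?_⟩
  obtain ⟨δstar, hd0, hd1, hsmall⟩ := exists_small_parameter (K := K) ht
    (show 0 ≤ N by positivity)
  refine ⟨δstar, hd0, hd1, fun ε δ hε hεδ hδs => ?_⟩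
  have hδ := hε.trans_le hεδ
  have hδ1 : δ ≤ 1 := hδs.trans hd1
  have hsymb : IsSymb (r + 2) (r + 1) 1 (sqrtSymb δ) :=
    isSymb_sqrtSymb hδ.le hδ1 hr1 (by linarith)
  -- The velocity of the linear waves with data `a`, `b` is `iω(b - a)`. It equals `iξ v₀` exactly
  -- when `b - a` is `√(1 + δ²ξ²) v₀`.
  set q := op (r + 2) (r + 1) (sqrtSymb δ) v2 with hq
  have hqn : ‖q‖ ≤ ‖v2‖ := (hsymb.norm_op_le v2).trans_eq (one_mul _)
  have hv1n : ‖v1‖ ≤ ‖v2‖ := norm_emb_le hr1 hle21 v2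
  have half (x : SobolevH (r + 1)) (hx : ‖x‖ ≤ ‖u1‖ + ‖v2‖) : ‖(1 / 2 : ℝ) • x‖ ≤ M := by
    rw [norm_smul, Real.norm_of_nonneg (by norm_num)]
    linarith [norm_nonneg x]
  have hsub (x : SobolevH (r + 1)) (hx : ‖x‖ ≤ ‖v2‖) : ‖(1 / 2 : ℝ) • (u1 - x)‖ ≤ M :=
    half _ ((norm_sub_le _ _).trans (by linarith))
  have hadd (x : SobolevH (r + 1)) (hx : ‖x‖ ≤ ‖v2‖) : ‖(1 / 2 : ℝ) • (u1 + x)‖ ≤ M :=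
    half _ ((norm_add_le _ _).trans (by linarith))
  set a := (1 / 2 : ℝ) • (u1 - q) with ha
  set b := (1 / 2 : ℝ) • (u1 + q) with hb
  set c := (1 / 2 : ℝ) • (u1 - v1) with hc
  set d := (1 / 2 : ℝ) • (u1 + v1) with hd
  have hab : a + b = u1 := by rw [ha, hb]; module
  have hba : b - a = q := by rw [ha, hb]; module
  have hsm := isSmoothing_om hδ
  have hweak : IsWeakDeriv (toL2 (r + 2) v2)
      (toL2 (r + 1) (skew (om δ) (r + 1) (r + 1) (b - a))) := by
    rw [isWeakDeriv_iff, hba]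
    filter_upwards [(hsm.isSkew hr1).fhat_skew q, hsymb.fhat_op v2] with η h1 h2
    change fhat _ η = _ * fhat v2 η
    rw [h1, hq, h2, om, sqrtSymb]
    have h3 : Real.sqrt (1 + δ ^ 2 * (2 * Real.pi * η) ^ 2) ≠ 0 :=
      (zero_lt_one.trans_le (one_le_sqrt δ _)).ne'
    generalize Real.sqrt (1 + δ ^ 2 * (2 * Real.pi * η) ^ 2) = ρ at h3 ⊢
    have h4 := Complex.ofReal_ne_zero.2 h3
    push_cast
    field_simp
  have hqv (σ : ℝ) (hσ : |σ| ≤ 1) (x y : SobolevH (r + 1)) (hxy : x - y = (σ / 2) • (q - v1)) :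
      ‖emb r s (emb (r + 1) r x - emb (r + 1) r y)‖ ≤ δ ^ 2 * M := by
    have h1 : ‖emb r s (emb (r + 1) r (q - v1))‖ ≤ δ ^ 2 * ‖v2‖ := by
      refine norm_le_of_fhat_le (by positivity) ?_
      filter_upwards [fhat_emb hs0 hlesr (emb (r + 1) r (q - v1)), fhat_emb hr0 hle10 (q - v1),
        fhat_sub q v1, hsymb.fhat_op v2, fhat_emb hr1 hle21 v2] with η e1 e2 e3 e4 e5
      rw [e1, e2, e3, hq, e4, hv1, e5, ← sub_one_mul, norm_mul]
      have h2 : wt s η * wt 2 η ≤ wt (r + 2) η := by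
        rw [← wt_add]; exact wt_mono (by linarith) η
      calc wt s η * (‖sqrtSymb δ η - 1‖ * ‖fhat v2 η‖)
          ≤ wt s η * (δ ^ 2 * wt 2 η * ‖fhat v2 η‖) := by
            have := norm_sqrtSymb_sub_one_le δ η
            have := (wt_pos s η).le
            gcongr
        _ = δ ^ 2 * (wt s η * wt 2 η * ‖fhat v2 η‖) := by ring
        _ ≤ _ := by gcongr
    rw [← map_sub, hxy, map_smul, map_smul, norm_smul, Real.norm_eq_abs, abs_div, abs_two]
    have h3 : ‖v2‖ ≤ M := by rw [hM]; linarith [norm_nonneg u1]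
    have h4 : δ ^ 2 * ‖v2‖ ≤ δ ^ 2 * M := by gcongr
    have h5 : |σ| / 2 ≤ 1 := by linarith
    calc |σ| / 2 * ‖emb r s (emb (r + 1) r (q - v1))‖
        ≤ 1 * ‖emb r s (emb (r + 1) r (q - v1))‖ := by gcongr
      _ ≤ δ ^ 2 * M := by linarith
  obtain ⟨U, hUsol, hUest⟩ := exists_ibSolution (s := s) (r := r) (T := tstar) (M := M) (by linarith)
    hs hlesr ht hε hεδ a b (hsub q hqn) (hadd q hqn) hweak (hsmall ε _ hε (hεδ.trans hδs) le_rfl)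
  obtain ⟨P, hPsol, hPest⟩ := exists_bbmSolution (σ := 1) (r := r) (T := tstar) (M := M)
    (by linarith) (by simp) ht hε hεδ c (hsub v1 hv1n) (hsmall ε _ hε (hεδ.trans hδs) hN')
  obtain ⟨Q, hQsol, hQest⟩ := exists_bbmSolution (σ := -1) (r := r) (T := tstar) (M := M)
    (by linarith) (by simp) ht hε hεδ d (hadd v1 hv1n) (hsmall ε _ hε (hεδ.trans hδs) hN')
  rw [hab] at hUsol
  have hcL : toL2 (r + 1) c = (1 / 2 : ℝ) • (toL2 (r + 1) u1 - toL2 (r + 2) v2) := by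
    rw [hc, map_smul, map_sub, hv1L]
  have hdL : toL2 (r + 1) d = (1 / 2 : ℝ) • (toL2 (r + 1) u1 + toL2 (r + 2) v2) := by
    rw [hd, map_smul, map_add, hv1L]
  rw [hcL] at hPsol
  rw [hdL] at hQsol
  refine ⟨_, _, _, ⟨hUsol, fun T' hT' u' hu' => ?_⟩, ⟨hPsol, fun T' hT' w' hw' => ?_⟩,
    ⟨hQsol, fun T' hT' w' hw' => ?_⟩, fun t htt => ?_⟩
  -- The constructed solution is restricted to the shorter interval, where uniqueness is applied.
  · exact ibSolution_unique hs hT'.1 hδ (hUsol.mono hs0 hT'.1 hT'.2) hu'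
  · exact bbmSolution_unique (by linarith) (by simp) hT'.1 hε hεδ
      (hPsol.mono (by linarith) hT'.1 hT'.2) hw'
  · exact bbmSolution_unique (by linarith) (by simp) hT'.1 hε hεδ
      (hQsol.mono (by linarith) hT'.1 hT'.2) hw'
  · have ht0 : 0 ≤ t := htt.1
    have hphase1 : bbmPhase 1 δ = kap δ := funext fun η => one_mul _
    have hphase2 : bbmPhase (-1) δ = -kap δ := funext fun η => by simp [bbmPhase]
    have hU := hUest t htt
    have hP := hPest t htt
    have hQ := hQest t htt
    rw [hphase1] at hP
    rw [hphase2, ← grp_neg] at hQ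
    have hlin1 := norm_emb_grp_sub_le hs0 hr.ge δ t (emb (r + 1) r a) (emb (r + 1) r c)
    have hlin2 := norm_emb_grp_sub_le hs0 hr.ge δ (-t) (emb (r + 1) r b) (emb (r + 1) r d)
    rw [abs_neg] at hlin2
    rw [abs_of_nonneg ht0] at hlin1 hlin2
    have hac := hqv (-1) (by simp) a c (by rw [ha, hc]; module)
    have hbd := hqv 1 (by simp) b d (by rw [hb, hd]; module)
    have hcM : ‖emb (r + 1) r c‖ ≤ M := (norm_emb_le hr0 hle10 c).trans (hsub v1 hv1n)
    have hdM : ‖emb (r + 1) r d‖ ≤ M := (norm_emb_le hr0 hle10 d).trans (hadd v1 hv1n)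
    set xU := U t - grp (om δ) r t (emb (r + 1) r a) - grp (om δ) r (-t) (emb (r + 1) r b)
    set xP := P t - grp (kap δ) r t (emb (r + 1) r c)
    set xQ := Q t - grp (kap δ) r (-t) (emb (r + 1) r d)
    set x1 := grp (om δ) r t (emb (r + 1) r a) - grp (kap δ) r t (emb (r + 1) r c)
    set x2 := grp (om δ) r (-t) (emb (r + 1) r b) - grp (kap δ) r (-t) (emb (r + 1) r d)
    -- Here `xU`, `xP`, `xQ` are the deviations from the linear flows, of size `ε t`; `x1` and `x2`
    -- compare the linear flows of right- and left-going waves.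
    have hdec : U t - P t - Q t = xU - xP - xQ + (x1 + x2) := by
      simp only [xU, xP, xQ, x1, x2]
      abel
    have hL2 : toL2 r (U t) - toL2 r (P t) - toL2 r (Q t)
        = toL2 s (emb r s (U t - P t - Q t)) := by
      rw [toL2_emb hs0 hlesr, map_sub, map_sub]
    have hfac (x : SobolevH r) : ‖emb r s x‖ ≤ ‖emb r (r - 1) x‖ := by
      have e : emb r s x = emb (r - 1) s (emb r (r - 1) x) := ext_toL2 (by
        rw [toL2_emb hs0 hlesr, toL2_emb hs0 hles, toL2_emb hrm hlem])
      rw [e]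
      exact norm_emb_le hs0 hles _
    have hsum : ‖emb r s (U t - P t - Q t)‖
        ≤ ‖emb r s xU‖ + ‖emb r s xP‖ + ‖emb r s xQ‖ + (‖emb r s x1‖ + ‖emb r s x2‖) := by
      rw [hdec, map_add, map_sub, map_sub, map_add]
      refine (norm_add_le _ _).trans (add_le_add ?_ (norm_add_le _ _))
      exact (norm_sub_le _ _).trans (add_le_add (norm_sub_le _ _) le_rfl)
    rw [hL2, sobolevENorm_toL2]
    refine ENNReal.ofReal_le_ofReal ?_
    have k1 : ‖emb r s xU‖ ≤ ε * (2 * C₁) * t := (hfac xU).trans hU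
    have k2 := ((hfac xP).trans hP).trans (show _ ≤ ε * C₁ * t by gcongr)
    have k3 := ((hfac xQ).trans hQ).trans (show _ ≤ ε * C₁ * t by gcongr)
    have k4 : ‖emb r s x1‖ ≤ δ ^ 2 * M + δ ^ 4 * t * M :=
      hlin1.trans (add_le_add hac (by gcongr))
    have k5 : ‖emb r s x2‖ ≤ δ ^ 2 * M + δ ^ 4 * t * M :=
      hlin2.trans (add_le_add hbd (by gcongr))
    have p1 : 0 ≤ C₁ * (δ ^ 4 * t) := by positivity
    have p2 : 0 ≤ C₁ * (ε + δ ^ 2) := by positivity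
    have p3 : 0 ≤ M * (ε + ε * t) := by positivity
    have p4 : 0 ≤ (ε + δ ^ 2) + (ε + δ ^ 4) * t := by positivity
    have e : (4 * C₁ + 2 * M + 1) * ((ε + δ ^ 2) + (ε + δ ^ 4) * t)
        = (ε * (2 * C₁) * t + ε * C₁ * t + ε * C₁ * t)
          + ((δ ^ 2 * M + δ ^ 4 * t * M) + (δ ^ 2 * M + δ ^ 4 * t * M))
          + 4 * (C₁ * (δ ^ 4 * t)) + 4 * (C₁ * (ε + δ ^ 2)) + 2 * (M * (ε + ε * t))
          + ((ε + δ ^ 2) + (ε + δ ^ 4) * t) := by ring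
    rw [e]
    linarith only [hsum, k1, k2, k3, k4, k5, p1, p2, p3, p4]
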